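/- Let $(\varepsilon_t)$ be i.i.d. with $E\varepsilon_1=0$, $\mathrm{Var}(\varepsilon_1)=\sigma^2>0$ and $E|\varepsilon_1|^{2+m}<\infty$ for some $m>0$. Let $c<0$, $\gamma\in(0,1)$, $k_n=n^\gamma$, $\rho_n=1+c/k_n$, let $(\mu_n)$ be a real sequence, and for each $n$ let $y_0=0$ and $y_t=\mu_n+\rho_n y_{t-1}+\varepsilon_t$ for $1\le t\le n$ (the dependence of $y_t$ on $n$ is suppressed). Put $$D_n=\mathrm{diag}(\sqrt n,\sqrt{nk_n}),\qquad B=\mathrm{diag}\bigl(1,\sigma^2/(-2c)\bigr),\qquad X_t=D_n^{-1}(1,y_{t-1})^\top .$$ (I) M-regression. Let $\varrho:\mathbb R\to\mathbb R$ be convex with left derivative $\psi$, let $q\in\mathbb R$ and $u_t=\varepsilon_t-q$. Suppose that $E\psi(u_1)=0$, that $E|\psi(u_1)|^{2+m}<\infty$ for some $m>0$, that $E\psi(u_1-\theta)^2<\infty$ for all $\theta$ near $0$, and that $\xi:=\bigl|\frac{\partial}{\partial\theta}E\psi(u_1-\theta)\bigr|_{\theta=0}$ exists and is nonzero. Let $(\hat\mu_n,\hat\rho_n)$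 be any minimizer of $(a,b)\mapsto\frac1n\sum_{t=1}^n\varrho(y_t-a-by_{t-1})$ over $\mathbb R^2$. Define the remainder $r_n$ by $$\begin{pmatrix}\hat\mu_n\\ \hat\rho_n\end{pmatrix}=\begin{pmatrix}\mu_n+q\\ \rho_n\end{pmatrix}+\frac{(BD_n)^{-1}}{\xi}\sum_{t=1}^n\psi(u_t)X_t+r_n .$$ Then $r_n=o_p(1)$ whenever $\mu_n=o(\sqrt n)$ (in particular for a fixed intercept), and moreover $D_nr_n=o_p(1)$ whenever $\mu_n=o(k_n^{-1/2})$ (in particular for $\mu_n=0$). If $E\psi(\varepsilon_1)=0$ one may take $q=0$ and $u_t=\varepsilon_t$. (II) Quantile regression. Let $\tau\in(0,1)$, let $\varepsilon_1$ have distribution function $F_\varepsilon$ and density $f_\varepsilon$, put $q=F_\varepsilon^{-1}(\tau)=\inf\{x:F_\varepsilon(x)\ge\tau\}$, and suppose that $F_\varepsilon$ is differentiable at $q$ with $F_\varepsilon'(q)=f_\varepsilon(q)>0$. Then the same conclusions hold for every minimizer $(\hat\mu_n(\tau),\hat\rho_n(\tau))$ with the loss $\varrho_\tau(u)=\tau u\mathbf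 1\{u>0\}-(1-\tau)u\mathbf 1\{u<0\}$, with $\psi(u)=\tau-\mathbf 1\{u\le0\}$, $\mu_n(\tau)=\mu_n+F_\varepsilon^{-1}(\tau)$ and $\xi=f_\varepsilon(F_\varepsilon^{-1}(\tau))$: $$\begin{pmatrix}\hat\mu_n(\tau)\\ \hat\rho_n(\tau)\end{pmatrix}=\begin{pmatrix}\mu_n+F_\varepsilon^{-1}(\tau)\\ \rho_n\end{pmatrix}+\frac{(BD_n)^{-1}}{f_\varepsilon(F_\varepsilon^{-1}(\tau))}\sum_{t=1}^n\bigl(\tau-\mathbf 1\{\varepsilon_t\le F_\varepsilon^{-1}(\tau)\}\bigr)X_t+r_n ,$$ with $r_n=o_p(1)$ if $\mu_n=o(\sqrt n)$, and $D_nr_n=o_p(1)$ if $\mu_n=o(k_n^{-1/2})$. -/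

import Mathlib

open MeasureTheory ProbabilityTheory Filter Topology
open scoped Matrix

noncomputable section

namespace NearStationaryAR

/-- The localizing sequence `k_n = n ^ γ`. -/
def k (γ : ℝ) (n : ℕ) : ℝ := (n : ℝ) ^ γ

/-- The autoregressive coefficient `ρ_n = 1 + c / k_n`. -/
def rho (c γ : ℝ) (n : ℕ) : ℝ := 1 + c / k γ n

/-- The AR(1) path `y_t = m + r * y_{t-1} + e_t` for `t ≥ 1`, started at `y_0 = 0`. -/
def path (m r : ℝ) (e : ℕ → ℝ) : ℕ → ℝ
  | 0 => 0
  | t + 1 => m + r * path m r e t + e (t + 1)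

/-- The triangular array `y_{n,t}` with intercepts `μ_n`, slopes `ρ_n` and innovations `ε_t`. -/
def y {Ω : Type*} (c γ : ℝ) (μ : ℕ → ℝ) (ε : ℕ → Ω → ℝ) (n t : ℕ) (ω : Ω) : ℝ :=
  path (μ n) (rho c γ n) (fun s => ε s ω) t

/-- `D_n = diag (√n, √(n k_n))`. -/
def D (γ : ℝ) (n : ℕ) : Matrix (Fin 2) (Fin 2) ℝ :=
  Matrix.diagonal ![√(n : ℝ), √((n : ℝ) * k γ n)]

/-- `B = diag (1, σ² / (-2c))`. -/
def B (σ c : ℝ) : Matrix (Fin 2) (Fin 2) ℝ :=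
  Matrix.diagonal ![1, σ ^ 2 / (-2 * c)]

/-- The normalized regressor `X_t = D_n⁻¹ (1, y_{t-1})ᵀ`, for `t ≥ 1`. -/
def X {Ω : Type*} (c γ : ℝ) (μ : ℕ → ℝ) (ε : ℕ → Ω → ℝ) (n t : ℕ) (ω : Ω) : Fin 2 → ℝ :=
  (D γ n)⁻¹ *ᵥ ![1, y c γ μ ε n (t - 1) ω]

/-- The objective function `R_n(a, b) = n⁻¹ ∑_{t=1}^n ϱ (y_t - a - b y_{t-1})`, `ϑ = (a, b)`. -/
def objective {Ω : Type*} (ϱ : ℝ → ℝ) (c γ : ℝ) (μ : ℕ → ℝ) (ε : ℕ → Ω → ℝ) (n : ℕ) (ω : Ω)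
    (ϑ : Fin 2 → ℝ) : ℝ :=
  (1 / (n : ℝ)) * ∑ t ∈ Finset.Icc 1 n,
    ϱ (y c γ μ ε n t ω - ϑ 0 - ϑ 1 * y c γ μ ε n (t - 1) ω)

/-- `ϑhat n = (μ̂_n, ρ̂_n)` is, for every `n`, almost surely a global minimizer over `ℝ²` of the
objective function with loss `ϱ`. -/
def IsMEstimator {Ω : Type*} [MeasurableSpace Ω] (P : Measure Ω) (ϱ : ℝ → ℝ) (c γ : ℝ)
    (μ : ℕ → ℝ) (ε : ℕ → Ω → ℝ) (ϑhat : ℕ → Ω → Fin 2 → ℝ) : Prop :=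
  ∀ n, ∀ᵐ ω ∂P, ∀ ϑ : Fin 2 → ℝ,
    objective ϱ c γ μ ε n ω (ϑhat n ω) ≤ objective ϱ c γ μ ε n ω ϑ

/-- The left derivative `ψ` of a loss function `ϱ` (it exists everywhere when `ϱ` is convex). -/
def leftDeriv (ϱ : ℝ → ℝ) (u : ℝ) : ℝ := derivWithin ϱ (Set.Iio u) u

/-- `ξ = |∂/∂θ E[ψ(U - θ)]|` at `θ = 0`. -/
def xi {Ω : Type*} [MeasurableSpace Ω] (P : Measure Ω) (ψ : ℝ → ℝ) (U : Ω → ℝ) : ℝ :=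
  |deriv (fun θ : ℝ => ∫ ω, ψ (U ω - θ) ∂P) 0|

/-- The remainder of the Bahadur representation of `ϑhat = (μ̂_n, ρ̂_n)`, with score `ψ`, slope `ξ`
and innovations re-centred at `q`:
`ϑhat_n - [(μ_n + q, ρ_n) + ξ⁻¹ (B D_n)⁻¹ ∑_{t=1}^n ψ(ε_t - q) X_t]`. -/
def remainder {Ω : Type*} (ψ : ℝ → ℝ) (ξ q σ c γ : ℝ) (μ : ℕ → ℝ) (ε : ℕ → Ω → ℝ)
    (ϑhat : ℕ → Ω → Fin 2 → ℝ) (n : ℕ) (ω : Ω) : Fin 2 → ℝ :=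
  ϑhat n ω - (![μ n + q, rho c γ n] +
    ξ⁻¹ • ((B σ c * D γ n)⁻¹ *ᵥ ∑ t ∈ Finset.Icc 1 n, ψ (ε t ω - q) • X c γ μ ε n t ω))

/-- The Bahadur representation: the remainder is `o_p(1)` provided that `μ_n = o(√n)` (for instance
a fixed intercept), and it is `o_p(1)` even after multiplication by `D_n` provided that
`μ_n = o(k_n^{-1/2})` (for instance a zero intercept). -/
def BahadurRepresentation {Ω : Type*} [MeasurableSpace Ω] (P : Measure Ω) (ψ : ℝ → ℝ)
    (ξ q σ c γ : ℝ) (μ : ℕ → ℝ) (ε : ℕ → Ω → ℝ) (ϑhat : ℕ → Ω → Fin 2 → ℝ) : Prop :=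
  (Tendsto (fun n : ℕ => μ n / √(n : ℝ)) atTop (𝓝 0) →
    TendstoInMeasure P (fun n ω => remainder ψ ξ q σ c γ μ ε ϑhat n ω) atTop (fun _ => 0)) ∧
  (Tendsto (fun n : ℕ => √(k γ n) * μ n) atTop (𝓝 0) →
    TendstoInMeasure P (fun n ω => D γ n *ᵥ remainder ψ ξ q σ c γ μ ε ϑhat n ω) atTop
      (fun _ => 0))

/-- The quantile loss `ϱ_τ(u) = τ u 1{u > 0} - (1 - τ) u 1{u < 0}`. -/
def checkLoss (τ u : ℝ) : ℝ :=
  (if 0 < u then τ * u else 0) - (if u < 0 then (1 - τ) * u else 0)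

/-- The quantile score `ψ(u) = τ - 1{u ≤ 0}`. -/
def quantileScore (τ u : ℝ) : ℝ := τ - (if u ≤ 0 then 1 else 0)

/-- The quantile function `F⁻¹(τ) = inf {x | τ ≤ F(x)}` of a probability measure on `ℝ`. -/
def quantile (ν : Measure ℝ) (τ : ℝ) : ℝ := sInf {x : ℝ | τ ≤ cdf ν x}

end NearStationaryAR

end

namespace NearStationaryAR

/-! Writing `m_n = μ_n / (1 - ρ_n)`, the deviation `z_t = y_t - m_n` follows the recursion without
intercept from `z_0 = -m_n`. Measure a candidate `(a, b)` by `v = (√n (a - μ_n - q + (b - ρ_n) m_n),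
s_n (b - ρ_n))` with `s_n² = (m_n² + n σ²) / (1 - ρ_n²)`. Its residual is then `u_t - v · Z_t` with
`Z_t = (1 / √n, z_{t-1} / s_n)`. These regressors are asymptotically orthonormal, `∑ Z_t Z_tᵀ → I`
in probability, and uniformly negligible, `max |Z_t| → 0` in probability. Neither fact requires a
condition on `μ_n`.

Up to a constant and a positive factor, the objective as a function of `v` is `∑ lossRem ϱ u_t (v ·
Z_t) - v · W_n`, where `W_n = ∑ ψ(u_t) Z_t = O_p(1)` is `scoreSum` and `lossRem` is what remains of
the loss after its linear part. Since `E lossRem ϱ u h` behaves like `ξ h² / 2` near `h = 0`, the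
compensator of the first sum is close to `(ξ / 2) ∑ (v · Z_t)²`, hence to `ξ |v|² / 2`. The
martingale part has a small second moment because `lossRem ϱ u h` is at most `|h|` times the
oscillation of `ψ` on a short interval, and that oscillation is small in `L²`. This is
`isLittleOP_sum_lossRem`. It is only pointwise in `v`, but convexity makes it uniform on bounded
sets, so the minimizer of the objective follows that of the quadratic form, `x_n = W_n / ξ + o_p(1)`
(`argmin_isLittleOP`).

Returning to the original coordinates is exact algebra (`remainder_apply`). It produces
deterministic coefficients in `m_n`, `s_n`, `n` and `k_n`, and the two assumptions on `μ_n` serve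
only to control their limits. Quantile regression is the special case of the check loss, where `E
ψ(u - θ) = τ - F(q + θ)`. -/

/-- `f_n = o_p(1)`. -/
def IsLittleOP {Ω : Type*} [MeasurableSpace Ω] (P : Measure Ω) (f : ℕ → Ω → ℝ) : Prop :=
  ∀ η : ℝ, 0 < η → Tendsto (fun n => P {ω | η ≤ |f n ω|}) atTop (𝓝 0)

/-- `f_n = O_p(1)`. -/
def IsBigOP {Ω : Type*} [MeasurableSpace Ω] (P : Measure Ω) (f : ℕ → Ω → ℝ) : Prop :=
  ∀ η : ENNReal, 0 < η → ∃ R : ℝ, ∀ᶠ n in atTop, P {ω | R ≤ |f n ω|} ≤ η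

/-! ### Calculus of `o_p(1)` and `O_p(1)`. -/

section Calculus

variable {Ω : Type*} [MeasurableSpace Ω] {P : Measure Ω} {f g : ℕ → Ω → ℝ}

theorem IsLittleOP.mono_ae (hg : IsLittleOP P g)
    (h : ∀ᶠ n in atTop, ∀ᵐ ω ∂P, |f n ω| ≤ |g n ω|) : IsLittleOP P f := by
  intro η hη
  refine tendsto_of_tendsto_of_tendsto_of_le_of_le' tendsto_const_nhds (hg η hη)
    (Eventually.of_forall fun _ => zero_le) ?_
  filter_upwards [h] with n hn
  refine measure_mono_ae ?_
  filter_upwards [hn] with ω hω h1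
  exact le_trans h1 hω

theorem IsLittleOP.mono (hg : IsLittleOP P g)
    (h : ∀ᶠ n in atTop, ∀ ω, |f n ω| ≤ |g n ω|) : IsLittleOP P f :=
  hg.mono_ae (h.mono fun _ hn => ae_of_all _ hn)

theorem IsLittleOP.congr (hg : IsLittleOP P g)
    (h : ∀ᶠ n in atTop, ∀ ω, f n ω = g n ω) : IsLittleOP P f :=
  hg.mono (h.mono fun _ hn ω => by rw [hn ω])

theorem IsBigOP.mono (hg : IsBigOP P g)
    (h : ∀ᶠ n in atTop, ∀ ω, |f n ω| ≤ |g n ω|) : IsBigOP P f := by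
  intro η hη
  obtain ⟨R, hR⟩ := hg η hη
  refine ⟨R, ?_⟩
  filter_upwards [hR, h] with n h1 h2
  exact (measure_mono fun ω (hω : R ≤ |f n ω|) => hω.trans (h2 ω)).trans h1

theorem IsLittleOP.add (hf : IsLittleOP P f) (hg : IsLittleOP P g) :
    IsLittleOP P (fun n ω => f n ω + g n ω) := by
  intro η hη
  have h := (hf (η / 2) (by positivity)).add (hg (η / 2) (by positivity))
  rw [add_zero] at h
  refine tendsto_of_tendsto_of_tendsto_of_le_of_le tendsto_const_nhds h
    (fun _ => zero_le) fun n => ?_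
  refine le_trans (measure_mono ?_) (measure_union_le _ _)
  intro ω (hω : η ≤ |f n ω + g n ω|)
  by_contra hcon
  simp only [Set.mem_union, Set.mem_ofPred_eq, not_or, not_le] at hcon
  have := abs_add_le (f n ω) (g n ω)
  linarith [hcon.1, hcon.2]

theorem IsBigOP.add (hf : IsBigOP P f) (hg : IsBigOP P g) :
    IsBigOP P (fun n ω => f n ω + g n ω) := by
  intro η hη
  obtain ⟨R, hR⟩ := hf (η / 2) (ENNReal.half_pos hη.ne')
  obtain ⟨S, hS⟩ := hg (η / 2) (ENNReal.half_pos hη.ne')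
  refine ⟨R + S, ?_⟩
  filter_upwards [hR, hS] with n h1 h2
  calc P {ω | R + S ≤ |f n ω + g n ω|}
      ≤ P ({ω | R ≤ |f n ω|} ∪ {ω | S ≤ |g n ω|}) := by
        refine measure_mono ?_
        intro ω (hω : R + S ≤ |f n ω + g n ω|)
        by_contra hcon
        simp only [Set.mem_union, Set.mem_ofPred_eq, not_or, not_le] at hcon
        have := abs_add_le (f n ω) (g n ω)
        linarith [hcon.1, hcon.2]
    _ ≤ η / 2 + η / 2 := (measure_union_le _ _).trans (add_le_add h1 h2)
    _ = η := ENNReal.add_halves η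

theorem IsLittleOP.isBigOP (hf : IsLittleOP P f) : IsBigOP P f := by
  intro η hη
  exact ⟨1, (ENNReal.tendsto_nhds_zero.1 (hf 1 one_pos)) η hη⟩

theorem IsBigOP.mul_tendsto {a : ℕ → ℝ} (hf : IsBigOP P f) (ha : Tendsto a atTop (𝓝 0)) :
    IsLittleOP P (fun n ω => a n * f n ω) := by
  intro η hη
  rw [ENNReal.tendsto_nhds_zero]
  intro δ hδ
  obtain ⟨R, hR⟩ := hf δ hδ
  have hb : 0 < η / (|R| + 1) := by positivity
  have h1 : Tendsto (fun n => |a n|) atTop (𝓝 0) := by simpa using ha.abs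
  filter_upwards [hR, h1.eventually (gt_mem_nhds hb)] with n h2 h3
  refine le_trans (measure_mono ?_) h2
  intro ω (hω : η ≤ |a n * f n ω|)
  show R ≤ |f n ω|
  by_contra hcon
  push Not at hcon
  rw [lt_div_iff₀ (by positivity)] at h3
  rw [abs_mul] at hω
  have : |a n| * |f n ω| ≤ |a n| * (|R| + 1) :=
    mul_le_mul_of_nonneg_left (by linarith [le_abs_self R]) (abs_nonneg _)
  linarith

theorem IsLittleOP.mul_bounded {a : ℕ → ℝ} (hf : IsLittleOP P f) (C : ℝ)
    (ha : ∀ᶠ n in atTop, |a n| ≤ C) : IsLittleOP P (fun n ω => a n * f n ω) := by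
  intro η hη
  refine tendsto_of_tendsto_of_tendsto_of_le_of_le' tendsto_const_nhds
    (hf (η / (|C| + 1)) (by positivity)) (Eventually.of_forall fun _ => zero_le) ?_
  filter_upwards [ha] with n hn
  refine measure_mono ?_
  intro ω (hω : η ≤ |a n * f n ω|)
  show η / (|C| + 1) ≤ |f n ω|
  rw [div_le_iff₀ (by positivity), mul_comm]
  rw [abs_mul] at hω
  exact hω.trans (mul_le_mul_of_nonneg_right (by linarith [le_abs_self C]) (abs_nonneg _))

theorem IsBigOP.mul_bounded {a : ℕ → ℝ} (hf : IsBigOP P f) (C : ℝ)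
    (ha : ∀ᶠ n in atTop, |a n| ≤ C) : IsBigOP P (fun n ω => a n * f n ω) := by
  intro η hη
  obtain ⟨R, hR⟩ := hf η hη
  refine ⟨(|C| + 1) * (|R| + 1), ?_⟩
  filter_upwards [hR, ha] with n h1 h2
  refine le_trans (measure_mono ?_) h1
  intro ω (hω : (|C| + 1) * (|R| + 1) ≤ |a n * f n ω|)
  show R ≤ |f n ω|
  by_contra hcon
  push Not at hcon
  rw [abs_mul] at hω
  have h3 : |a n| * |f n ω| ≤ |C| * |R| :=
    mul_le_mul (h2.trans (le_abs_self C)) (by linarith [le_abs_self R]) (abs_nonneg _)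
      (abs_nonneg _)
  nlinarith [abs_nonneg C, abs_nonneg R]

theorem IsLittleOP.const_mul (hf : IsLittleOP P f) (C : ℝ) :
    IsLittleOP P (fun n ω => C * f n ω) :=
  hf.mul_bounded |C| (Eventually.of_forall fun _ => le_rfl)

theorem IsLittleOP.sub (hf : IsLittleOP P f) (hg : IsLittleOP P g) :
    IsLittleOP P (fun n ω => f n ω - g n ω) :=
  (hf.add (hg.const_mul (-1))).congr (Eventually.of_forall fun n ω => by ring)

theorem measureReal_le_abs_le [IsFiniteMeasure P] {X : Ω → ℝ} (hX : MemLp X 2 P) {η : ℝ}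
    (hη : 0 < η) : P.real {ω | η ≤ |X ω|} ≤ (∫ ω, X ω ^ 2 ∂P) / η ^ 2 := by
  have h := mul_meas_ge_le_integral_of_nonneg (μ := P) (f := fun ω => X ω ^ 2)
    (ae_of_all _ fun ω => sq_nonneg _) hX.integrable_sq (η ^ 2)
  rw [le_div_iff₀ (by positivity), mul_comm]
  refine le_trans (le_of_eq ?_) h
  congr 2
  ext ω
  simp only [Set.mem_ofPred_eq]
  rw [← sq_abs (X ω)]
  exact (pow_le_pow_iff_left₀ hη.le (abs_nonneg _) two_ne_zero).symm

theorem measure_le_abs_le [IsFiniteMeasure P] {X : Ω → ℝ} (hX : MemLp X 2 P) {η : ℝ}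
    (hη : 0 < η) : P {ω | η ≤ |X ω|} ≤ ENNReal.ofReal ((∫ ω, X ω ^ 2 ∂P) / η ^ 2) := by
  rw [← ofReal_measureReal]
  exact ENNReal.ofReal_le_ofReal (measureReal_le_abs_le hX hη)

theorem isLittleOP_of_integral_sq [IsFiniteMeasure P] {a : ℕ → ℝ}
    (h : ∀ᶠ n in atTop, MemLp (f n) 2 P ∧ ∫ ω, f n ω ^ 2 ∂P ≤ a n)
    (ha : Tendsto a atTop (𝓝 0)) : IsLittleOP P f := by
  intro η hη
  have h0 : Tendsto (fun n => ENNReal.ofReal (a n / η ^ 2)) atTop (𝓝 0) := by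
    have := ENNReal.tendsto_ofReal (ha.div_const (η ^ 2))
    simpa using this
  refine tendsto_of_tendsto_of_tendsto_of_le_of_le' tendsto_const_nhds h0
    (Eventually.of_forall fun _ => zero_le) ?_
  filter_upwards [h] with n hn
  refine (measure_le_abs_le hn.1 hη).trans (ENNReal.ofReal_le_ofReal ?_)
  gcongr
  exact hn.2

theorem isBigOP_of_integral_sq [IsFiniteMeasure P] {C : ℝ}
    (h : ∀ᶠ n in atTop, MemLp (f n) 2 P ∧ ∫ ω, f n ω ^ 2 ∂P ≤ C) : IsBigOP P f := by
  intro η hη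
  have h0 : Tendsto (fun j : ℕ => ENNReal.ofReal (C / ((j : ℝ) + 1) ^ 2)) atTop (𝓝 0) := by
    have h1 : Tendsto (fun j : ℕ => C / ((j : ℝ) + 1) ^ 2) atTop (𝓝 0) := by
      refine tendsto_const_nhds.div_atTop ?_
      exact (tendsto_pow_atTop two_ne_zero).comp
        (tendsto_atTop_add_const_right _ _ tendsto_natCast_atTop_atTop)
    simpa using ENNReal.tendsto_ofReal h1
  obtain ⟨j, hj⟩ := ((ENNReal.tendsto_nhds_zero.1 h0) η hη).exists
  refine ⟨(j : ℝ) + 1, ?_⟩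
  filter_upwards [h] with n hn
  refine (measure_le_abs_le hn.1 (by positivity)).trans (le_trans (ENNReal.ofReal_le_ofReal ?_) hj)
  gcongr
  exact hn.2

theorem tendstoInMeasure_fin_two {r : ℕ → Ω → Fin 2 → ℝ}
    (h0 : IsLittleOP P (fun n ω => r n ω 0)) (h1 : IsLittleOP P (fun n ω => r n ω 1)) :
    TendstoInMeasure P r atTop (fun _ => 0) := by
  rw [tendstoInMeasure_iff_norm]
  intro η hη
  have h := (h0 η hη).add (h1 η hη)
  rw [add_zero] at h
  refine tendsto_of_tendsto_of_tendsto_of_le_of_le tendsto_const_nhds h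
    (fun _ => zero_le) fun n => ?_
  refine le_trans (measure_mono ?_) (measure_union_le _ _)
  intro ω (hω : η ≤ ‖r n ω - 0‖)
  by_contra hcon
  simp only [Set.mem_union, Set.mem_ofPred_eq, not_or, not_le] at hcon
  rw [sub_zero] at hω
  refine absurd hω (not_le.2 ((pi_norm_lt_iff hη).2 fun i => ?_))
  fin_cases i
  · exact hcon.1
  · exact hcon.2

end Calculus

/-! ### Algebra of the autoregressive recursion. -/

/-- The recursion `z_t = r z_{t-1} + e_t` started at `z_0 = z₀`. -/
def ar (r z₀ : ℝ) (e : ℕ → ℝ) : ℕ → ℝ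
  | 0 => z₀
  | t + 1 => r * ar r z₀ e t + e (t + 1)

/-- The constant `m / (1 - r)` is the fixed point of `x ↦ m + r x`, so the deviation from it obeys
the recursion without intercept. Starting at `y_0 = 0` means starting the deviation at minus the
fixed point. -/
theorem path_eq_ar {r : ℝ} (hr : r ≠ 1) (m : ℝ) (e : ℕ → ℝ) (t : ℕ) :
    path m r e t = m / (1 - r) + ar r (-(m / (1 - r))) e t := by
  have h : 1 - r ≠ 0 := sub_ne_zero.2 hr.symm
  induction t with
  | zero => simp [path, ar]
  | succ t ih =>
    rw [path, ar, ih]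
    field_simp
    ring

theorem ar_add (r a b : ℝ) (e f : ℕ → ℝ) (t : ℕ) :
    ar r (a + b) (fun s => e s + f s) t = ar r a e t + ar r b f t := by
  induction t with
  | zero => rfl
  | succ t ih => simp only [ar, ih]; ring

theorem ar_eq_pow_add (r z₀ : ℝ) (e : ℕ → ℝ) (t : ℕ) :
    ar r z₀ e t = r ^ t * z₀ + ar r 0 e t := by
  induction t with
  | zero => simp [ar]
  | succ t ih => rw [ar, ih, ar]; ring

/-- A crude bound growing with `t`. It only serves to make powers of the recursion integrable when
the innovations are bounded; the sharp moment bounds come later. -/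
theorem abs_ar_le {r K : ℝ} (hr0 : 0 ≤ r) (hr1 : r ≤ 1) {e : ℕ → ℝ} (he : ∀ t, |e t| ≤ K)
    (t : ℕ) : |ar r 0 e t| ≤ t * K := by
  induction t with
  | zero => simp [ar]
  | succ t ih =>
    rw [ar]
    refine (abs_add_le _ _).trans ?_
    rw [abs_mul, abs_of_nonneg hr0]
    have h1 : r * |ar r 0 e t| ≤ 1 * |ar r 0 e t| :=
      mul_le_mul_of_nonneg_right hr1 (abs_nonneg _)
    push_cast
    linarith [he (t + 1)]

/-! ### Independence of the next innovation from the past, and orthogonality of martingale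
differences. -/

section Independence

variable {Ω : Type*} [mΩ : MeasurableSpace Ω] {P : Measure Ω} [IsProbabilityMeasure P]
  {e : ℕ → Ω → ℝ}

/-- The natural filtration of the innovations. -/
noncomputable abbrev hist (hm : ∀ t, Measurable (e t)) : Filtration ℕ mΩ :=
  Filtration.natural e (fun t => (hm t).stronglyMeasurable)

theorem measurable_hist (hm : ∀ t, Measurable (e t)) {s t : ℕ} (hst : s ≤ t) :
    Measurable[hist hm t] (e s) :=
  ((Filtration.stronglyAdapted_natural
    (fun t => (hm t).stronglyMeasurable) s).measurable).mono ((hist hm).mono hst) le_rfl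

theorem measurable_ar_hist (hm : ∀ t, Measurable (e t)) (r z₀ : ℝ) (t : ℕ) :
    Measurable[hist hm t] (fun ω => ar r z₀ (fun s => e s ω) t) := by
  induction t with
  | zero => exact measurable_const
  | succ t ih =>
    exact ((ih.mono ((hist hm).mono t.le_succ) le_rfl).const_mul r).add
      (measurable_hist hm le_rfl)

theorem measurable_ar (hm : ∀ t, Measurable (e t)) (r z₀ : ℝ) (t : ℕ) :
    Measurable (fun ω => ar r z₀ (fun s => e s ω) t) :=
  (measurable_ar_hist hm r z₀ t).mono ((hist hm).le t) le_rfl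

-- The time index matters: the innovation at `t + 1` is paired with quantities known at time `t`,
-- just as `ε_t` is paired with the regressor `y_{t-1}`.
omit [IsProbabilityMeasure P] in
theorem indepFun_hist (hm : ∀ t, Measurable (e t)) (hi : iIndepFun e P) {β : Type*}
    [MeasurableSpace β] {t : ℕ} {K : Ω → β} (hK : Measurable[hist hm t] K) :
    IndepFun (e (t + 1)) K P := by
  have h := hi.indep_comap_natural_of_lt (fun t => (hm t).stronglyMeasurable) t.lt_succ_self
  exact indep_of_indep_of_le_right h hK.comap_le

/-- Independence turns the joint law into a product, and Fubini allows `Y` to be frozen before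
integrating over `X`. -/
theorem integral_comp_eq_zero_of_indepFun {α β : Type*} [MeasurableSpace α] [MeasurableSpace β]
    {X : Ω → α} {Y : Ω → β} (hX : Measurable X) (hY : Measurable Y) (hXY : IndepFun X Y P)
    {Φ : α → β → ℝ} (hΦ : Measurable (Function.uncurry Φ)) (h0 : ∀ y, ∫ ω, Φ (X ω) y ∂P = 0) :
    ∫ ω, Φ (X ω) (Y ω) ∂P = 0 := by
  by_cases hint : Integrable (fun ω => Φ (X ω) (Y ω)) P
  · have hmap := hXY.map_prod_eq_prod_map_map hX.aemeasurable hY.aemeasurable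
    have hpair : Measurable (fun ω => (X ω, Y ω)) := hX.prodMk hY
    have : IsProbabilityMeasure (P.map X) := Measure.isProbabilityMeasure_map hX.aemeasurable
    have : IsProbabilityMeasure (P.map Y) := Measure.isProbabilityMeasure_map hY.aemeasurable
    have h1 : ∫ ω, Φ (X ω) (Y ω) ∂P = ∫ p, Function.uncurry Φ p ∂(P.map fun ω => (X ω, Y ω)) := by
      rw [integral_map hpair.aemeasurable hΦ.aestronglyMeasurable]
      rfl
    have h2 : Integrable (Function.uncurry Φ) ((P.map X).prod (P.map Y)) := by
      rw [← hmap, integrable_map_measure hΦ.aestronglyMeasurable hpair.aemeasurable]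
      exact hint
    rw [h1, hmap, integral_prod_symm _ h2]
    refine integral_eq_zero_of_ae (ae_of_all _ fun y => ?_)
    show ∫ x, Φ x y ∂(P.map X) = 0
    have hy : Measurable (fun x => Φ x y) := hΦ.comp measurable_prodMk_right
    rw [integral_map hX.aemeasurable hy.aestronglyMeasurable]
    exact h0 y
  -- Without integrability the Bochner integral is zero by convention.
  · exact integral_undef hint

/-- Sums of martingale differences `Φ(e_{t+1}, H_t)` have orthogonal increments. -/
theorem integral_sq_sum_eq (hm : ∀ t, Measurable (e t)) (hi : iIndepFun e P) {Φ : ℝ → ℝ → ℝ}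
    (hΦ : Measurable (Function.uncurry Φ)) {H : ℕ → Ω → ℝ}
    (hH : ∀ t, Measurable[hist hm t] (H t))
    (h0 : ∀ t h, ∫ ω, Φ (e (t + 1) ω) h ∂P = 0)
    (hL : ∀ t, MemLp (fun ω => Φ (e (t + 1) ω) (H t ω)) 2 P) (n : ℕ) :
    ∫ ω, (∑ t ∈ Finset.range n, Φ (e (t + 1) ω) (H t ω)) ^ 2 ∂P =
      ∑ t ∈ Finset.range n, ∫ ω, Φ (e (t + 1) ω) (H t ω) ^ 2 ∂P := by
  induction n with
  | zero => simp
  | succ n ih =>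
    set S : Ω → ℝ := fun ω => ∑ t ∈ Finset.range n, Φ (e (t + 1) ω) (H t ω) with hS
    have hSm : Measurable[hist hm n] S := by
      refine Finset.measurable_sum _ fun t ht => ?_
      rw [Finset.mem_range] at ht
      have h1 : Measurable[hist hm n] (fun ω => (e (t + 1) ω, H t ω)) :=
        (measurable_hist hm ht).prodMk ((hH t).mono ((hist hm).mono ht.le) le_rfl)
      exact hΦ.comp h1
    have hS2 : MemLp S 2 P := memLp_finsetSum _ fun t _ => hL t
    -- The past sum `S` and `H n` are both known at time `n`. Treating the pair as one argument
    -- independent of `e (n + 1)`, the cross term vanishes because `Φ` has mean zero at every frozen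
    -- value.
    have hcross : ∫ ω, S ω * Φ (e (n + 1) ω) (H n ω) ∂P = 0 := by
      have hY : Measurable[hist hm n] (fun ω => (H n ω, S ω)) := (hH n).prodMk hSm
      refine integral_comp_eq_zero_of_indepFun (X := e (n + 1)) (Y := fun ω => (H n ω, S ω))
        (Φ := fun x p => p.2 * Φ x p.1) (hm _) (hY.mono ((hist hm).le n) le_rfl)
        (indepFun_hist hm hi hY) ?_ fun y => ?_
      · exact (measurable_snd.comp measurable_snd).mul
          (hΦ.comp (measurable_fst.prodMk (measurable_fst.comp measurable_snd)))
      · rw [integral_const_mul, h0, mul_zero]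
    have hexp : ∀ ω, (∑ t ∈ Finset.range (n + 1), Φ (e (t + 1) ω) (H t ω)) ^ 2 =
        S ω ^ 2 + 2 * (S ω * Φ (e (n + 1) ω) (H n ω)) + Φ (e (n + 1) ω) (H n ω) ^ 2 := fun ω => by
      rw [Finset.sum_range_succ, hS]; ring
    simp_rw [hexp]
    have i1 : Integrable (fun ω => S ω ^ 2) P := hS2.integrable_sq
    have i2 : Integrable (fun ω => S ω * Φ (e (n + 1) ω) (H n ω)) P := hS2.integrable_mul (hL n)
    have i3 : Integrable (fun ω => Φ (e (n + 1) ω) (H n ω) ^ 2) P := (hL n).integrable_sq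
    rw [integral_add (i1.fun_add (i2.const_mul 2)) i3, integral_add i1 (i2.const_mul 2),
      integral_const_mul, hcross, ih, Finset.sum_range_succ]
    ring

omit [IsProbabilityMeasure P] in
theorem memLp_mul_of_indepFun {X Y : Ω → ℝ} (hX : MemLp X 2 P) (hY : MemLp Y 2 P)
    (hXY : IndepFun X Y P) : MemLp (fun ω => X ω * Y ω) 2 P := by
  have h1 : Integrable (fun ω => X ω ^ 2 * Y ω ^ 2) P :=
    (hXY.comp (measurable_id.pow_const 2) (measurable_id.pow_const 2)).integrable_mul
      hX.integrable_sq hY.integrable_sq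
  refine (memLp_two_iff_integrable_sq (hX.1.mul hY.1)).2 (h1.congr (ae_of_all _ fun ω => ?_))
  simp only [mul_pow, Pi.mul_apply]

omit [IsProbabilityMeasure P] in
theorem integral_mul_sq_of_indepFun {X Y : Ω → ℝ} (hX : AEStronglyMeasurable X P)
    (hY : AEStronglyMeasurable Y P) (hXY : IndepFun X Y P) :
    ∫ ω, (X ω * Y ω) ^ 2 ∂P = (∫ ω, X ω ^ 2 ∂P) * ∫ ω, Y ω ^ 2 ∂P := by
  have h := (hXY.comp (measurable_id.pow_const 2)
    (measurable_id.pow_const 2)).integral_fun_mul_eq_mul_integral (hX.fun_pow 2) (hY.fun_pow 2)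
  simp only [Function.comp, id] at h
  simp only [mul_pow, h]

end Independence

/-! ### Second and fourth moments of the recursion. -/

section Moments

variable {Ω : Type*} [mΩ : MeasurableSpace Ω] {P : Measure Ω} [IsProbabilityMeasure P]
  {e : ℕ → Ω → ℝ}

theorem memLp_ar (hL : ∀ t, MemLp (e t) 2 P) (r z₀ : ℝ) (t : ℕ) :
    MemLp (fun ω => ar r z₀ (fun s => e s ω) t) 2 P := by
  induction t with
  | zero => exact memLp_const z₀
  | succ t ih => exact (ih.const_mul r).add (hL (t + 1))

omit [IsProbabilityMeasure P] in
theorem integral_ar_mul (hm : ∀ t, Measurable (e t)) (hi : iIndepFun e P)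
    (h0 : ∀ t, ∫ ω, e t ω ∂P = 0) (r z₀ : ℝ) (t : ℕ) :
    ∫ ω, e (t + 1) ω * ar r z₀ (fun s => e s ω) t ∂P = 0 := by
  rw [(indepFun_hist hm hi (measurable_ar_hist hm r z₀ t)).integral_fun_mul_eq_mul_integral
    (hm _).aestronglyMeasurable (measurable_ar hm r z₀ t).aestronglyMeasurable, h0, zero_mul]

theorem integral_ar_sq_succ (hm : ∀ t, Measurable (e t)) (hi : iIndepFun e P)
    (hL : ∀ t, MemLp (e t) 2 P) (h0 : ∀ t, ∫ ω, e t ω ∂P = 0) {v : ℝ}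
    (hv : ∀ t, ∫ ω, e t ω ^ 2 ∂P = v) (r z₀ : ℝ) (t : ℕ) :
    ∫ ω, ar r z₀ (fun s => e s ω) (t + 1) ^ 2 ∂P =
      r ^ 2 * ∫ ω, ar r z₀ (fun s => e s ω) t ^ 2 ∂P + v := by
  have hexp : ∀ ω, ar r z₀ (fun s => e s ω) (t + 1) ^ 2 =
      r ^ 2 * ar r z₀ (fun s => e s ω) t ^ 2 +
        2 * r * (e (t + 1) ω * ar r z₀ (fun s => e s ω) t) + e (t + 1) ω ^ 2 := fun ω => by
    rw [ar]; ring
  simp_rw [hexp]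
  have hz := memLp_ar hL r z₀ t
  have i1 := hz.integrable_sq
  have i2 : Integrable (fun ω => e (t + 1) ω * ar r z₀ (fun s => e s ω) t) P :=
    (hL _).integrable_mul hz
  rw [integral_add ((i1.const_mul _).fun_add (i2.const_mul _)) (hL _).integrable_sq,
    integral_add (i1.const_mul _) (i2.const_mul _), integral_const_mul, integral_const_mul,
    integral_ar_mul hm hi h0, hv]
  ring

/-- The value `v / (1 - r ^ 2)` is the fixed point of the variance recursion `a ↦ r ^ 2 * a + v`;
the initial condition is forgotten geometrically. -/
theorem integral_ar_sq_le (hm : ∀ t, Measurable (e t)) (hi : iIndepFun e P)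
    (hL : ∀ t, MemLp (e t) 2 P) (h0 : ∀ t, ∫ ω, e t ω ∂P = 0) {v : ℝ}
    (hv : ∀ t, ∫ ω, e t ω ^ 2 ∂P = v) {r : ℝ} (hr : r ^ 2 < 1) (z₀ : ℝ) (t : ℕ) :
    ∫ ω, ar r z₀ (fun s => e s ω) t ^ 2 ∂P ≤ (r ^ 2) ^ t * z₀ ^ 2 + v / (1 - r ^ 2) := by
  have hv0 : 0 ≤ v := by rw [← hv 0]; exact integral_nonneg fun ω => sq_nonneg _
  have hd : 0 < 1 - r ^ 2 := by linarith
  induction t with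
  | zero => simp [ar]; positivity
  | succ t ih =>
    rw [integral_ar_sq_succ hm hi hL h0 hv]
    have h1 := mul_le_mul_of_nonneg_left ih (sq_nonneg r)
    have h2 : r ^ 2 * (v / (1 - r ^ 2)) + v = v / (1 - r ^ 2) := by
      field_simp; ring
    rw [pow_succ _ t]
    linarith

/-- The variance recursion telescopes after multiplication by `1 - r ^ 2`, and the terminal second
moment is dropped. This is where the normalization `scale` comes from. -/
theorem sum_integral_ar_sq_le (hm : ∀ t, Measurable (e t)) (hi : iIndepFun e P)
    (hL : ∀ t, MemLp (e t) 2 P) (h0 : ∀ t, ∫ ω, e t ω ∂P = 0) {v : ℝ}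
    (hv : ∀ t, ∫ ω, e t ω ^ 2 ∂P = v) (r z₀ : ℝ) (n : ℕ) :
    (1 - r ^ 2) * ∑ t ∈ Finset.range n, ∫ ω, ar r z₀ (fun s => e s ω) t ^ 2 ∂P ≤
      z₀ ^ 2 + n * v := by
  have key : (1 - r ^ 2) * ∑ t ∈ Finset.range n, ∫ ω, ar r z₀ (fun s => e s ω) t ^ 2 ∂P =
      z₀ ^ 2 + n * v - ∫ ω, ar r z₀ (fun s => e s ω) n ^ 2 ∂P := by
    induction n with
    | zero => simp [ar]
    | succ n ih =>
      rw [Finset.sum_range_succ, mul_add, ih, integral_ar_sq_succ hm hi hL h0 hv]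
      push_cast; ring
  rw [key]
  have : 0 ≤ ∫ ω, ar r z₀ (fun s => e s ω) n ^ 2 ∂P := integral_nonneg fun ω => sq_nonneg _
  linarith

theorem integrable_pow_mul_pow {X Y : Ω → ℝ} {K L : ℝ} (hX : Measurable X) (hY : Measurable Y)
    (hXK : ∀ ω, |X ω| ≤ K) (hYL : ∀ ω, |Y ω| ≤ L) (i j : ℕ) :
    Integrable (fun ω => X ω ^ i * Y ω ^ j) P := by
  refine Integrable.of_bound ((hX.pow_const i).mul (hY.pow_const j)).aestronglyMeasurable
    (K ^ i * L ^ j) (ae_of_all _ fun ω => ?_)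
  rw [Real.norm_eq_abs, abs_mul, abs_pow, abs_pow]
  exact mul_le_mul (pow_le_pow_left₀ (abs_nonneg _) (hXK ω) i)
    (pow_le_pow_left₀ (abs_nonneg _) (hYL ω) j) (by positivity)
    (pow_nonneg ((abs_nonneg _).trans (hXK ω)) i)

omit [IsProbabilityMeasure P] in
theorem integral_pow_mul_pow {X Y : Ω → ℝ} (hX : Measurable X) (hY : Measurable Y)
    (hXY : IndepFun X Y P) (i j : ℕ) :
    ∫ ω, X ω ^ i * Y ω ^ j ∂P = (∫ ω, X ω ^ i ∂P) * ∫ ω, Y ω ^ j ∂P :=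
  (hXY.comp (measurable_id.pow_const i)
    (measurable_id.pow_const j)).integral_fun_mul_eq_mul_integral
      (hX.pow_const i).aestronglyMeasurable (hY.pow_const j).aestronglyMeasurable

theorem integral_ar_eq_zero (hL : ∀ t, MemLp (e t) 2 P) (h0 : ∀ t, ∫ ω, e t ω ∂P = 0) (r : ℝ)
    (t : ℕ) : ∫ ω, ar r 0 (fun s => e s ω) t ∂P = 0 := by
  induction t with
  | zero => simp [ar]
  | succ t ih =>
    simp only [ar]
    rw [integral_add (((memLp_ar hL r 0 t).integrable one_le_two).const_mul r)
      ((hL _).integrable one_le_two), integral_const_mul, ih, h0]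
    ring

/-- Expanding the fourth power of `r w + e`, the two odd mixed terms vanish because `e` and `w` are
independent and centred. The remaining source is at most `6 K ^ 4 / (1 - r ^ 2)` from the term
quadratic in each, plus `K ^ 4 ≤ K ^ 4 / (1 - r ^ 2)`, which explains the factor 7. The stated bound
is the fixed point of `a ↦ r ^ 2 * a + 7 * K ^ 4 / (1 - r ^ 2)`. -/
theorem integral_ar_pow_four_le (hm : ∀ t, Measurable (e t)) (hi : iIndepFun e P)
    {K : ℝ} (hK : ∀ t ω, |e t ω| ≤ K) (h0 : ∀ t, ∫ ω, e t ω ∂P = 0)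
    {v : ℝ} (hv : ∀ t, ∫ ω, e t ω ^ 2 ∂P = v) {r : ℝ} (hr0 : 0 ≤ r) (hr : r < 1) (t : ℕ) :
    ∫ ω, ar r 0 (fun s => e s ω) t ^ 4 ∂P ≤ 7 * K ^ 4 / (1 - r ^ 2) ^ 2 := by
  have hr2 : r ^ 2 < 1 := by nlinarith
  have hd : 0 < 1 - r ^ 2 := by linarith
  have hL : ∀ t, MemLp (e t) 2 P := fun t =>
    MemLp.of_bound (hm t).aestronglyMeasurable K (ae_of_all _ (hK t))
  have hv0 : 0 ≤ v := by rw [← hv 0]; exact integral_nonneg fun ω => sq_nonneg _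
  have hvK : v ≤ K ^ 2 := by
    rw [← hv 0]
    calc ∫ ω, e 0 ω ^ 2 ∂P ≤ ∫ _, K ^ 2 ∂P :=
          integral_mono (hL 0).integrable_sq (integrable_const _) fun ω => by
            rw [← sq_abs]; exact pow_le_pow_left₀ (abs_nonneg _) (hK 0 ω) 2
      _ = K ^ 2 := by simp
  induction t with
  | zero => simp [ar]; positivity
  | succ t ih =>
    set w : Ω → ℝ := fun ω => ar r 0 (fun s => e s ω) t with hw
    have hwm : Measurable w := measurable_ar hm r 0 t
    have hwb : ∀ ω, |w ω| ≤ t * K := fun ω => abs_ar_le hr0 hr.le (fun s => hK s ω) t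
    have hind : IndepFun (e (t + 1)) w P := indepFun_hist hm hi (measurable_ar_hist hm r 0 t)
    have hexp : ∀ ω, ar r 0 (fun s => e s ω) (t + 1) ^ 4 =
        r ^ 4 * (e (t + 1) ω ^ 0 * w ω ^ 4) + 4 * r ^ 3 * (e (t + 1) ω ^ 1 * w ω ^ 3) +
        6 * r ^ 2 * (e (t + 1) ω ^ 2 * w ω ^ 2) + 4 * r * (e (t + 1) ω ^ 3 * w ω ^ 1) +
        e (t + 1) ω ^ 4 * w ω ^ 0 := fun ω => by
      rw [ar, hw]; ring
    have I := integrable_pow_mul_pow (P := P) (hm (t + 1)) hwm (hK (t + 1)) hwb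
    have J := integral_pow_mul_pow (hm (t + 1)) hwm hind
    have w1 : ∫ ω, w ω ^ 1 ∂P = 0 := by simpa using integral_ar_eq_zero hL h0 r t
    have e1 : ∫ ω, e (t + 1) ω ^ 1 ∂P = 0 := by simpa using h0 (t + 1)
    have hval : ∫ ω, ar r 0 (fun s => e s ω) (t + 1) ^ 4 ∂P =
        r ^ 4 * ∫ ω, w ω ^ 4 ∂P + 6 * r ^ 2 * (v * ∫ ω, w ω ^ 2 ∂P) +
          ∫ ω, e (t + 1) ω ^ 4 ∂P := by
      simp_rw [hexp]
      rw [integral_add ((((I 0 4).const_mul _).fun_add ((I 1 3).const_mul _)).fun_add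
          ((I 2 2).const_mul _) |>.fun_add ((I 3 1).const_mul _)) (I 4 0),
        integral_add ((((I 0 4).const_mul _).fun_add ((I 1 3).const_mul _)).fun_add
          ((I 2 2).const_mul _)) ((I 3 1).const_mul _),
        integral_add (((I 0 4).const_mul _).fun_add ((I 1 3).const_mul _)) ((I 2 2).const_mul _),
        integral_add ((I 0 4).const_mul _) ((I 1 3).const_mul _)]
      simp only [integral_const_mul, J, w1, e1, hv]
      simp
    have e4 : ∫ ω, e (t + 1) ω ^ 4 ∂P ≤ K ^ 4 := by
      calc ∫ ω, e (t + 1) ω ^ 4 ∂P ≤ ∫ _, K ^ 4 ∂P :=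
            integral_mono (by simpa using I 4 0) (integrable_const _) fun ω => by
              have := pow_le_pow_left₀ (abs_nonneg _) (hK (t + 1) ω) 4
              rwa [← abs_pow, abs_of_nonneg (by positivity)] at this
        _ = K ^ 4 := by simp
    have w2 : ∫ ω, w ω ^ 2 ∂P ≤ K ^ 2 / (1 - r ^ 2) := by
      have := integral_ar_sq_le hm hi hL h0 hv hr2 0 t
      simp only [ne_eq, OfNat.ofNat_ne_zero, not_false_eq_true, zero_pow, mul_zero, zero_add]
        at this
      exact this.trans (by gcongr)
    have w20 : 0 ≤ ∫ ω, w ω ^ 2 ∂P := integral_nonneg fun ω => sq_nonneg _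
    rw [hval]
    have h1 : v * ∫ ω, w ω ^ 2 ∂P ≤ K ^ 2 * (K ^ 2 / (1 - r ^ 2)) :=
      mul_le_mul hvK w2 w20 (sq_nonneg _)
    have h2 : 6 * r ^ 2 * (v * ∫ ω, w ω ^ 2 ∂P) ≤ 6 * (K ^ 4 / (1 - r ^ 2)) := by
      calc 6 * r ^ 2 * (v * ∫ ω, w ω ^ 2 ∂P) ≤ 6 * 1 * (K ^ 2 * (K ^ 2 / (1 - r ^ 2))) := by
            gcongr
        _ = 6 * (K ^ 4 / (1 - r ^ 2)) := by ring
    have h3 : K ^ 4 ≤ K ^ 4 / (1 - r ^ 2) := by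
      rw [le_div_iff₀ hd]
      nlinarith [mul_nonneg (sq_nonneg r) (by positivity : 0 ≤ K ^ 4)]
    have h4 : r ^ 4 * ∫ ω, w ω ^ 4 ∂P ≤ r ^ 2 * (7 * K ^ 4 / (1 - r ^ 2) ^ 2) := by
      have : r ^ 4 ≤ r ^ 2 := pow_le_pow_of_le_one hr0 hr.le (by norm_num)
      exact mul_le_mul this ih (integral_nonneg fun ω => by positivity) (sq_nonneg _)
    have h5 : r ^ 2 * (7 * K ^ 4 / (1 - r ^ 2) ^ 2) + 7 * (K ^ 4 / (1 - r ^ 2)) =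
        7 * K ^ 4 / (1 - r ^ 2) ^ 2 := by
      field_simp; ring
    linarith

end Moments

/-! ### Laws of large numbers for the centred near-stationary array. -/

section

variable {Ω : Type*} [mΩ : MeasurableSpace Ω] {P : Measure Ω} [IsProbabilityMeasure P]

omit [IsProbabilityMeasure P] in
theorem IsLittleOP.sq {f : ℕ → Ω → ℝ} (hf : IsLittleOP P f) :
    IsLittleOP P (fun n ω => f n ω ^ 2) := by
  intro η hη
  refine (hf (√η) (Real.sqrt_pos.2 hη)).congr fun n => ?_
  congr 1
  ext ω
  simp only [Set.mem_ofPred_eq]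
  rw [abs_of_nonneg (sq_nonneg (f n ω)), ← sq_abs (f n ω), Real.sqrt_le_left (abs_nonneg _)]

theorem tendsto_measure_zero_of_real {S : ℕ → Set Ω}
    (h : ∀ κ : ℝ, 0 < κ → ∀ᶠ n in atTop, P.real (S n) ≤ κ) :
    Tendsto (fun n => P (S n)) atTop (𝓝 0) := by
  rw [← ENNReal.tendsto_toReal_zero_iff (fun n => measure_ne_top P (S n))]
  rw [Metric.tendsto_atTop']
  intro κ hκ
  obtain ⟨N, hN⟩ := eventually_atTop.1 (h (κ / 2) (by positivity))
  refine ⟨N, fun n hn => ?_⟩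
  have := hN n hn.le
  rw [Real.dist_eq, sub_zero, abs_of_nonneg ENNReal.toReal_nonneg]
  change P.real (S n) < κ
  linarith

/-- Independent, identically distributed, centred innovations with second moment `σ²`. -/
structure IsInnovation (P : Measure Ω) (e : ℕ → Ω → ℝ) (σ : ℝ) : Prop where
  meas : ∀ t, Measurable (e t)
  indep : iIndepFun e P
  ident : ∀ t, IdentDistrib (e t) (e 1) P P
  memLp : MemLp (e 1) 2 P
  mean : ∫ ω, e 1 ω ∂P = 0
  var : ∫ ω, e 1 ω ^ 2 ∂P = σ ^ 2
  pos : 0 < σ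

namespace IsInnovation

variable {e : ℕ → Ω → ℝ} {σ : ℝ}

omit [IsProbabilityMeasure P] in
theorem memLp' (he : IsInnovation P e σ) (t : ℕ) : MemLp (e t) 2 P :=
  (he.ident t).memLp_iff.2 he.memLp

omit [IsProbabilityMeasure P] in
theorem mean' (he : IsInnovation P e σ) (t : ℕ) : ∫ ω, e t ω ∂P = 0 := by
  rw [(he.ident t).integral_eq, he.mean]

omit [IsProbabilityMeasure P] in
theorem integral_comp (he : IsInnovation P e σ) {f : ℝ → ℝ} (hf : Measurable f) (t : ℕ) :
    ∫ ω, f (e t ω) ∂P = ∫ ω, f (e 1 ω) ∂P :=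
  ((he.ident t).comp hf).integral_eq

omit [IsProbabilityMeasure P] in
theorem var' (he : IsInnovation P e σ) (t : ℕ) : ∫ ω, e t ω ^ 2 ∂P = σ ^ 2 := by
  rw [he.integral_comp (f := fun x => x ^ 2) (measurable_id.pow_const 2), ← he.var]

end IsInnovation

/-- Autoregressive coefficients approaching one at a rate slower than `1 / n`. -/
structure IsNearStationary (r : ℕ → ℝ) : Prop where
  tendsto : Tendsto r atTop (𝓝 1)
  lt_one : ∀ᶠ n in atTop, r n < 1
  rate : Tendsto (fun n : ℕ => n * (1 - r n ^ 2)) atTop atTop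

theorem IsNearStationary.gap {r : ℕ → ℝ} (hr : IsNearStationary r) :
    Tendsto (fun n => 1 - r n ^ 2) atTop (𝓝 0) := by
  simpa using (hr.tendsto.pow 2).const_sub 1

theorem IsNearStationary.basic {r : ℕ → ℝ} (hr : IsNearStationary r) :
    ∀ᶠ n in atTop, 0 ≤ r n ∧ r n < 1 ∧ 0 < 1 - r n ^ 2 ∧ 0 < n := by
  filter_upwards [hr.lt_one, hr.tendsto.eventually (lt_mem_nhds (zero_lt_one)),
    eventually_gt_atTop 0] with n h1 h2 h3
  exact ⟨h2.le, h1, by nlinarith, h3⟩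

theorem IsNearStationary.inv_rate {r : ℕ → ℝ} (hr : IsNearStationary r) :
    Tendsto (fun n : ℕ => 1 / ((n : ℝ) * (1 - r n ^ 2))) atTop (𝓝 0) := by
  simp only [one_div]
  exact hr.rate.inv_tendsto_atTop

/-- The normalization `s_n` of the centred regressor. -/
noncomputable def scale (σ : ℝ) (r m : ℕ → ℝ) (n : ℕ) : ℝ :=
  √((m n ^ 2 + n * σ ^ 2) / (1 - r n ^ 2))

/-- The centred triangular array `z_{n,t} = y_{n,t} - m_n`. -/
def zArr (r m : ℕ → ℝ) (e : ℕ → Ω → ℝ) (n t : ℕ) (ω : Ω) : ℝ :=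
  ar (r n) (-(m n)) (fun s => e s ω) t

theorem scale_sq {σ : ℝ} {r m : ℕ → ℝ} {n : ℕ} (hd : 0 < 1 - r n ^ 2) :
    scale σ r m n ^ 2 = (m n ^ 2 + n * σ ^ 2) / (1 - r n ^ 2) :=
  Real.sq_sqrt (by positivity)

theorem scale_pos {σ : ℝ} (hσ : 0 < σ) {r m : ℕ → ℝ} {n : ℕ} (hd : 0 < 1 - r n ^ 2)
    (hn : 0 < n) : 0 < scale σ r m n := by
  have : (0 : ℝ) < n := by exact_mod_cast hn
  exact Real.sqrt_pos.2 (by positivity)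

/-- The start `-m n` of the centred array is of smaller order than the normalization, since `1 - r n
^ 2` tends to zero. The initial transient is therefore negligible in each single regressor, whatever
the size of `m n`. -/
theorem abs_le_scale {σ : ℝ} {r m : ℕ → ℝ} {n : ℕ} (hd : 0 < 1 - r n ^ 2) :
    |m n| ≤ √(1 - r n ^ 2) * scale σ r m n := by
  rw [scale, ← Real.sqrt_mul hd.le, mul_div_cancel₀ _ hd.ne']
  refine Real.le_sqrt_of_sq_le ?_
  rw [sq_abs]
  nlinarith [mul_nonneg (Nat.cast_nonneg (α := ℝ) n) (sq_nonneg σ)]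

variable {e : ℕ → Ω → ℝ} {σ : ℝ} {r : ℕ → ℝ} (m : ℕ → ℝ)

theorem integral_zArr_sq_le (he : IsInnovation P e σ) {n : ℕ}
    (hd : 0 < 1 - r n ^ 2) (hn : 0 < n) :
    ∫ ω, zArr r m e n n ω ^ 2 ∂P ≤ (m n ^ 2 + n * σ ^ 2) / (n * (1 - r n ^ 2)) := by
  have hn' : (0 : ℝ) < n := by exact_mod_cast hn
  have h := integral_ar_sq_le he.meas he.indep he.memLp' he.mean' he.var'
    (r := r n) (by linarith) (-(m n)) n
  -- The last power is at most the average of the first `n` powers, and their geometric sum is at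
  -- most `1 / (1 - r n ^ 2)`.
  have hpow : (r n ^ 2) ^ n ≤ 1 / (n * (1 - r n ^ 2)) := by
    rw [le_div_iff₀ (by positivity)]
    have h1 : (1 - r n ^ 2) * ∑ i ∈ Finset.range n, (r n ^ 2) ^ i = 1 - (r n ^ 2) ^ n := by
      have := geom_sum_mul (r n ^ 2) n
      linarith
    have h2 : (n : ℝ) * (r n ^ 2) ^ n ≤ ∑ i ∈ Finset.range n, (r n ^ 2) ^ i := by
      rw [← nsmul_eq_mul]
      refine le_trans (le_of_eq ?_) (Finset.card_nsmul_le_sum (Finset.range n) _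
        ((r n ^ 2) ^ n) fun i hi => ?_)
      · rw [Finset.card_range]
      · exact pow_le_pow_of_le_one (sq_nonneg _) (by linarith) (Finset.mem_range.1 hi).le
    have h3 := mul_le_mul_of_nonneg_left h2 hd.le
    have h4 : 0 ≤ (r n ^ 2) ^ n := by positivity
    nlinarith
  refine h.trans ?_
  calc (r n ^ 2) ^ n * (-(m n)) ^ 2 + σ ^ 2 / (1 - r n ^ 2)
      ≤ 1 / (n * (1 - r n ^ 2)) * (-(m n)) ^ 2 + σ ^ 2 / (1 - r n ^ 2) := by gcongr
    _ = (m n ^ 2 + n * σ ^ 2) / (n * (1 - r n ^ 2)) := by field_simp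

theorem sum_integral_zArr_sq_le (he : IsInnovation P e σ) {n : ℕ} (hd : 0 < 1 - r n ^ 2) :
    ∑ t ∈ Finset.range n, ∫ ω, zArr r m e n t ω ^ 2 ∂P ≤ scale σ r m n ^ 2 := by
  rw [scale_sq hd, le_div_iff₀ hd, mul_comm]
  have := sum_integral_ar_sq_le he.meas he.indep he.memLp' he.mean' he.var' (r n) (-(m n)) n
  rwa [neg_sq] at this

theorem memLp_zArr (he : IsInnovation P e σ) (n t : ℕ) : MemLp (zArr r m e n t) 2 P :=
  memLp_ar he.memLp' _ _ _

/-- The squared norm of a martingale transform of the centred array. -/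
theorem memLp_and_integral_sq_transform (he : IsInnovation P e σ) {φ : ℝ → ℝ} (hφ : Measurable φ)
    (hφ2 : MemLp (fun ω => φ (e 1 ω)) 2 P) (hφ0 : ∫ ω, φ (e 1 ω) ∂P = 0) {n : ℕ}
    (hd : 0 < 1 - r n ^ 2) :
    MemLp (fun ω => ∑ t ∈ Finset.range n, φ (e (t + 1) ω) * zArr r m e n t ω) 2 P ∧
    ∫ ω, (∑ t ∈ Finset.range n, φ (e (t + 1) ω) * zArr r m e n t ω) ^ 2 ∂P ≤
      (∫ ω, φ (e 1 ω) ^ 2 ∂P) * scale σ r m n ^ 2 := by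
  have hφt : ∀ t, MemLp (fun ω => φ (e t ω)) 2 P := fun t =>
    ((he.ident t).comp hφ).memLp_iff.2 hφ2
  have hz : ∀ t, Measurable[hist he.meas t] (zArr r m e n t) := fun t =>
    measurable_ar_hist he.meas _ _ t
  have hind : ∀ t, IndepFun (fun ω => φ (e (t + 1) ω)) (zArr r m e n t) P := fun t =>
    (indepFun_hist he.meas he.indep (hz t)).comp hφ measurable_id
  have hL : ∀ t, MemLp (fun ω => φ (e (t + 1) ω) * zArr r m e n t ω) 2 P := fun t =>
    memLp_mul_of_indepFun (hφt _) (memLp_zArr m he n t) (hind t)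
  refine ⟨memLp_finsetSum _ fun t _ => hL t, ?_⟩
  rw [integral_sq_sum_eq he.meas he.indep (Φ := fun x h => φ x * h)
    ((hφ.comp measurable_fst).mul measurable_snd) hz (fun t h => ?_) hL]
  · calc ∑ t ∈ Finset.range n, ∫ ω, (φ (e (t + 1) ω) * zArr r m e n t ω) ^ 2 ∂P
        = ∑ t ∈ Finset.range n,
          (∫ ω, φ (e 1 ω) ^ 2 ∂P) * ∫ ω, zArr r m e n t ω ^ 2 ∂P := by
          refine Finset.sum_congr rfl fun t _ => ?_
          rw [integral_mul_sq_of_indepFun (hφt _).1 (memLp_zArr m he n t).1 (hind t),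
            he.integral_comp (hφ.pow_const 2) (t + 1)]
      _ ≤ _ := by
          rw [← Finset.mul_sum]
          exact mul_le_mul_of_nonneg_left (sum_integral_zArr_sq_le m he hd)
            (integral_nonneg fun ω => sq_nonneg _)
  · rw [integral_mul_const, he.integral_comp hφ, hφ0, zero_mul]

theorem memLp_and_integral_sq_sum (he : IsInnovation P e σ) {φ : ℝ → ℝ} (hφ : Measurable φ)
    (hφ2 : MemLp (fun ω => φ (e 1 ω)) 2 P) (hφ0 : ∫ ω, φ (e 1 ω) ∂P = 0) (n : ℕ) :
    MemLp (fun ω => ∑ t ∈ Finset.range n, φ (e (t + 1) ω)) 2 P ∧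
    ∫ ω, (∑ t ∈ Finset.range n, φ (e (t + 1) ω)) ^ 2 ∂P = n * ∫ ω, φ (e 1 ω) ^ 2 ∂P := by
  have hφt : ∀ t, MemLp (fun ω => φ (e t ω)) 2 P := fun t =>
    ((he.ident t).comp hφ).memLp_iff.2 hφ2
  refine ⟨memLp_finsetSum _ fun t _ => hφt _, ?_⟩
  rw [integral_sq_sum_eq he.meas he.indep (Φ := fun x _ => φ x) (H := fun _ _ => 0)
    (hφ.comp measurable_fst) (fun _ => measurable_const) (fun t h => ?_) fun t => hφt _]
  · simp_rw [he.integral_comp (hφ.pow_const 2)]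
    simp
  · rw [he.integral_comp hφ, hφ0]

/-- The terminal value is the boundary term of the telescoped identity for `∑ z²`. Its relative
second moment is at most `1 / (n (1 - r n ^ 2))`, which vanishes because `r n` approaches one more
slowly than `1 / n`. -/
theorem isLittleOP_zArr_last (he : IsInnovation P e σ) (hr : IsNearStationary r) :
    IsLittleOP P (fun n ω => zArr r m e n n ω / √(m n ^ 2 + n * σ ^ 2)) := by
  refine isLittleOP_of_integral_sq ?_ hr.inv_rate
  filter_upwards [hr.basic] with n hn
  obtain ⟨h0, h1, hd, hpos⟩ := hn
  have hn' : (0 : ℝ) < n := by exact_mod_cast hpos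
  have hσ := he.pos
  have hA : 0 < m n ^ 2 + n * σ ^ 2 := by positivity
  refine ⟨by simpa only [div_eq_mul_inv] using (memLp_zArr m he n n).mul_const _, ?_⟩
  simp_rw [div_pow, Real.sq_sqrt hA.le]
  rw [integral_div, div_le_iff₀ hA]
  refine (integral_zArr_sq_le m he hd hpos).trans (le_of_eq ?_)
  ring

theorem isLittleOP_sum_sq_innovation (he : IsInnovation P e σ) :
    IsLittleOP P (fun n ω => (∑ t ∈ Finset.range n, e (t + 1) ω ^ 2) / n - σ ^ 2) := by
  have hsq : Measurable (fun x : ℝ => x ^ 2) := measurable_id.pow_const 2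
  have h := strong_law_ae_real (μ := P) (fun t ω => e (t + 1) ω ^ 2)
    (he.memLp' _).integrable_sq
    (fun i j hij => (he.indep.indepFun (by omega : i + 1 ≠ j + 1)).comp hsq hsq)
    (fun t => ((he.ident (t + 1)).trans (he.ident (0 + 1)).symm).comp hsq)
  have h2 : TendstoInMeasure P
      (fun n ω => (∑ t ∈ Finset.range n, e (t + 1) ω ^ 2) / (n : ℝ)) atTop (fun _ => σ ^ 2) := by
    refine tendstoInMeasure_of_tendsto_ae (fun n => ?_) ?_
    · exact ((Finset.measurable_sum _ fun t _ =>
        (he.meas (t + 1)).pow_const 2).div_const _).aestronglyMeasurable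
    · filter_upwards [h] with ω hω
      rwa [he.var'] at hω
  rw [tendstoInMeasure_iff_norm] at h2
  exact h2

-- Squaring `z_{t+1} = r z_t + e_{t+1}` and summing telescopes. It reduces `∑ z²` to a boundary
-- term, a martingale and `∑ e²`.
omit mΩ in
theorem zArr_sq_identity (n k : ℕ) (ω : Ω) :
    (1 - r n ^ 2) * ∑ t ∈ Finset.range k, zArr r m e n t ω ^ 2 =
      m n ^ 2 - zArr r m e n k ω ^ 2 +
        2 * r n * ∑ t ∈ Finset.range k, e (t + 1) ω * zArr r m e n t ω +
        ∑ t ∈ Finset.range k, e (t + 1) ω ^ 2 := by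
  induction k with
  | zero => simp [zArr, ar]
  | succ k ih =>
    rw [Finset.sum_range_succ, mul_add, ih, Finset.sum_range_succ, Finset.sum_range_succ]
    simp only [zArr, ar]
    ring

-- The linear analogue, obtained by summing the recursion itself.
omit mΩ in
theorem zArr_identity (n k : ℕ) (ω : Ω) :
    (1 - r n) * ∑ t ∈ Finset.range k, zArr r m e n t ω =
      -(m n) - zArr r m e n k ω + ∑ t ∈ Finset.range k, e (t + 1) ω := by
  induction k with
  | zero => simp [zArr, ar]
  | succ k ih =>
    rw [Finset.sum_range_succ, mul_add, ih, Finset.sum_range_succ]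
    simp only [zArr, ar]
    ring

/-- The law of large numbers for the squared centred regressor. -/
theorem isLittleOP_sum_zArr_sq (he : IsInnovation P e σ) (hr : IsNearStationary r) :
    IsLittleOP P (fun n ω =>
      (∑ t ∈ Finset.range n, zArr r m e n t ω ^ 2) / scale σ r m n ^ 2 - 1) := by
  have hσ := he.pos
  have h1 := (isLittleOP_zArr_last m he hr).sq
  -- The second moment of the martingale transform is at most `σ² s_n²`; after division by `(m² + n
  -- σ²)²` it is at most `1 / (n (1 - r n ^ 2))`.
  have h2 : IsLittleOP P (fun n ω =>
      (∑ t ∈ Finset.range n, e (t + 1) ω * zArr r m e n t ω) / (m n ^ 2 + n * σ ^ 2)) := by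
    refine isLittleOP_of_integral_sq ?_ hr.inv_rate
    filter_upwards [hr.basic] with n hn
    obtain ⟨h0, h1, hd, hpos⟩ := hn
    have hn' : (0 : ℝ) < n := by exact_mod_cast hpos
    have hA : 0 < m n ^ 2 + n * σ ^ 2 := by positivity
    obtain ⟨ha, hb⟩ := memLp_and_integral_sq_transform m he (φ := fun x => x) measurable_id
      he.memLp he.mean hd
    refine ⟨by simpa only [div_eq_mul_inv] using ha.mul_const _, ?_⟩
    simp_rw [div_pow]
    rw [integral_div, div_le_iff₀ (by positivity)]
    refine hb.trans ?_
    rw [he.var, scale_sq hd]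
    have : n * σ ^ 2 ≤ m n ^ 2 + n * σ ^ 2 := by nlinarith [sq_nonneg (m n)]
    calc σ ^ 2 * ((m n ^ 2 + n * σ ^ 2) / (1 - r n ^ 2))
        = 1 / (n * (1 - r n ^ 2)) * ((m n ^ 2 + n * σ ^ 2) * (n * σ ^ 2)) := by
          field_simp
      _ ≤ 1 / (n * (1 - r n ^ 2)) * ((m n ^ 2 + n * σ ^ 2) * (m n ^ 2 + n * σ ^ 2)) := by
          gcongr
      _ = _ := by ring
  have h3 := (isLittleOP_sum_sq_innovation he).mul_bounded
    (a := fun n : ℕ => n / (m n ^ 2 + n * σ ^ 2)) (1 / σ ^ 2) (by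
      filter_upwards [eventually_gt_atTop 0] with n hpos
      have hn' : (0 : ℝ) < n := by exact_mod_cast hpos
      rw [abs_of_nonneg (by positivity), div_le_div_iff₀ (by positivity) (by positivity)]
      nlinarith [sq_nonneg (m n)])
  have h4 := h2.mul_bounded (a := fun n => 2 * r n) 2 (by
    filter_upwards [hr.basic] with n hn
    rw [abs_of_nonneg (by linarith [hn.1])]; linarith [hn.2.1])
  -- This is `zArr_sq_identity` divided by `m² + n σ² = (1 - r²) s_n²`. The deterministic part of
  -- the right-hand side is exactly 1.
  refine ((h4.add h3).sub h1).congr ?_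
  filter_upwards [hr.basic] with n hn ω
  obtain ⟨h0, h1, hd, hpos⟩ := hn
  have hn' : (0 : ℝ) < n := by exact_mod_cast hpos
  have hA : 0 < m n ^ 2 + n * σ ^ 2 := by positivity
  have hid := zArr_sq_identity (r := r) m (e := e) n n ω
  have hq : (∑ t ∈ Finset.range n, zArr r m e n t ω ^ 2) / scale σ r m n ^ 2 =
      ((1 - r n ^ 2) * ∑ t ∈ Finset.range n, zArr r m e n t ω ^ 2) / (m n ^ 2 + n * σ ^ 2) := by
    rw [scale_sq hd]; field_simp
  rw [hq, hid, div_pow, Real.sq_sqrt hA.le]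
  field_simp
  ring

/-- The centred regressor is asymptotically orthogonal to the constant. -/
theorem isLittleOP_sum_zArr (he : IsInnovation P e σ) (hr : IsNearStationary r) :
    IsLittleOP P (fun n ω =>
      (∑ t ∈ Finset.range n, zArr r m e n t ω) / (√n * scale σ r m n)) := by
  have hσ := he.pos
  -- The constant is `3 * 4`: a factor 3 for the square of a sum of three terms in `zArr_identity`,
  -- and a factor 4 from `1 - r² ≤ 2 (1 - r)`.
  have hlim : Tendsto (fun n : ℕ => 12 * (1 + 1 / ((n : ℝ) * (1 - r n ^ 2))) *
      (1 / ((n : ℝ) * (1 - r n ^ 2)))) atTop (𝓝 0) := by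
    have := ((hr.inv_rate.const_add 1).const_mul 12).mul hr.inv_rate
    simpa using this
  refine isLittleOP_of_integral_sq ?_ hlim
  filter_upwards [hr.basic] with n hn
  obtain ⟨h0, h1, hd, hpos⟩ := hn
  have hn' : (0 : ℝ) < n := by exact_mod_cast hpos
  have hA : 0 < m n ^ 2 + n * σ ^ 2 := by positivity
  have hs := scale_pos (m := m) he.pos hd hpos
  obtain ⟨ha, hb⟩ := memLp_and_integral_sq_sum he (φ := fun x => x) measurable_id
    he.memLp he.mean n
  refine ⟨by simpa only [div_eq_mul_inv] using
    (memLp_finsetSum _ fun t _ => memLp_zArr m he n t).mul_const _, ?_⟩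
  have h1r : 0 < 1 - r n := by linarith
  have hz := memLp_zArr (r := r) m he n n
  have hpt : ∀ ω, ((∑ t ∈ Finset.range n, zArr r m e n t ω) / (√n * scale σ r m n)) ^ 2 ≤
      4 / (n * (1 - r n ^ 2) * (m n ^ 2 + n * σ ^ 2)) * (3 * (m n ^ 2 + zArr r m e n n ω ^ 2 +
        (∑ t ∈ Finset.range n, e (t + 1) ω) ^ 2)) := by
    intro ω
    have hid := zArr_identity (r := r) m (e := e) n n ω
    set T := ∑ t ∈ Finset.range n, zArr r m e n t ω
    set S := ∑ t ∈ Finset.range n, e (t + 1) ω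
    set Z := zArr r m e n n ω
    have hT : ((1 - r n) * T) ^ 2 ≤ 3 * (m n ^ 2 + Z ^ 2 + S ^ 2) := by
      rw [hid]
      nlinarith [sq_nonneg (m n - Z), sq_nonneg (m n + S), sq_nonneg (Z + S)]
    have hd2 : (1 - r n ^ 2) ^ 2 ≤ 4 * (1 - r n) ^ 2 := by
      have : 1 - r n ^ 2 = (1 - r n) * (1 + r n) := by ring
      rw [this, mul_pow, mul_comm]
      refine mul_le_mul_of_nonneg_right ?_ (sq_nonneg _)
      nlinarith
    have hT2 : (1 - r n ^ 2) ^ 2 * T ^ 2 ≤ 4 * (3 * (m n ^ 2 + Z ^ 2 + S ^ 2)) := by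
      calc (1 - r n ^ 2) ^ 2 * T ^ 2 ≤ 4 * (1 - r n) ^ 2 * T ^ 2 :=
            mul_le_mul_of_nonneg_right hd2 (sq_nonneg _)
        _ = 4 * ((1 - r n) * T) ^ 2 := by ring
        _ ≤ _ := by linarith
    have heq : (T / (√n * scale σ r m n)) ^ 2 =
        ((1 - r n ^ 2) ^ 2 * T ^ 2) / (n * (1 - r n ^ 2) * (m n ^ 2 + n * σ ^ 2)) := by
      rw [div_pow, mul_pow, Real.sq_sqrt hn'.le, scale_sq hd]
      field_simp
    rw [heq, div_mul_eq_mul_div]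
    gcongr
  have hint : Integrable (fun ω => m n ^ 2 + zArr r m e n n ω ^ 2 +
        (∑ t ∈ Finset.range n, e (t + 1) ω) ^ 2) P :=
    ((integrable_const _).add hz.integrable_sq).add ha.integrable_sq
  refine (integral_mono_of_nonneg (ae_of_all _ fun ω => sq_nonneg _)
    ((hint.const_mul 3).const_mul _) (ae_of_all _ hpt)).trans ?_
  rw [integral_const_mul, integral_const_mul,
    integral_add ((integrable_const _).fun_add hz.integrable_sq) ha.integrable_sq,
    integral_add (integrable_const _) hz.integrable_sq, hb, he.var]
  simp only [integral_const, probReal_univ, one_smul]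
  have hzz := integral_zArr_sq_le m he hd hpos
  have hnd : 0 < n * (1 - r n ^ 2) := by positivity
  calc 4 / (n * (1 - r n ^ 2) * (m n ^ 2 + n * σ ^ 2)) *
        (3 * (m n ^ 2 + ∫ ω, zArr r m e n n ω ^ 2 ∂P + n * σ ^ 2))
      ≤ 4 / (n * (1 - r n ^ 2) * (m n ^ 2 + n * σ ^ 2)) *
        (3 * (m n ^ 2 + (m n ^ 2 + n * σ ^ 2) / (n * (1 - r n ^ 2)) + n * σ ^ 2)) := by
        gcongr
    _ = 12 * (1 + 1 / ((n : ℝ) * (1 - r n ^ 2))) * (1 / ((n : ℝ) * (1 - r n ^ 2))) := by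
        field_simp; ring

end

/-! ### Truncation of the innovations and uniform negligibility of the regressors. -/

section

variable {Ω : Type*} [mΩ : MeasurableSpace Ω] {P : Measure Ω} [IsProbabilityMeasure P]

/-- Truncation at level `K`. -/
noncomputable def trunc (K x : ℝ) : ℝ := if |x| ≤ K then x else 0

theorem measurable_trunc (K : ℝ) : Measurable (trunc K) :=
  Measurable.ite (measurableSet_le measurable_norm measurable_const) measurable_id
    measurable_const

theorem abs_trunc_le {K : ℝ} (hK : 0 ≤ K) (x : ℝ) : |trunc K x| ≤ K := by
  unfold trunc
  split_ifs with h
  · exact h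
  · simpa using hK

theorem abs_sub_trunc_le (K x : ℝ) : |x - trunc K x| ≤ |x| := by
  unfold trunc
  split_ifs with h <;> simp

omit [IsProbabilityMeasure P] in
theorem tendsto_integral_sub_trunc_sq {X : Ω → ℝ} (hX : Measurable X) (hL : MemLp X 2 P) :
    Tendsto (fun j : ℕ => ∫ ω, (X ω - trunc j (X ω)) ^ 2 ∂P) atTop (𝓝 0) := by
  have h : Tendsto (fun j : ℕ => ∫ ω, (X ω - trunc j (X ω)) ^ 2 ∂P) atTop
      (𝓝 (∫ _, (0 : ℝ) ∂P)) := by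
    refine tendsto_integral_of_dominated_convergence (fun ω => X ω ^ 2) (fun j => ?_)
      hL.integrable_sq (fun j => ae_of_all _ fun ω => ?_) (ae_of_all _ fun ω => ?_)
    · exact ((hX.sub ((measurable_trunc j).comp hX)).pow_const 2).aestronglyMeasurable
    · rw [Real.norm_eq_abs, abs_of_nonneg (sq_nonneg _), ← sq_abs, ← sq_abs (X ω)]
      exact pow_le_pow_left₀ (abs_nonneg _) (abs_sub_trunc_le _ _) 2
    · refine tendsto_const_nhds.congr' ?_
      obtain ⟨J, hJ⟩ := exists_nat_ge |X ω|
      filter_upwards [eventually_ge_atTop J] with j hj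
      have : |X ω| ≤ j := hJ.trans (by exact_mod_cast hj)
      rw [trunc, if_pos this]
      ring
  simpa using h

theorem measureReal_le_abs_le_four {X : Ω → ℝ} (hX : MemLp (fun ω => X ω ^ 2) 2 P)
    {η : ℝ} (hη : 0 < η) : P.real {ω | η ≤ |X ω|} ≤ (∫ ω, X ω ^ 4 ∂P) / η ^ 4 := by
  have h := measureReal_le_abs_le hX (pow_pos hη 2)
  have hset : {ω | η ≤ |X ω|} = {ω | η ^ 2 ≤ |X ω ^ 2|} := by
    ext ω
    simp only [Set.mem_ofPred_eq]
    rw [abs_pow, pow_le_pow_iff_left₀ hη.le (abs_nonneg _) two_ne_zero]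
  rw [hset]
  refine h.trans (le_of_eq ?_)
  simp only [← pow_mul]

variable {e : ℕ → Ω → ℝ} {σ : ℝ} {r : ℕ → ℝ} (m : ℕ → ℝ)

/-- The tail bound for the stationary part, for a given truncation level. -/
theorem measureReal_ar_le (he : IsInnovation P e σ) (K : ℝ) (hK : 0 ≤ K) {n : ℕ}
    (hr0 : 0 ≤ r n) (hr1 : r n < 1) (hd : 0 < 1 - r n ^ 2) (hn : 0 < n) {δ : ℝ} (hδ : 0 < δ)
    (t : ℕ) :
    P.real {ω | δ * scale σ r m n ≤ |ar (r n) 0 (fun s => e s ω) t|} ≤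
      1792 * K ^ 4 / (δ ^ 4 * σ ^ 4 * n ^ 2) +
        4 * (∫ ω, (e 1 ω - trunc K (e 1 ω)) ^ 2 ∂P) / (δ ^ 2 * σ ^ 2 * n) := by
  have hn' : (0 : ℝ) < n := by exact_mod_cast hn
  have hσ := he.pos
  have hs := scale_pos (m := m) hσ hd hn
  set S := scale σ r m n with hS
  -- Both tail bounds use only the part of the normalization due to the innovations. Splitting each
  -- innovation into a recentred truncation `f` and a remainder `g`, the bounded part is controlled
  -- by a fourth moment and the unbounded part by a small second moment.
  have hS2 : n * σ ^ 2 / (1 - r n ^ 2) ≤ S ^ 2 := by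
    rw [hS, scale_sq hd]
    gcongr
    nlinarith [sq_nonneg (m n)]
  set b := ∫ ω, trunc K (e 1 ω) ∂P with hb
  set f : ℝ → ℝ := fun x => trunc K x - b with hf
  set g : ℝ → ℝ := fun x => x - f x with hg
  have hfm : Measurable f := (measurable_trunc K).sub_const b
  have hgm : Measurable g := measurable_id.sub hfm
  have hTL : MemLp (fun ω => trunc K (e 1 ω)) 2 P :=
    MemLp.of_bound ((measurable_trunc K).comp (he.meas 1)).aestronglyMeasurable K
      (ae_of_all _ fun ω => abs_trunc_le hK _)
  have hbK : |b| ≤ K := by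
    have := norm_integral_le_of_norm_le_const (μ := P) (f := fun ω => trunc K (e 1 ω)) (C := K)
      (ae_of_all _ fun ω => abs_trunc_le hK _)
    simpa using this
  have hfb : ∀ t ω, |f (e t ω)| ≤ 2 * K := fun t ω => by
    refine (abs_sub _ _).trans ?_
    linarith [abs_trunc_le hK (e t ω)]
  have hfi : iIndepFun (fun t ω => f (e t ω)) P := he.indep.comp _ fun _ => hfm
  have hgi : iIndepFun (fun t ω => g (e t ω)) P := he.indep.comp _ fun _ => hgm
  have hf0 : ∀ t, ∫ ω, f (e t ω) ∂P = 0 := fun t => by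
    rw [he.integral_comp hfm, hf]
    simp only
    rw [integral_sub (hTL.integrable one_le_two) (integrable_const _), ← hb]
    simp
  have hfL : ∀ t, MemLp (fun ω => f (e t ω)) 2 P := fun t =>
    MemLp.of_bound (hfm.comp (he.meas t)).aestronglyMeasurable (2 * K) (ae_of_all _ (hfb t))
  have hgL : ∀ t, MemLp (fun ω => g (e t ω)) 2 P := fun t => (he.memLp' t).sub (hfL t)
  have hg0 : ∀ t, ∫ ω, g (e t ω) ∂P = 0 := fun t => by
    rw [hg]
    simp only
    rw [integral_sub ((he.memLp' t).integrable one_le_two) ((hfL t).integrable one_le_two),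
      he.mean', hf0, sub_zero]
  -- Recentring can only decrease a second moment: the truncated-off part has mean `-b`, and `g` is
  -- that part minus its mean.
  have hgv : ∫ ω, g (e 1 ω) ^ 2 ∂P ≤ ∫ ω, (e 1 ω - trunc K (e 1 ω)) ^ 2 ∂P := by
    have hU : MemLp (fun ω => e 1 ω - trunc K (e 1 ω)) 2 P := he.memLp.sub hTL
    have hUm : ∫ ω, (e 1 ω - trunc K (e 1 ω)) ∂P = -b := by
      rw [integral_sub (he.memLp.integrable one_le_two) (hTL.integrable one_le_two), he.mean,
        zero_sub]
    have hx : ∀ ω, g (e 1 ω) ^ 2 = (e 1 ω - trunc K (e 1 ω)) ^ 2 +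
        2 * b * (e 1 ω - trunc K (e 1 ω)) + b ^ 2 := fun ω => by
      simp only [hg, hf]; ring
    simp_rw [hx]
    rw [integral_add (hU.integrable_sq.fun_add ((hU.integrable one_le_two).const_mul _))
      (integrable_const _), integral_add hU.integrable_sq
      ((hU.integrable one_le_two).const_mul _), integral_const_mul, hUm]
    simp only [integral_const, probReal_univ, one_smul]
    nlinarith [sq_nonneg b]
  have hsplit : ∀ ω, ar (r n) 0 (fun s => e s ω) t =
      ar (r n) 0 (fun s => f (e s ω)) t + ar (r n) 0 (fun s => g (e s ω)) t := fun ω => by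
    rw [← ar_add, add_zero]
    simp only [hg, add_sub_cancel]
  have hsub : {ω | δ * S ≤ |ar (r n) 0 (fun s => e s ω) t|} ⊆
      {ω | δ / 2 * S ≤ |ar (r n) 0 (fun s => f (e s ω)) t|} ∪
        {ω | δ / 2 * S ≤ |ar (r n) 0 (fun s => g (e s ω)) t|} := by
    intro ω (hω : δ * S ≤ |ar (r n) 0 (fun s => e s ω) t|)
    by_contra hcon
    simp only [Set.mem_union, Set.mem_ofPred_eq, not_or, not_le] at hcon
    rw [hsplit] at hω
    have := abs_add_le (ar (r n) 0 (fun s => f (e s ω)) t) (ar (r n) 0 (fun s => g (e s ω)) t)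
    linarith [hcon.1, hcon.2]
  -- Each half is tested at level `δ / 2`. The constant 1792 is `7 * 2 ^ 4 * 2 ^ 4`, where one `2 ^
  -- 4` comes from the bound `2 * K` on `f` and the other from the halved level; the constant 4 is
  -- the squared halving.
  refine (measureReal_mono hsub).trans ((measureReal_union_le _ _).trans (add_le_add ?_ ?_))
  · have hwm := measurable_ar (fun t => hfm.comp (he.meas t)) (r n) 0 t
    have hw2 : MemLp (fun ω => ar (r n) 0 (fun s => f (e s ω)) t ^ 2) 2 P := by
      refine MemLp.of_bound (hwm.pow_const 2).aestronglyMeasurable ((t * (2 * K)) ^ 2)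
        (ae_of_all _ fun ω => ?_)
      rw [Real.norm_eq_abs, abs_pow]
      exact pow_le_pow_left₀ (abs_nonneg _) (abs_ar_le hr0 hr1.le (fun s => hfb s ω) t) 2
    refine (measureReal_le_abs_le_four hw2 (by positivity)).trans ?_
    have h4 := integral_ar_pow_four_le (fun t => hfm.comp (he.meas t)) hfi hfb hf0
      (fun t => he.integral_comp (hfm.pow_const 2) t) hr0 hr1 t
    have hS4 : n ^ 2 * σ ^ 4 / (1 - r n ^ 2) ^ 2 ≤ S ^ 4 := by
      calc n ^ 2 * σ ^ 4 / (1 - r n ^ 2) ^ 2 = (n * σ ^ 2 / (1 - r n ^ 2)) ^ 2 := by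
            rw [div_pow]; ring
        _ ≤ (S ^ 2) ^ 2 := pow_le_pow_left₀ (by positivity) hS2 2
        _ = S ^ 4 := by ring
    calc (∫ ω, ar (r n) 0 (fun s => f (e s ω)) t ^ 4 ∂P) / (δ / 2 * S) ^ 4
        ≤ (7 * (2 * K) ^ 4 / (1 - r n ^ 2) ^ 2) /
            ((δ / 2) ^ 4 * (n ^ 2 * σ ^ 4 / (1 - r n ^ 2) ^ 2)) := by
          rw [mul_pow]
          gcongr
          exact h4
      _ = 1792 * K ^ 4 / (δ ^ 4 * σ ^ 4 * n ^ 2) := by field_simp; ring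
  · have hw := memLp_ar hgL (r n) 0 t
    refine (measureReal_le_abs_le hw (by positivity)).trans ?_
    have h2 := integral_ar_sq_le (fun t => hgm.comp (he.meas t)) hgi hgL hg0
      (fun t => he.integral_comp (hgm.pow_const 2) t) (r := r n) (by linarith) 0 t
    simp only [ne_eq, OfNat.ofNat_ne_zero, not_false_eq_true, zero_pow, mul_zero, zero_add] at h2
    calc (∫ ω, ar (r n) 0 (fun s => g (e s ω)) t ^ 2 ∂P) / (δ / 2 * S) ^ 2
        ≤ ((∫ ω, (e 1 ω - trunc K (e 1 ω)) ^ 2 ∂P) / (1 - r n ^ 2)) /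
            ((δ / 2) ^ 2 * (n * σ ^ 2 / (1 - r n ^ 2))) := by
          rw [mul_pow]
          have : 0 ≤ ∫ ω, (e 1 ω - trunc K (e 1 ω)) ^ 2 ∂P :=
            integral_nonneg fun ω => sq_nonneg _
          gcongr
          exact h2.trans (by gcongr)
      _ = 4 * (∫ ω, (e 1 ω - trunc K (e 1 ω)) ^ 2 ∂P) / (δ ^ 2 * σ ^ 2 * n) := by
          field_simp; ring

/-- The normalized centred regressors are uniformly asymptotically negligible. -/
theorem tendsto_measure_exists_zArr (he : IsInnovation P e σ) (hr : IsNearStationary r)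
    {δ : ℝ} (hδ : 0 < δ) :
    Tendsto (fun n => P {ω | ∃ t < n, δ * scale σ r m n ≤ |zArr r m e n t ω|}) atTop (𝓝 0) := by
  have hσ := he.pos
  refine tendsto_measure_zero_of_real fun κ hκ => ?_
  -- A union bound costs a factor `n`. The fourth-moment term is of order `n⁻²` and survives it. The
  -- second-moment term is only of order `n⁻¹`, so the truncation level `K` is fixed beforehand to
  -- make its coefficient at most `κ / 2`.
  have hc : 0 < κ / 2 * ((δ / 2) ^ 2 * σ ^ 2) / 4 := by positivity
  obtain ⟨K, hK⟩ := ((tendsto_integral_sub_trunc_sq (he.meas 1) he.memLp).eventually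
    (gt_mem_nhds hc)).exists
  have hlim : Tendsto (fun n : ℕ => 1792 * (K : ℝ) ^ 4 / ((δ / 2) ^ 4 * σ ^ 4) / (n : ℝ)) atTop
      (𝓝 0) := tendsto_const_nhds.div_atTop tendsto_natCast_atTop_atTop
  have hgap : Tendsto (fun n => √(1 - r n ^ 2)) atTop (𝓝 0) := by
    have := (Real.continuous_sqrt.tendsto 0).comp hr.gap
    rwa [Real.sqrt_zero] at this
  filter_upwards [hr.basic, hlim.eventually (gt_mem_nhds (half_pos hκ)),
    hgap.eventually (gt_mem_nhds (half_pos hδ))] with n hn hn1 hn2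
  obtain ⟨h0, h1, hd, hpos⟩ := hn
  have hn' : (0 : ℝ) < n := by exact_mod_cast hpos
  have hs := scale_pos (m := m) hσ hd hpos
  have hsub : {ω | ∃ t < n, δ * scale σ r m n ≤ |zArr r m e n t ω|} ⊆
      ⋃ t ∈ Finset.range n,
        {ω | δ / 2 * scale σ r m n ≤ |ar (r n) 0 (fun s => e s ω) t|} := by
    rintro ω ⟨t, ht, hω⟩
    simp only [Set.mem_iUnion, Finset.mem_range]
    refine ⟨t, ht, ?_⟩
    show δ / 2 * scale σ r m n ≤ _
    -- Half of the level `δ` absorbs the deterministic transient `r^t (-m)`, which `abs_le_scale`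
    -- makes small relative to `scale`.
    rw [zArr, ar_eq_pow_add] at hω
    have ha := abs_add_le (r n ^ t * -(m n)) (ar (r n) 0 (fun s => e s ω) t)
    have hb : |r n ^ t * -(m n)| ≤ δ / 2 * scale σ r m n := by
      rw [abs_mul, abs_neg, abs_of_nonneg (pow_nonneg h0 t)]
      calc r n ^ t * |m n| ≤ 1 * |m n| :=
            mul_le_mul_of_nonneg_right (pow_le_one₀ h0 h1.le) (abs_nonneg _)
        _ ≤ √(1 - r n ^ 2) * scale σ r m n := by rw [one_mul]; exact abs_le_scale hd
        _ ≤ _ := mul_le_mul_of_nonneg_right hn2.le hs.le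
    linarith
  calc P.real {ω | ∃ t < n, δ * scale σ r m n ≤ |zArr r m e n t ω|}
      ≤ ∑ t ∈ Finset.range n,
          P.real {ω | δ / 2 * scale σ r m n ≤ |ar (r n) 0 (fun s => e s ω) t|} :=
        (measureReal_mono hsub (measure_ne_top _ _)).trans (measureReal_biUnion_finset_le _ _)
    _ ≤ ∑ t ∈ Finset.range n, (1792 * (K : ℝ) ^ 4 / ((δ / 2) ^ 4 * σ ^ 4 * n ^ 2) +
        4 * (∫ ω, (e 1 ω - trunc K (e 1 ω)) ^ 2 ∂P) / ((δ / 2) ^ 2 * σ ^ 2 * n)) :=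
        Finset.sum_le_sum fun t _ =>
          measureReal_ar_le m he K (Nat.cast_nonneg K) h0 h1 hd hpos (by positivity) t
    _ = 1792 * (K : ℝ) ^ 4 / ((δ / 2) ^ 4 * σ ^ 4) / n +
        4 * (∫ ω, (e 1 ω - trunc K (e 1 ω)) ^ 2 ∂P) / ((δ / 2) ^ 2 * σ ^ 2) := by
        rw [Finset.sum_const, Finset.card_range, nsmul_eq_mul]
        field_simp
    _ ≤ κ / 2 + κ / 2 := by
        refine add_le_add hn1.le ?_
        rw [div_le_iff₀ (by positivity)]
        linarith
    _ = κ := add_halves κ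

end

/-! ### Convex losses, their scores and the expected second-order remainder. -/

section ConvexLoss

variable {ϱ : ℝ → ℝ}

theorem leftDeriv_mono (hϱ : ConvexOn ℝ Set.univ ϱ) : Monotone (leftDeriv ϱ) := by
  have h := hϱ.monotoneOn_leftDeriv
  rw [interior_univ, monotoneOn_univ] at h
  exact h

theorem leftDeriv_mul_sub_le (hϱ : ConvexOn ℝ Set.univ ϱ) (x y : ℝ) :
    leftDeriv ϱ x * (y - x) ≤ ϱ y - ϱ x := by
  have hx : x ∈ interior (Set.univ : Set ℝ) := by simp
  rcases lt_trichotomy x y with h | h | h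
  · have h1 := (hϱ.leftDeriv_le_rightDeriv_of_mem_interior hx).trans
      (hϱ.rightDeriv_le_slope_of_mem_interior hx (Set.mem_univ y) h)
    rw [slope_def_field, le_div_iff₀ (sub_pos.2 h)] at h1
    exact h1
  · subst h; simp
  · have h1 := hϱ.slope_le_leftDeriv_of_mem_interior (Set.mem_univ y) hx h
    rw [slope_def_field, div_le_iff₀ (sub_pos.2 h)] at h1
    unfold leftDeriv
    linarith

/-- The second-order remainder of a loss function with score `leftDeriv ϱ`. -/
noncomputable def lossRem (ϱ : ℝ → ℝ) (u h : ℝ) : ℝ := ϱ (u - h) - ϱ u + h * leftDeriv ϱ u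

theorem lossRem_nonneg (hϱ : ConvexOn ℝ Set.univ ϱ) (u h : ℝ) : 0 ≤ lossRem ϱ u h := by
  have := leftDeriv_mul_sub_le hϱ u (u - h)
  unfold lossRem
  linarith

/-- Applies the subgradient inequality for `ϱ` at `u - s`. After taking expectations, it exhibits
`-E ψ(U - s)` as a subgradient of the mean remainder, with no differentiation under the integral. -/
theorem lossRem_sub_ge (hϱ : ConvexOn ℝ Set.univ ϱ) (u s t : ℝ) :
    (t - s) * (leftDeriv ϱ u - leftDeriv ϱ (u - s)) ≤ lossRem ϱ u t - lossRem ϱ u s := by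
  have := leftDeriv_mul_sub_le hϱ (u - s) (u - t)
  unfold lossRem
  linarith

/-- The oscillation of the score around `u`. -/
noncomputable def scoreOsc (ϱ : ℝ → ℝ) (δ u : ℝ) : ℝ := leftDeriv ϱ (u + δ) - leftDeriv ϱ (u - δ)

theorem scoreOsc_mono (hϱ : ConvexOn ℝ Set.univ ϱ) (u : ℝ) : Monotone (fun δ => scoreOsc ϱ δ u) := by
  intro a b hab
  have h1 := leftDeriv_mono hϱ (by linarith : u + a ≤ u + b)
  have h2 := leftDeriv_mono hϱ (by linarith : u - b ≤ u - a)
  simp only [scoreOsc]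
  linarith

theorem scoreOsc_nonneg (hϱ : ConvexOn ℝ Set.univ ϱ) {δ : ℝ} (hδ : 0 ≤ δ) (u : ℝ) :
    0 ≤ scoreOsc ϱ δ u := by
  have h1 := leftDeriv_mono hϱ (by linarith : u - δ ≤ u + δ)
  simp only [scoreOsc]
  linarith

/-- The subgradient inequality between `h` and `0` bounds the remainder by `|h|` times an increment
of the monotone score inside `[u - δ, u + δ]`. This separates the shift from the innovation, so that
independence can be used on the product. -/
theorem lossRem_le (hϱ : ConvexOn ℝ Set.univ ϱ) {δ h : ℝ} (hh : |h| ≤ δ) (u : ℝ) :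
    lossRem ϱ u h ≤ |h| * scoreOsc ϱ δ u := by
  have hδ : 0 ≤ δ := (abs_nonneg h).trans hh
  have h1 := lossRem_sub_ge hϱ u h 0
  have h2 : lossRem ϱ u 0 = 0 := by simp [lossRem]
  rw [h2] at h1
  obtain ⟨ha, hb⟩ := abs_le.1 hh
  have m1 := leftDeriv_mono hϱ (by linarith : u - δ ≤ u - h)
  have m2 := leftDeriv_mono hϱ (by linarith : u - h ≤ u + δ)
  have m3 := leftDeriv_mono hϱ (by linarith : u - δ ≤ u)
  have m4 := leftDeriv_mono hϱ (by linarith : u ≤ u + δ)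
  have h3 : |leftDeriv ϱ u - leftDeriv ϱ (u - h)| ≤ scoreOsc ϱ δ u := by
    unfold scoreOsc
    rw [abs_le]
    constructor <;> linarith
  calc lossRem ϱ u h ≤ h * (leftDeriv ϱ u - leftDeriv ϱ (u - h)) := by linarith
    _ ≤ |h * (leftDeriv ϱ u - leftDeriv ϱ (u - h))| := le_abs_self _
    _ = |h| * |leftDeriv ϱ u - leftDeriv ϱ (u - h)| := abs_mul _ _
    _ ≤ _ := mul_le_mul_of_nonneg_left h3 (abs_nonneg _)

theorem measurable_lossRem (hϱ : ConvexOn ℝ Set.univ ϱ) :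
    Measurable (Function.uncurry (lossRem ϱ)) := by
  have hc : Measurable ϱ := hϱ.locallyLipschitz.continuous.measurable
  have hψ : Measurable (leftDeriv ϱ) := (leftDeriv_mono hϱ).measurable
  exact ((hc.comp (measurable_fst.sub measurable_snd)).sub (hc.comp measurable_fst)).add
    (measurable_snd.mul (hψ.comp measurable_fst))

/-- A function whose subgradient is close to linear is close to quadratic. -/
theorem abs_sub_quadratic_le {L lam : ℝ → ℝ} {δ ξ η : ℝ}
    (hsub : ∀ s t, |s| ≤ δ → |t| ≤ δ → (t - s) * lam s ≤ L t - L s) (h0 : L 0 = 0)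
    (hl : ∀ s, |s| ≤ δ → |lam s - ξ * s| ≤ η * |s|) {h : ℝ} (hh : |h| ≤ δ) :
    |L h - ξ * h ^ 2 / 2| ≤ η * h ^ 2 / 2 := by
  -- The segment from `0` to `h` is cut into `N` equal steps. The subgradient at the left end of a
  -- step bounds the increment of `L` from below and the one at the right end bounds it from above.
  -- The resulting Riemann sums of a linear function are `i (i - 1) / 2` and `i (i + 1) / 2`, and
  -- letting `N` grow closes the gap.
  have hstep : ∀ N : ℕ, 0 < N → ∀ i : ℕ, i ≤ N →
      (ξ - η) * h ^ 2 * (i * (i - 1)) / (2 * N ^ 2) ≤ L (h * i / N) ∧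
      L (h * i / N) ≤ (ξ + η) * h ^ 2 * (i * (i + 1)) / (2 * N ^ 2) := by
    intro N hN i
    have hN' : (0 : ℝ) < N := by exact_mod_cast hN
    have hin : ∀ j : ℕ, j ≤ N → |h * j / N| ≤ δ := fun j hj => by
      have hj' : (j : ℝ) ≤ N := by exact_mod_cast hj
      rw [abs_div, abs_mul, abs_of_pos hN', Nat.abs_cast, div_le_iff₀ hN']
      exact mul_le_mul hh hj' (Nat.cast_nonneg _) ((abs_nonneg h).trans hh)
    have hlam : ∀ j : ℕ, j ≤ N → (ξ - η) * h ^ 2 * j / N ^ 2 ≤ h / N * lam (h * j / N) ∧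
        h / N * lam (h * j / N) ≤ (ξ + η) * h ^ 2 * j / N ^ 2 := fun j hj => by
      have h1 := mul_le_mul_of_nonneg_left (hl _ (hin j hj)) (abs_nonneg (h / N))
      rw [← abs_mul] at h1
      have h2 : |h / N| * (η * |h * j / N|) = η * h ^ 2 * j / N ^ 2 := by
        rw [abs_div, abs_div, abs_mul, abs_of_pos hN', Nat.abs_cast, ← sq_abs h]
        field_simp
      rw [h2, abs_le] at h1
      have h3 : h / N * (lam (h * j / N) - ξ * (h * j / N)) =
          h / N * lam (h * j / N) - ξ * h ^ 2 * j / N ^ 2 := by field_simp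
      rw [h3] at h1
      have h4 : (ξ - η) * h ^ 2 * j / N ^ 2 = ξ * h ^ 2 * j / N ^ 2 - η * h ^ 2 * j / N ^ 2 := by
        ring
      have h5 : (ξ + η) * h ^ 2 * j / N ^ 2 = ξ * h ^ 2 * j / N ^ 2 + η * h ^ 2 * j / N ^ 2 := by
        ring
      constructor <;> linarith [h1.1, h1.2]
    induction i with
    | zero => intro _; simp [h0]
    | succ i ih =>
      intro hi
      obtain ⟨ih1, ih2⟩ := ih (by omega)
      have hd : h * ((i + 1 : ℕ) : ℝ) / N - h * i / N = h / N := by push_cast; ring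
      have s1 := hsub _ _ (hin i (by omega)) (hin (i + 1) hi)
      have s2 := hsub _ _ (hin (i + 1) hi) (hin i (by omega))
      have hd' : h * i / N - h * ((i + 1 : ℕ) : ℝ) / N = -(h / N) := by push_cast; ring
      rw [hd] at s1
      rw [hd'] at s2
      have l1 := (hlam i (by omega)).1
      have l2 := (hlam (i + 1) hi).2
      have e1 : (ξ - η) * h ^ 2 * (((i + 1 : ℕ) : ℝ) * (((i + 1 : ℕ) : ℝ) - 1)) / (2 * N ^ 2) =
          (ξ - η) * h ^ 2 * (i * (i - 1)) / (2 * N ^ 2) + (ξ - η) * h ^ 2 * i / N ^ 2 := by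
        push_cast; field_simp; ring
      have e2 : (ξ + η) * h ^ 2 * (((i + 1 : ℕ) : ℝ) * (((i + 1 : ℕ) : ℝ) + 1)) / (2 * N ^ 2) =
          (ξ + η) * h ^ 2 * (i * (i + 1)) / (2 * N ^ 2) +
            (ξ + η) * h ^ 2 * ((i + 1 : ℕ) : ℝ) / N ^ 2 := by
        push_cast; field_simp; ring
      rw [e1, e2]
      constructor <;> linarith
  have hinv : Tendsto (fun N : ℕ => 1 / (N : ℝ)) atTop (𝓝 0) := tendsto_one_div_atTop_nhds_zero_nat
  have hlo : Tendsto (fun N : ℕ => (ξ - η) * h ^ 2 / 2 * (1 - 1 / (N : ℝ))) atTop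
      (𝓝 ((ξ - η) * h ^ 2 / 2)) := by
    simpa using (hinv.const_sub 1).const_mul ((ξ - η) * h ^ 2 / 2)
  have hup : Tendsto (fun N : ℕ => (ξ + η) * h ^ 2 / 2 * (1 + 1 / (N : ℝ))) atTop
      (𝓝 ((ξ + η) * h ^ 2 / 2)) := by
    simpa using (hinv.const_add 1).const_mul ((ξ + η) * h ^ 2 / 2)
  have b1 : (ξ - η) * h ^ 2 / 2 ≤ L h := by
    refine le_of_tendsto hlo ?_
    filter_upwards [eventually_gt_atTop 0] with N hN
    have hN' : (0 : ℝ) < N := by exact_mod_cast hN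
    have := (hstep N hN N le_rfl).1
    rw [mul_div_cancel_right₀ _ hN'.ne'] at this
    refine le_trans (le_of_eq ?_) this
    field_simp
  have b2 : L h ≤ (ξ + η) * h ^ 2 / 2 := by
    refine ge_of_tendsto hup ?_
    filter_upwards [eventually_gt_atTop 0] with N hN
    have hN' : (0 : ℝ) < N := by exact_mod_cast hN
    have := (hstep N hN N le_rfl).2
    rw [mul_div_cancel_right₀ _ hN'.ne'] at this
    refine this.trans (le_of_eq ?_)
    field_simp
  rw [abs_le]
  constructor <;> linarith

variable {Ω : Type*} [mΩ : MeasurableSpace Ω] {P : Measure Ω} [IsProbabilityMeasure P]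
  {U : Ω → ℝ}

omit [IsProbabilityMeasure P] in
theorem exists_memLp_score (hnear : ∀ᶠ θ : ℝ in 𝓝 0, MemLp (fun ω => leftDeriv ϱ (U ω - θ)) 2 P) :
    ∃ δ : ℝ, 0 < δ ∧ ∀ θ, |θ| ≤ δ → MemLp (fun ω => leftDeriv ϱ (U ω - θ)) 2 P := by
  obtain ⟨δ, hδ, h⟩ := Metric.eventually_nhds_iff.1 hnear
  refine ⟨δ / 2, by positivity, fun θ hθ => h ?_⟩
  rw [Real.dist_eq, sub_zero]
  linarith

/-- As `δ` decreases to 0 the oscillation decreases pointwise to some limit `J ≥ 0`. Its mean is the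
difference of `θ ↦ E ψ(U - θ)` at `-δ` and `δ`, which vanishes in the limit by continuity at 0.
Hence `J = 0` almost surely, and dominated convergence transfers this to second moments. The score
itself may well be discontinuous. -/
theorem exists_scoreOsc_sq_le (hϱ : ConvexOn ℝ Set.univ ϱ)
    (hnear : ∀ᶠ θ : ℝ in 𝓝 0, MemLp (fun ω => leftDeriv ϱ (U ω - θ)) 2 P)
    (hcont : ContinuousAt (fun θ : ℝ => ∫ ω, leftDeriv ϱ (U ω - θ) ∂P) 0) {κ : ℝ} (hκ : 0 < κ) :
    ∃ δ₀ : ℝ, 0 < δ₀ ∧ ∀ δ, 0 < δ → δ ≤ δ₀ → MemLp (fun ω => scoreOsc ϱ δ (U ω)) 2 P ∧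
      ∫ ω, scoreOsc ϱ δ (U ω) ^ 2 ∂P ≤ κ := by
  obtain ⟨δ₀, hδ₀, hmem⟩ := exists_memLp_score hnear
  have hosc : ∀ δ, |δ| ≤ δ₀ → MemLp (fun ω => scoreOsc ϱ δ (U ω)) 2 P := fun δ hδ => by
    have h1 := hmem (-δ) (by rwa [abs_neg])
    simp only [sub_neg_eq_add] at h1
    exact h1.sub (hmem δ hδ)
  set d : ℕ → ℝ := fun j => δ₀ / ((j : ℝ) + 1) with hd
  have hdpos : ∀ j, 0 < d j := fun j => by simp only [hd]; positivity
  have hdle : ∀ j, d j ≤ δ₀ := fun j => div_le_self hδ₀.le (by linarith [Nat.cast_nonneg (α := ℝ) j])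
  have hdabs : ∀ j, |d j| ≤ δ₀ := fun j => by rw [abs_of_pos (hdpos j)]; exact hdle j
  have hdanti : Antitone d := fun i j hij => by
    simp only [hd]
    have : (i : ℝ) ≤ j := by exact_mod_cast hij
    gcongr
  have hdlim : Tendsto d atTop (𝓝 0) :=
    tendsto_const_nhds.div_atTop (tendsto_atTop_add_const_right _ _ tendsto_natCast_atTop_atTop)
  set J : Ω → ℝ := fun ω => ⨅ j, scoreOsc ϱ (d j) (U ω) with hJ
  have hbdd : ∀ ω, BddBelow (Set.range fun j => scoreOsc ϱ (d j) (U ω)) := fun ω =>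
    ⟨0, by rintro _ ⟨j, rfl⟩; exact scoreOsc_nonneg hϱ (hdpos j).le _⟩
  have hlim : ∀ ω, Tendsto (fun j => scoreOsc ϱ (d j) (U ω)) atTop (𝓝 (J ω)) := fun ω =>
    tendsto_atTop_ciInf (fun i j hij => scoreOsc_mono hϱ (U ω) (hdanti hij)) (hbdd ω)
  have hJ0 : ∀ ω, 0 ≤ J ω := fun ω => le_ciInf fun j => scoreOsc_nonneg hϱ (hdpos j).le _
  have hY := hosc δ₀ (by rw [abs_of_pos hδ₀])
  have hle : ∀ j ω, scoreOsc ϱ (d j) (U ω) ≤ scoreOsc ϱ δ₀ (U ω) := fun j ω =>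
    scoreOsc_mono hϱ (U ω) (hdle j)
  have hI1 : Tendsto (fun j => ∫ ω, scoreOsc ϱ (d j) (U ω) ∂P) atTop (𝓝 (∫ ω, J ω ∂P)) := by
    refine tendsto_integral_of_dominated_convergence (fun ω => scoreOsc ϱ δ₀ (U ω))
      (fun j => (hosc _ (hdabs j)).1) (hY.integrable one_le_two)
      (fun j => ae_of_all _ fun ω => ?_) (ae_of_all _ hlim)
    rw [Real.norm_eq_abs, abs_of_nonneg (scoreOsc_nonneg hϱ (hdpos j).le _)]
    exact hle j ω
  have hI0 : Tendsto (fun j => ∫ ω, scoreOsc ϱ (d j) (U ω) ∂P) atTop (𝓝 0) := by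
    have h1 := hcont.tendsto.comp hdlim
    have h2 := hcont.tendsto.comp (by simpa using hdlim.neg : Tendsto (fun j => -d j) atTop (𝓝 0))
    have h3 := h2.sub h1
    rw [sub_self] at h3
    refine h3.congr fun j => ?_
    simp only [Function.comp, scoreOsc, sub_neg_eq_add]
    rw [integral_sub]
    · have h1 := hmem (-d j) (by rw [abs_neg]; exact hdabs j)
      simp only [sub_neg_eq_add] at h1
      exact h1.integrable one_le_two
    · exact (hmem _ (hdabs j)).integrable one_le_two
  have hJint0 : ∫ ω, J ω ∂P = 0 := tendsto_nhds_unique hI1 hI0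
  have hJm : AEStronglyMeasurable J P :=
    aestronglyMeasurable_of_tendsto_ae atTop (fun j => (hosc _ (hdabs j)).1) (ae_of_all _ hlim)
  have hJint : Integrable J P := by
    refine (hY.integrable one_le_two).mono' hJm (ae_of_all _ fun ω => ?_)
    rw [Real.norm_eq_abs, abs_of_nonneg (hJ0 ω)]
    exact (ciInf_le (hbdd ω) 0).trans (hle 0 ω)
  have hJae : J =ᵐ[P] 0 := (integral_eq_zero_iff_of_nonneg hJ0 hJint).1 hJint0
  have hI2 : Tendsto (fun j => ∫ ω, scoreOsc ϱ (d j) (U ω) ^ 2 ∂P) atTop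
      (𝓝 (∫ _, (0 : ℝ) ∂P)) := by
    refine tendsto_integral_of_dominated_convergence (fun ω => scoreOsc ϱ δ₀ (U ω) ^ 2)
      (fun j => (hosc _ (hdabs j)).1.pow 2) hY.integrable_sq
      (fun j => ae_of_all _ fun ω => ?_) ?_
    · rw [Real.norm_eq_abs, abs_of_nonneg (sq_nonneg _)]
      exact pow_le_pow_left₀ (scoreOsc_nonneg hϱ (hdpos j).le _) (hle j ω) 2
    · filter_upwards [hJae] with ω hω
      have := (hlim ω).pow 2
      rw [hω] at this
      simpa using this
  rw [integral_zero] at hI2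
  obtain ⟨j, hj⟩ := (hI2.eventually (gt_mem_nhds hκ)).exists
  refine ⟨d j, hdpos j, fun δ hδ hδj => ?_⟩
  have hδm := hosc δ (by rw [abs_of_pos hδ]; exact hδj.trans (hdle j))
  refine ⟨hδm, le_trans ?_ hj.le⟩
  exact integral_mono hδm.integrable_sq (hosc _ (hdabs j)).integrable_sq fun ω =>
    pow_le_pow_left₀ (scoreOsc_nonneg hϱ hδ.le _) (scoreOsc_mono hϱ _ hδj) 2

theorem integrable_lossRem (hϱ : ConvexOn ℝ Set.univ ϱ) (hU : Measurable U) {δ : ℝ}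
    (hosc : MemLp (fun ω => scoreOsc ϱ δ (U ω)) 2 P) {h : ℝ} (hh : |h| ≤ δ) :
    Integrable (fun ω => lossRem ϱ (U ω) h) P := by
  refine ((hosc.integrable one_le_two).const_mul |h|).mono'
    ((measurable_lossRem hϱ).comp (hU.prodMk measurable_const)).aestronglyMeasurable
    (ae_of_all _ fun ω => ?_)
  rw [Real.norm_eq_abs, abs_of_nonneg (lossRem_nonneg hϱ _ _)]
  exact lossRem_le hϱ hh _

/-- The expected loss remainder is locally quadratic. -/
theorem exists_integral_lossRem_quadratic (hϱ : ConvexOn ℝ Set.univ ϱ) (hU : Measurable U)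
    (hnear : ∀ᶠ θ : ℝ in 𝓝 0, MemLp (fun ω => leftDeriv ϱ (U ω - θ)) 2 P)
    (hzero : ∫ ω, leftDeriv ϱ (U ω) ∂P = 0) {ξ : ℝ}
    (hderiv : HasDerivAt (fun θ : ℝ => ∫ ω, leftDeriv ϱ (U ω - θ) ∂P) (-ξ) 0)
    {η : ℝ} (hη : 0 < η) :
    ∃ δ : ℝ, 0 < δ ∧ ∀ h, |h| ≤ δ →
      |∫ ω, lossRem ϱ (U ω) h ∂P - ξ * h ^ 2 / 2| ≤ η * h ^ 2 / 2 := by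
  obtain ⟨δ₁, hδ₁, hmem⟩ := exists_memLp_score hnear
  obtain ⟨δ₂, hδ₂, hosc⟩ := exists_scoreOsc_sq_le hϱ hnear hderiv.continuousAt one_pos
  have hlin := (hasDerivAt_iff_isLittleO_nhds_zero.1 hderiv).def hη
  obtain ⟨δ₃, hδ₃, hlin⟩ := Metric.eventually_nhds_iff.1 hlin
  have hδ : 0 < min (min δ₁ δ₂) (δ₃ / 2) := by positivity
  refine ⟨min (min δ₁ δ₂) (δ₃ / 2), hδ, fun h hh => ?_⟩
  have hU0 : MemLp (fun ω => leftDeriv ϱ (U ω)) 2 P := by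
    simpa using hmem 0 (by simpa using hδ₁.le)
  refine abs_sub_quadratic_le (L := fun h => ∫ ω, lossRem ϱ (U ω) h ∂P)
    (lam := fun s => -∫ ω, leftDeriv ϱ (U ω - s) ∂P) ?_ (by simp [lossRem]) ?_ hh
  · intro s t hs ht
    have hs1 : |s| ≤ δ₁ := hs.trans ((min_le_left _ _).trans (min_le_left _ _))
    have hs2 : |s| ≤ δ₂ := hs.trans ((min_le_left _ _).trans (min_le_right _ _))
    have ht2 : |t| ≤ δ₂ := ht.trans ((min_le_left _ _).trans (min_le_right _ _))
    have is := integrable_lossRem hϱ hU (hosc δ₂ hδ₂ le_rfl).1 hs2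
    have it := integrable_lossRem hϱ hU (hosc δ₂ hδ₂ le_rfl).1 ht2
    have i0 := hU0.integrable one_le_two
    have i1 := (hmem s hs1).integrable one_le_two
    rw [← integral_sub it is]
    calc (t - s) * -∫ ω, leftDeriv ϱ (U ω - s) ∂P
        = ∫ ω, (t - s) * (leftDeriv ϱ (U ω) - leftDeriv ϱ (U ω - s)) ∂P := by
          rw [integral_const_mul, integral_sub i0 i1, hzero, zero_sub]
      _ ≤ _ := integral_mono ((i0.sub i1).const_mul _) (it.sub is) fun ω =>
          lossRem_sub_ge hϱ _ _ _
  · intro s hs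
    have hs3 : |s| ≤ δ₃ / 2 := hs.trans (min_le_right _ _)
    have := hlin (y := s) (by rw [Real.dist_eq, sub_zero]; linarith)
    simp only [zero_add, sub_zero, hzero, smul_eq_mul, Real.norm_eq_abs] at this
    rw [← abs_neg]
    refine le_trans (le_of_eq ?_) this
    congr 1
    ring

/-- A nonzero value of `deriv` excludes the default value 0, so the derivative exists. Monotonicity
of the score makes it nonpositive, which identifies the absolute value in `xi` with its negative. -/
theorem hasDerivAt_of_xi_ne_zero (hϱ : ConvexOn ℝ Set.univ ϱ)
    (hnear : ∀ᶠ θ : ℝ in 𝓝 0, MemLp (fun ω => leftDeriv ϱ (U ω - θ)) 2 P)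
    (hxi : xi P (leftDeriv ϱ) U ≠ 0) :
    HasDerivAt (fun θ : ℝ => ∫ ω, leftDeriv ϱ (U ω - θ) ∂P) (-xi P (leftDeriv ϱ) U) 0 := by
  set Ψ : ℝ → ℝ := fun θ : ℝ => ∫ ω, leftDeriv ϱ (U ω - θ) ∂P with hΨ
  have hne : deriv Ψ 0 ≠ 0 := fun h => hxi (by simp only [xi]; rw [← hΨ, h, abs_zero])
  have hd : HasDerivAt Ψ (deriv Ψ 0) 0 := (differentiableAt_of_deriv_ne_zero hne).hasDerivAt
  obtain ⟨δ, hδ, hmem⟩ := exists_memLp_score hnear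
  have hle : deriv Ψ 0 ≤ 0 := by
    have hs := (hasDerivAt_iff_tendsto_slope_zero.1 hd).mono_left
      (nhdsWithin_mono 0 (fun x (hx : x ∈ Set.Ioi (0 : ℝ)) => ne_of_gt hx))
    refine le_of_tendsto hs ?_
    have hev : ∀ᶠ t : ℝ in 𝓝[>] 0, t ∈ Set.Ioo 0 δ := Ioo_mem_nhdsGT hδ
    filter_upwards [hev] with t ht
    have h1 : Ψ (0 + t) ≤ Ψ 0 := by
      rw [zero_add]
      refine integral_mono ((hmem t ?_).integrable one_le_two)
        ((hmem 0 (by simpa using hδ.le)).integrable one_le_two) fun ω =>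
          leftDeriv_mono hϱ (by linarith [ht.1])
      rw [abs_of_pos ht.1]; exact ht.2.le
    rw [smul_eq_mul]
    exact mul_nonpos_of_nonneg_of_nonpos (inv_nonneg.2 ht.1.le) (by linarith)
  have hx : xi P (leftDeriv ϱ) U = -deriv Ψ 0 := by
    simp only [xi]; rw [← hΨ, abs_of_nonpos hle]
  rw [hx, neg_neg]
  exact hd

end ConvexLoss

/-! ### Convexity: from pointwise convergence to convergence of minimizers. -/

/-- Sublevel sets of `C` are convex and the square is the convex hull of its corners: interpolate
first along the two vertical edges, then between them. -/
theorem le_of_corners {C : ℝ × ℝ → ℝ} (hC : ConvexOn ℝ Set.univ C) {K M : ℝ} (hK : 0 < K)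
    (h1 : C (K, K) ≤ M) (h2 : C (K, -K) ≤ M) (h3 : C (-K, K) ≤ M) (h4 : C (-K, -K) ≤ M)
    {v : ℝ × ℝ} (hv1 : |v.1| ≤ K) (hv2 : |v.2| ≤ K) : C v ≤ M := by
  have hconv : Convex ℝ {x | C x ≤ M} := by simpa using hC.convex_le M
  obtain ⟨a1, a2⟩ := abs_le.1 hv1
  obtain ⟨b1, b2⟩ := abs_le.1 hv2
  have edge : ∀ x : ℝ, C (x, K) ≤ M → C (x, -K) ≤ M → C (x, v.2) ≤ M := fun x hx hx' => by
    have h := hconv (x := (x, K)) hx (y := (x, -K)) hx'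
      (a := (K + v.2) / (2 * K)) (b := (K - v.2) / (2 * K))
      (div_nonneg (by linarith) (by linarith)) (div_nonneg (by linarith) (by linarith))
      (by field_simp; ring)
    have e : ((K + v.2) / (2 * K)) • ((x, K) : ℝ × ℝ) + ((K - v.2) / (2 * K)) • (x, -K) =
        (x, v.2) := by
      ext
      · simp; field_simp; ring
      · simp; field_simp; ring
    rw [e] at h
    exact h
  have h := hconv (x := (K, v.2)) (edge K h1 h2) (y := (-K, v.2)) (edge (-K) h3 h4)
    (a := (K + v.1) / (2 * K)) (b := (K - v.1) / (2 * K))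
    (div_nonneg (by linarith) (by linarith)) (div_nonneg (by linarith) (by linarith))
    (by field_simp; ring)
  have e : ((K + v.1) / (2 * K)) • ((K, v.2) : ℝ × ℝ) + ((K - v.1) / (2 * K)) • (-K, v.2) = v := by
    ext
    · simp; field_simp; ring
    · simp; field_simp; ring
  rw [e] at h
  exact h

/-- A convex function on the plane that is close to a continuous function on a suitable finite set
is uniformly close to it on a given ball. -/
theorem exists_finset_convex_approx {q : ℝ × ℝ → ℝ} (hq : Continuous q) {ρ κ : ℝ} (hρ : 0 < ρ)
    (hκ : 0 < κ) :
    ∃ S : Finset (ℝ × ℝ), ∃ δ : ℝ, 0 < δ ∧ ∀ C : ℝ × ℝ → ℝ, ConvexOn ℝ Set.univ C →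
      (∀ v ∈ S, |C v - q v| ≤ δ) → ∀ v, ‖v‖ ≤ ρ → |C v - q v| ≤ κ := by
  -- The product norm is the maximum norm, so balls are squares. Radius `ρ + 2` puts the closed ball
  -- of radius `ρ` inside the ball of radius `K - 1`, where a convex function bounded by `M` on the
  -- ball of radius `K` is Lipschitz with constant `2 M`.
  set K := ρ + 2 with hK
  have hK0 : 0 < K := by linarith
  set M₁ := |q (K, K)| + |q (K, -K)| + |q (-K, K)| + |q (-K, -K)| + 1 with hM₁
  -- The corners give the upper bound `M₁`; the lower bound comes from `C 0 ≤ (C x + C (-x)) / 2`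
  -- and the closeness of `C 0` to `q 0`.
  set M := M₁ + 2 * |q 0| + 2 with hM
  have hM₁0 : 0 ≤ M₁ := by positivity
  have hM0 : 0 ≤ M := by positivity
  have hcomp : IsCompact (Metric.closedBall (0 : ℝ × ℝ) ρ) := isCompact_closedBall 0 ρ
  obtain ⟨η, hη, hunif⟩ := Metric.uniformContinuousOn_iff.1
    (hcomp.uniformContinuousOn_of_continuous hq.continuousOn) (κ / 3) (by positivity)
  set ε := min η (κ / (3 * (2 * M + 1))) with hε
  have hε0 : 0 < ε := by positivity
  obtain ⟨T, hTsub, hTfin, hTcov⟩ := hcomp.finite_cover_balls hε0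
  refine ⟨hTfin.toFinset ∪ {(K, K), (K, -K), (-K, K), (-K, -K), 0}, min 1 (κ / 3), by positivity,
    fun C hC hS v hv => ?_⟩
  have near : ∀ p ∈ ({(K, K), (K, -K), (-K, K), (-K, -K), 0} : Finset (ℝ × ℝ)),
      |C p - q p| ≤ 1 := fun p hp =>
    (hS p (Finset.mem_union_right _ hp)).trans (min_le_left _ _)
  have up : ∀ x : ℝ × ℝ, ‖x‖ ≤ K → C x ≤ M₁ := fun x hx => by
    have n1 := (abs_le.1 (near (K, K) (by simp))).2
    have n2 := (abs_le.1 (near (K, -K) (by simp))).2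
    have n3 := (abs_le.1 (near (-K, K) (by simp))).2
    have n4 := (abs_le.1 (near (-K, -K) (by simp))).2
    have p1 := abs_nonneg (q (K, K))
    have p2 := abs_nonneg (q (K, -K))
    have p3 := abs_nonneg (q (-K, K))
    have p4 := abs_nonneg (q (-K, -K))
    have l1 := le_abs_self (q (K, K))
    have l2 := le_abs_self (q (K, -K))
    have l3 := le_abs_self (q (-K, K))
    have l4 := le_abs_self (q (-K, -K))
    exact le_of_corners hC hK0 (by linarith) (by linarith) (by linarith) (by linarith)
      ((norm_fst_le x).trans hx) ((norm_snd_le x).trans hx)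
  have bound : ∀ x : ℝ × ℝ, dist x 0 < K → |C x| ≤ M := fun x hx => by
    rw [dist_zero_right] at hx
    have h1 := up x hx.le
    have h2 := up (-x) (by rw [norm_neg]; exact hx.le)
    have h3 := hC.2 (Set.mem_univ x) (Set.mem_univ (-x))
      (by norm_num : (0 : ℝ) ≤ 1 / 2) (by norm_num : (0 : ℝ) ≤ 1 / 2) (by norm_num)
    rw [smul_neg, add_neg_cancel, smul_eq_mul, smul_eq_mul] at h3
    have n0 := (abs_le.1 (near 0 (by simp))).1
    have l0 := neg_abs_le (q 0)
    rw [abs_le]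
    constructor <;> linarith [abs_nonneg (q 0)]
  have hLip := (hC.subset (Set.subset_univ (Metric.ball 0 K))
    (convex_ball 0 K)).lipschitzOnWith_of_abs_le one_pos bound
  have hvB : v ∈ Metric.closedBall (0 : ℝ × ℝ) ρ := by simpa using hv
  obtain ⟨p, hpT, hvp⟩ := Set.mem_iUnion₂.1 (hTcov hvB)
  have hpB := hTsub hpT
  have hin : ∀ x ∈ Metric.closedBall (0 : ℝ × ℝ) ρ, x ∈ Metric.ball (0 : ℝ × ℝ) (K - 1) :=
    fun x hx => by
      rw [Metric.mem_closedBall] at hx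
      rw [Metric.mem_ball]
      linarith
  have hdist : dist v p < ε := Metric.mem_ball.1 hvp
  have hq1 := hunif v hvB p hpB (hdist.trans_le (min_le_left _ _))
  have hC1 := hLip.dist_le_mul v (hin v hvB) p (hin p hpB)
  rw [Real.coe_toNNReal _ (by positivity), div_one, Real.dist_eq] at hC1
  rw [Real.dist_eq] at hq1
  have hC2 : |C v - C p| ≤ κ / 3 := by
    refine hC1.trans ?_
    have h1 : dist v p ≤ κ / (3 * (2 * M + 1)) := (hdist.trans_le (min_le_right _ _)).le
    calc 2 * M * dist v p ≤ (2 * M + 1) * (κ / (3 * (2 * M + 1))) :=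
          mul_le_mul (by linarith) h1 dist_nonneg (by positivity)
      _ = κ / 3 := by field_simp
  have hp : |C p - q p| ≤ κ / 3 :=
    (hS p (Finset.mem_union_left _ (hTfin.mem_toFinset.2 hpT))).trans (min_le_right _ _)
  rw [abs_le] at hC2 hp ⊢
  rw [abs_lt] at hq1
  constructor <;> linarith [hC2.1, hC2.2, hp.1, hp.2, hq1.1, hq1.2]

/-- The minimizer of a tilted convex function is close to that of the tilted quadratic form as soon
as the two functions are close on a suitable finite set. -/
theorem exists_finset_argmin {ξ R κ : ℝ} (hξ : 0 < ξ) (hR : 0 < R) (hκ : 0 < κ) :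
    ∃ S : Finset (ℝ × ℝ), ∃ δ : ℝ, 0 < δ ∧ ∀ C : ℝ × ℝ → ℝ, ConvexOn ℝ Set.univ C →
      (∀ v ∈ S, |C v - ξ / 2 * (v.1 ^ 2 + v.2 ^ 2)| ≤ δ) →
      ∀ w : ℝ × ℝ, |w.1| ≤ R → |w.2| ≤ R → ∀ x : ℝ × ℝ,
        (∀ v : ℝ × ℝ, C x - (w.1 * x.1 + w.2 * x.2) ≤ C v - (w.1 * v.1 + w.2 * v.2)) →
        |x.1 - ξ⁻¹ * w.1| ≤ κ ∧ |x.2 - ξ⁻¹ * w.2| ≤ κ := by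
  -- The tilted quadratic form exceeds its minimum by at least `ξ κ² / 2` at distance `κ` from its
  -- minimizer. The error `ξ κ² / 8` is incurred at two points, so it cannot compensate for that
  -- gap.
  obtain ⟨S, δ, hδ, h⟩ := exists_finset_convex_approx
    (q := fun v : ℝ × ℝ => ξ / 2 * (v.1 ^ 2 + v.2 ^ 2)) (by fun_prop)
    (ρ := ξ⁻¹ * R + κ) (κ := ξ * κ ^ 2 / 8) (by positivity) (by positivity)
  refine ⟨S, δ, hδ, fun C hC hS w hw1 hw2 x hx => ?_⟩
  set p : ℝ × ℝ := (ξ⁻¹ * w.1, ξ⁻¹ * w.2) with hp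
  suffices hsuff : ‖x - p‖ ≤ κ from
    ⟨(norm_fst_le (x - p)).trans hsuff, (norm_snd_le (x - p)).trans hsuff⟩
  by_contra hcon
  push Not at hcon
  have hpn : ‖p‖ ≤ ξ⁻¹ * R := by
    rw [Prod.norm_def, max_le_iff]
    simp only [hp, Real.norm_eq_abs, abs_mul, abs_of_pos (inv_pos.2 hξ)]
    exact ⟨mul_le_mul_of_nonneg_left hw1 (by positivity),
      mul_le_mul_of_nonneg_left hw2 (by positivity)⟩
  have hxp : 0 < ‖x - p‖ := hκ.trans hcon
  -- If the minimizer `x` were farther than `κ` from `p`, the point `z` of the segment at distance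
  -- exactly `κ` would, by convexity, have a tilted value no larger than that at `p`.
  set l := κ / ‖x - p‖ with hl
  have hl0 : 0 ≤ l := by positivity
  have hl1 : l ≤ 1 := (div_le_one hxp).2 hcon.le
  set d : ℝ × ℝ := l • (x - p) with hd
  have hdn : ‖d‖ = κ := by
    rw [hd, norm_smul, Real.norm_eq_abs, abs_of_nonneg hl0, hl, div_mul_cancel₀ _ hxp.ne']
  set z := p + d with hz
  have hzn : ‖z‖ ≤ ξ⁻¹ * R + κ := (norm_add_le _ _).trans (by rw [hdn]; linarith)
  have hzc : z = (1 - l) • p + l • x := by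
    rw [hz, hd, smul_sub, sub_smul, one_smul]; abel
  have hconv := hC.2 (Set.mem_univ p) (Set.mem_univ x) (sub_nonneg.2 hl1) hl0 (by ring)
  rw [← hzc, smul_eq_mul, smul_eq_mul] at hconv
  have hz1 : z.1 = (1 - l) * p.1 + l * x.1 := by rw [hzc]; simp
  have hz2 : z.2 = (1 - l) * p.2 + l * x.2 := by rw [hzc]; simp
  have hmin := mul_le_mul_of_nonneg_left (hx p) hl0
  have hG : C z - (w.1 * z.1 + w.2 * z.2) ≤ C p - (w.1 * p.1 + w.2 * p.2) := by
    rw [hz1, hz2]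
    nlinarith
  have hCz := (abs_le.1 (h C hC hS z hzn)).1
  have hCp := (abs_le.1 (h C hC hS p (by linarith))).2
  have hw1' : w.1 = ξ * p.1 := by simp only [hp]; field_simp
  have hw2' : w.2 = ξ * p.2 := by simp only [hp]; field_simp
  have hzd1 : z.1 = p.1 + d.1 := rfl
  have hzd2 : z.2 = p.2 + d.2 := rfl
  have hd2 : κ ^ 2 ≤ d.1 ^ 2 + d.2 ^ 2 := by
    rw [← hdn, Prod.norm_def]
    rcases max_choice ‖d.1‖ ‖d.2‖ with hm | hm <;> rw [hm, Real.norm_eq_abs, sq_abs] <;>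
      nlinarith [sq_nonneg d.1, sq_nonneg d.2]
  have hquad : ξ / 2 * (z.1 ^ 2 + z.2 ^ 2) - (w.1 * z.1 + w.2 * z.2) -
      (ξ / 2 * (p.1 ^ 2 + p.2 ^ 2) - (w.1 * p.1 + w.2 * p.2)) =
        ξ / 2 * (d.1 ^ 2 + d.2 ^ 2) := by
    rw [hw1', hw2', hzd1, hzd2]; ring
  have := mul_le_mul_of_nonneg_left hd2 (by positivity : 0 ≤ ξ / 2)
  have hpos : 0 < ξ * κ ^ 2 := by positivity
  linarith

/-- Convexity lemma: pointwise convergence in probability of convex processes to a quadratic form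
gives the asymptotic representation of the minimizers of the tilted processes. -/
theorem argmin_isLittleOP {Ω : Type*} [MeasurableSpace Ω] {P : Measure Ω}
    {C : ℕ → Ω → ℝ × ℝ → ℝ} (hC : ∀ n ω, ConvexOn ℝ Set.univ (C n ω)) {ξ : ℝ} (hξ : 0 < ξ)
    (hlim : ∀ v : ℝ × ℝ, IsLittleOP P (fun n ω => C n ω v - ξ / 2 * (v.1 ^ 2 + v.2 ^ 2)))
    {w x : ℕ → Ω → ℝ × ℝ} (hw1 : IsBigOP P (fun n ω => (w n ω).1))
    (hw2 : IsBigOP P (fun n ω => (w n ω).2))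
    (hx : ∀ᶠ n in atTop, ∀ᵐ ω ∂P, ∀ v : ℝ × ℝ,
      C n ω (x n ω) - ((w n ω).1 * (x n ω).1 + (w n ω).2 * (x n ω).2) ≤
        C n ω v - ((w n ω).1 * v.1 + (w n ω).2 * v.2)) :
    IsLittleOP P (fun n ω => (x n ω).1 - ξ⁻¹ * (w n ω).1) ∧
    IsLittleOP P (fun n ω => (x n ω).2 - ξ⁻¹ * (w n ω).2) := by
  have key : ∀ κ : ℝ, 0 < κ → Tendsto (fun n => P {ω | κ ≤ |(x n ω).1 - ξ⁻¹ * (w n ω).1| ∨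
      κ ≤ |(x n ω).2 - ξ⁻¹ * (w n ω).2|}) atTop (𝓝 0) := by
    intro κ hκ
    rw [ENNReal.tendsto_nhds_zero]
    intro η hη
    have hη3 : 0 < η / 3 := ENNReal.div_pos hη.ne' (by norm_num)
    obtain ⟨R₁, hR₁⟩ := hw1 _ hη3
    obtain ⟨R₂, hR₂⟩ := hw2 _ hη3
    set R := |R₁| + |R₂| + 1 with hR
    obtain ⟨S, δ, hδ, hS⟩ := exists_finset_argmin hξ (by positivity : 0 < R) (half_pos hκ)
    have hsum : Tendsto (fun n => ∑ v ∈ S,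
        P {ω | δ ≤ |C n ω v - ξ / 2 * (v.1 ^ 2 + v.2 ^ 2)|}) atTop (𝓝 0) := by
      have := tendsto_finsetSum S fun v _ => hlim v δ hδ
      simpa using this
    filter_upwards [hR₁, hR₂, (ENNReal.tendsto_nhds_zero.1 hsum) _ hη3, hx] with n h1 h2 h3 h4
    set A := {ω | κ ≤ |(x n ω).1 - ξ⁻¹ * (w n ω).1| ∨ κ ≤ |(x n ω).2 - ξ⁻¹ * (w n ω).2|}
    set W₁ := {ω | R₁ ≤ |(w n ω).1|}
    set W₂ := {ω | R₂ ≤ |(w n ω).2|}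
    set T := ⋃ v ∈ S, {ω | δ ≤ |C n ω v - ξ / 2 * (v.1 ^ 2 + v.2 ^ 2)|}
    calc P A ≤ P (W₁ ∪ W₂ ∪ T) := by
          refine measure_mono_ae ?_
          filter_upwards [h4] with ω hω hA
          by_contra hcon
          have hcon' : ω ∉ W₁ ∪ W₂ ∪ T := hcon
          simp only [W₁, W₂, T, Set.mem_union, Set.mem_iUnion, Set.mem_ofPred_eq, not_or,
            not_exists, not_le] at hcon'
          obtain ⟨⟨c1, c2⟩, c3⟩ := hcon'
          have := hS (C n ω) (hC n ω) (fun v hv => (c3 v hv).le) (w n ω)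
            (by linarith [le_abs_self R₁, abs_nonneg R₂])
            (by linarith [le_abs_self R₂, abs_nonneg R₁]) (x n ω) hω
          have hA' : κ ≤ |(x n ω).1 - ξ⁻¹ * (w n ω).1| ∨ κ ≤ |(x n ω).2 - ξ⁻¹ * (w n ω).2| := hA
          rcases hA' with hA' | hA' <;> linarith [this.1, this.2]
      _ ≤ P W₁ + P W₂ + P T :=
          (measure_union_le _ _).trans (add_le_add_left (measure_union_le _ _) _)
      _ ≤ η / 3 + η / 3 + η / 3 :=
          add_le_add (add_le_add h1 h2) ((measure_biUnion_finset_le _ _).trans h3)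
      _ = η := ENNReal.add_thirds η
  constructor
  · intro κ hκ
    refine tendsto_of_tendsto_of_tendsto_of_le_of_le tendsto_const_nhds (key κ hκ)
      (fun _ => zero_le) fun n => measure_mono fun ω hω => Or.inl hω
  · intro κ hκ
    refine tendsto_of_tendsto_of_tendsto_of_le_of_le tendsto_const_nhds (key κ hκ)
      (fun _ => zero_le) fun n => measure_mono fun ω hω => Or.inr hω

/-! ### Quadratic limit of the localized objective. -/

section

variable {Ω : Type*} [mΩ : MeasurableSpace Ω] {P : Measure Ω} [IsProbabilityMeasure P]

/-- The local shift `v · Z_t` with `Z_t = (1 / √n, z_{t-1} / s_n)`. -/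
noncomputable def shift (σ : ℝ) (r m : ℕ → ℝ) (e : ℕ → Ω → ℝ) (n t : ℕ) (ω : Ω) (v : ℝ × ℝ) : ℝ :=
  v.1 / √n + v.2 * (zArr r m e n t ω / scale σ r m n)

variable {e : ℕ → Ω → ℝ} {σ : ℝ} {r : ℕ → ℝ} (m : ℕ → ℝ)

/-- Expanding the square leaves the cross term, killed by `isLittleOP_sum_zArr`, and the normalized
sum of squares, which tends to 1. -/
theorem isLittleOP_sum_shift_sq (he : IsInnovation P e σ) (hr : IsNearStationary r) (v : ℝ × ℝ) :
    IsLittleOP P (fun n ω => ∑ t ∈ Finset.range n, shift σ r m e n t ω v ^ 2 -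
      (v.1 ^ 2 + v.2 ^ 2)) := by
  refine (((isLittleOP_sum_zArr m he hr).const_mul (2 * v.1 * v.2)).add
    ((isLittleOP_sum_zArr_sq m he hr).const_mul (v.2 ^ 2))).congr ?_
  filter_upwards [hr.basic] with n hn ω
  have hn' : (0 : ℝ) < n := by exact_mod_cast hn.2.2.2
  have hs := scale_pos (m := m) he.pos hn.2.2.1 hn.2.2.2
  have hexp : ∀ t, shift σ r m e n t ω v ^ 2 = v.1 ^ 2 / n +
      2 * v.1 * v.2 / (√n * scale σ r m n) * zArr r m e n t ω +
      v.2 ^ 2 / scale σ r m n ^ 2 * zArr r m e n t ω ^ 2 := fun t => by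
    have hsq : √(n : ℝ) ^ 2 = n := Real.sq_sqrt hn'.le
    have : 0 < √(n : ℝ) := Real.sqrt_pos.2 hn'
    rw [← hsq, shift]
    simp only [Real.sqrt_sq this.le]
    field_simp
    ring
  simp_rw [hexp]
  rw [Finset.sum_add_distrib, Finset.sum_add_distrib, ← Finset.mul_sum, ← Finset.mul_sum]
  simp only [Finset.sum_const, Finset.card_range, nsmul_eq_mul]
  field_simp
  ring

omit [IsProbabilityMeasure P] in
theorem measurable_shift (he : IsInnovation P e σ) (n t : ℕ) (v : ℝ × ℝ) :
    Measurable[hist he.meas t] (fun ω => shift σ r m e n t ω v) :=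
  (((measurable_ar_hist he.meas (r n) (-(m n)) t).div_const _).const_mul _).const_add _

theorem memLp_shift (he : IsInnovation P e σ) (n t : ℕ) (v : ℝ × ℝ) :
    MemLp (fun ω => shift σ r m e n t ω v) 2 P := by
  have h1 : MemLp (zArr r m e n t) 2 P := memLp_zArr m he n t
  have h2 : MemLp (fun _ : Ω => v.1 / √(n : ℝ)) 2 P := memLp_const _
  have h := h2.add (h1.const_mul (v.2 / scale σ r m n))
  refine h.ae_eq (ae_of_all _ fun ω => ?_)
  simp only [shift, Pi.add_apply]
  ring

theorem sum_integral_shift_sq_le (he : IsInnovation P e σ) {n : ℕ} (hd : 0 < 1 - r n ^ 2)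
    (hn : 0 < n) (v : ℝ × ℝ) :
    ∑ t ∈ Finset.range n, ∫ ω, shift σ r m e n t ω v ^ 2 ∂P ≤ 2 * (v.1 ^ 2 + v.2 ^ 2) := by
  have hn' : (0 : ℝ) < n := by exact_mod_cast hn
  have hs := scale_pos (m := m) he.pos hd hn
  have h1 : ∀ t, ∫ ω, shift σ r m e n t ω v ^ 2 ∂P ≤
      2 * v.1 ^ 2 / n + 2 * v.2 ^ 2 / scale σ r m n ^ 2 * ∫ ω, zArr r m e n t ω ^ 2 ∂P := by
    intro t
    have hz := (memLp_zArr (r := r) m he n t).integrable_sq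
    calc ∫ ω, shift σ r m e n t ω v ^ 2 ∂P
        ≤ ∫ ω, (2 * v.1 ^ 2 / n + 2 * v.2 ^ 2 / scale σ r m n ^ 2 * zArr r m e n t ω ^ 2) ∂P := by
          refine integral_mono (memLp_shift m he n t v).integrable_sq
            ((integrable_const _).add (hz.const_mul _)) fun ω => ?_
          simp only [shift]
          have h2 : (v.1 / √(n : ℝ)) ^ 2 = v.1 ^ 2 / n := by rw [div_pow, Real.sq_sqrt hn'.le]
          have h3 : (v.2 * (zArr r m e n t ω / scale σ r m n)) ^ 2 =
            v.2 ^ 2 / scale σ r m n ^ 2 * zArr r m e n t ω ^ 2 := by field_simp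
          have h4 : 2 * v.1 ^ 2 / n = 2 * (v.1 ^ 2 / n) := by ring
          have h5 : 2 * v.2 ^ 2 / scale σ r m n ^ 2 * zArr r m e n t ω ^ 2 =
            2 * (v.2 ^ 2 / scale σ r m n ^ 2 * zArr r m e n t ω ^ 2) := by ring
          rw [h4, h5, ← h2, ← h3]
          nlinarith [sq_nonneg (v.1 / √(n : ℝ) - v.2 * (zArr r m e n t ω / scale σ r m n))]
      _ = _ := by
          rw [integral_add (integrable_const _) (hz.const_mul _), integral_const_mul]
          simp
  refine (Finset.sum_le_sum fun t _ => h1 t).trans ?_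
  rw [Finset.sum_add_distrib, ← Finset.mul_sum]
  have h2 := mul_le_mul_of_nonneg_left (sum_integral_zArr_sq_le m he hd (n := n))
    (by positivity : 0 ≤ 2 * v.2 ^ 2 / scale σ r m n ^ 2)
  have h3 : 2 * v.2 ^ 2 / scale σ r m n ^ 2 * scale σ r m n ^ 2 = 2 * v.2 ^ 2 := by field_simp
  rw [h3] at h2
  simp only [Finset.sum_const, Finset.card_range, nsmul_eq_mul]
  have h4 : (n : ℝ) * (2 * v.1 ^ 2 / n) = 2 * v.1 ^ 2 := by field_simp
  rw [h4]
  linarith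

/-- The regularity of the loss and of the re-centred innovation. -/
structure IsRegularLoss (P : Measure Ω) (ϱ : ℝ → ℝ) (U : Ω → ℝ) (ξ : ℝ) : Prop where
  convex : ConvexOn ℝ Set.univ ϱ
  memLp : MemLp (fun ω => leftDeriv ϱ (U ω)) 2 P
  near : ∀ᶠ θ : ℝ in 𝓝 0, MemLp (fun ω => leftDeriv ϱ (U ω - θ)) 2 P
  mean : ∫ ω, leftDeriv ϱ (U ω) ∂P = 0
  deriv : HasDerivAt (fun θ : ℝ => ∫ ω, leftDeriv ϱ (U ω - θ) ∂P) (-ξ) 0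
  pos : 0 < ξ

variable {ϱ : ℝ → ℝ} {q ξ : ℝ}

/-- The loss remainder, truncated in the shift and centred. -/
noncomputable def centredRem (P : Measure Ω) (U : Ω → ℝ) (ϱ : ℝ → ℝ) (q δ x h : ℝ) : ℝ :=
  if |h| ≤ δ then lossRem ϱ (x - q) h - ∫ ω, lossRem ϱ (U ω) h ∂P else 0

/-- The shift is itself random, so measurability jointly in the innovation and the shift is needed
in order to freeze one of them. -/
theorem measurable_centredRem (hϱ : ConvexOn ℝ Set.univ ϱ) {U : Ω → ℝ} (hU : Measurable U) (δ : ℝ) :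
    Measurable (Function.uncurry (centredRem P U ϱ q δ)) := by
  have hg : StronglyMeasurable (fun h : ℝ => ∫ ω, lossRem ϱ (U ω) h ∂P) := by
    have h1 : Measurable (fun p : Ω × ℝ => lossRem ϱ (U p.1) p.2) :=
      (measurable_lossRem hϱ).comp ((hU.comp measurable_fst).prodMk measurable_snd)
    exact h1.stronglyMeasurable.integral_prod_left'
  refine Measurable.ite (measurableSet_le measurable_snd.abs measurable_const) ?_ measurable_const
  exact ((measurable_lossRem hϱ).comp ((measurable_fst.sub_const q).prodMk measurable_snd)).sub
    (hg.measurable.comp measurable_snd)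

/-- The remainder and its mean are both nonnegative and bounded through `lossRem_le`. The domination
is by a product of a function of the innovation and the shift, whose second moment factors by
independence. -/
theorem abs_centredRem_le (hϱ : ConvexOn ℝ Set.univ ϱ) {U : Ω → ℝ} (hU : Measurable U) {δ : ℝ}
    (hδ : 0 ≤ δ) (hosc : MemLp (fun ω => scoreOsc ϱ δ (U ω)) 2 P) (x h : ℝ) :
    |centredRem P U ϱ q δ x h| ≤
      |(scoreOsc ϱ δ (x - q) + ∫ ω, scoreOsc ϱ δ (U ω) ∂P) * h| := by
  have hb : 0 ≤ ∫ ω, scoreOsc ϱ δ (U ω) ∂P := integral_nonneg fun ω => scoreOsc_nonneg hϱ hδ _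
  have hx := scoreOsc_nonneg hϱ hδ (x - q)
  unfold centredRem
  split_ifs with hh
  · have h1 := lossRem_nonneg hϱ (x - q) h
    have h2 := lossRem_le hϱ hh (x - q)
    have h3 : 0 ≤ ∫ ω, lossRem ϱ (U ω) h ∂P := integral_nonneg fun ω => lossRem_nonneg hϱ _ _
    have h4 : ∫ ω, lossRem ϱ (U ω) h ∂P ≤ |h| * ∫ ω, scoreOsc ϱ δ (U ω) ∂P := by
      rw [← integral_const_mul]
      exact integral_mono (integrable_lossRem hϱ hU hosc hh)
        ((hosc.integrable one_le_two).const_mul _) fun ω => lossRem_le hϱ hh _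
    rw [abs_mul, abs_of_nonneg (by linarith : 0 ≤ scoreOsc ϱ δ (x - q) +
      ∫ ω, scoreOsc ϱ δ (U ω) ∂P), abs_le]
    have h5 := mul_nonneg (abs_nonneg h) hx
    have h6 := mul_nonneg (abs_nonneg h) hb
    constructor <;> nlinarith
  · simp only [abs_zero]
    positivity

/-- The truncated martingale part of the objective has small second moment. -/
theorem centredRem_sum_sq_le (he : IsInnovation P e σ) (hϱ : ConvexOn ℝ Set.univ ϱ) {δ : ℝ}
    (hδ : 0 ≤ δ) (hosc : MemLp (fun ω => scoreOsc ϱ δ (e 1 ω - q)) 2 P) {n : ℕ}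
    (hd : 0 < 1 - r n ^ 2) (hn : 0 < n) (v : ℝ × ℝ) :
    MemLp (fun ω => ∑ t ∈ Finset.range n,
      centredRem P (fun ω => e 1 ω - q) ϱ q δ (e (t + 1) ω) (shift σ r m e n t ω v)) 2 P ∧
    ∫ ω, (∑ t ∈ Finset.range n, centredRem P (fun ω => e 1 ω - q) ϱ q δ (e (t + 1) ω)
      (shift σ r m e n t ω v)) ^ 2 ∂P ≤
      4 * (∫ ω, scoreOsc ϱ δ (e 1 ω - q) ^ 2 ∂P) * (2 * (v.1 ^ 2 + v.2 ^ 2)) := by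
  have hU : Measurable (fun ω => e 1 ω - q) := (he.meas 1).sub_const q
  set b := ∫ ω, scoreOsc ϱ δ (e 1 ω - q) ∂P with hb
  set φ : ℝ → ℝ := fun x => scoreOsc ϱ δ (x - q) + b with hφ
  have hψm : Measurable (leftDeriv ϱ) := (leftDeriv_mono hϱ).measurable
  have hφm : Measurable φ := by
    refine Measurable.add_const ?_ b
    exact (hψm.comp ((measurable_id.sub_const q).add_const δ)).sub
      (hψm.comp ((measurable_id.sub_const q).sub_const δ))
  have hφ1 : MemLp (fun ω => φ (e 1 ω)) 2 P := hosc.add (memLp_const b)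
  have hφt : ∀ t, MemLp (fun ω => φ (e t ω)) 2 P := fun t =>
    ((he.ident t).comp hφm).memLp_iff.2 hφ1
  -- With `Y` the oscillation and `b` its mean, the second moment of `Y + b` is `E Y² + 3 b²`, and
  -- nonnegativity of the variance gives `b² ≤ E Y²`.
  have hφsq : ∫ ω, φ (e 1 ω) ^ 2 ∂P ≤ 4 * ∫ ω, scoreOsc ϱ δ (e 1 ω - q) ^ 2 ∂P := by
    have i1 := hosc.integrable_sq
    have i0 := hosc.integrable one_le_two
    have hvar : 0 ≤ ∫ ω, (scoreOsc ϱ δ (e 1 ω - q) - b) ^ 2 ∂P :=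
      integral_nonneg fun ω => sq_nonneg _
    have x1 : ∀ ω, (scoreOsc ϱ δ (e 1 ω - q) - b) ^ 2 = scoreOsc ϱ δ (e 1 ω - q) ^ 2 +
        (-2 * b) * scoreOsc ϱ δ (e 1 ω - q) + b ^ 2 := fun ω => by ring
    have x2 : ∀ ω, φ (e 1 ω) ^ 2 = scoreOsc ϱ δ (e 1 ω - q) ^ 2 +
        (2 * b) * scoreOsc ϱ δ (e 1 ω - q) + b ^ 2 := fun ω => by simp only [hφ]; ring
    simp_rw [x1] at hvar
    simp_rw [x2]
    rw [integral_add (i1.fun_add (i0.const_mul _)) (integrable_const _),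
      integral_add i1 (i0.const_mul _), integral_const_mul, ← hb] at hvar ⊢
    simp only [integral_const, probReal_univ, one_smul] at hvar ⊢
    linarith
  have hind : ∀ t, IndepFun (fun ω => φ (e (t + 1) ω)) (fun ω => shift σ r m e n t ω v) P :=
    fun t => (indepFun_hist he.meas he.indep (measurable_shift m he n t v)).comp hφm measurable_id
  have hprod : ∀ t, MemLp (fun ω => φ (e (t + 1) ω) * shift σ r m e n t ω v) 2 P := fun t =>
    memLp_mul_of_indepFun (hφt _) (memLp_shift m he n t v) (hind t)
  have hmeasΦ := measurable_centredRem (P := P) (q := q) hϱ hU δ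
  have hsm : ∀ t, Measurable (fun ω => shift σ r m e n t ω v) := fun t =>
    (measurable_shift m he n t v).mono ((hist he.meas).le t) le_rfl
  have hle : ∀ t ω, ‖centredRem P (fun ω => e 1 ω - q) ϱ q δ (e (t + 1) ω)
      (shift σ r m e n t ω v)‖ ≤ ‖φ (e (t + 1) ω) * shift σ r m e n t ω v‖ := fun t ω =>
    abs_centredRem_le hϱ hU hδ hosc _ _
  have hL : ∀ t, MemLp (fun ω => centredRem P (fun ω => e 1 ω - q) ϱ q δ (e (t + 1) ω)
      (shift σ r m e n t ω v)) 2 P := fun t =>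
    (hprod t).mono (hmeasΦ.comp ((he.meas _).prodMk (hsm t))).aestronglyMeasurable
      (ae_of_all _ (hle t))
  refine ⟨memLp_finsetSum _ fun t _ => hL t, ?_⟩
  rw [integral_sq_sum_eq he.meas he.indep hmeasΦ (fun t => measurable_shift m he n t v)
    (fun t h => ?_) hL]
  · have hterm : ∀ t, ∫ ω, centredRem P (fun ω => e 1 ω - q) ϱ q δ (e (t + 1) ω)
        (shift σ r m e n t ω v) ^ 2 ∂P ≤
        (∫ ω, φ (e 1 ω) ^ 2 ∂P) * ∫ ω, shift σ r m e n t ω v ^ 2 ∂P := fun t => by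
      rw [← he.integral_comp (hφm.pow_const 2) (t + 1), ← integral_mul_sq_of_indepFun (hφt _).1
        (memLp_shift m he n t v).1 (hind t)]
      exact integral_mono (hL t).integrable_sq (hprod t).integrable_sq fun ω =>
        sq_le_sq.2 (hle t ω)
    refine (Finset.sum_le_sum fun t _ => hterm t).trans ?_
    rw [← Finset.mul_sum]
    exact mul_le_mul hφsq (sum_integral_shift_sq_le m he hd hn v)
      (Finset.sum_nonneg fun t _ => integral_nonneg fun ω => sq_nonneg _)
      (mul_nonneg (by norm_num) (integral_nonneg fun ω => sq_nonneg _))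
  · by_cases hh : |h| ≤ δ
    · simp only [centredRem, if_pos hh]
      have hm1 : Measurable (fun x : ℝ => lossRem ϱ (x - q) h) :=
        (measurable_lossRem hϱ).comp ((measurable_id.sub_const q).prodMk measurable_const)
      have i1 : Integrable (fun ω => lossRem ϱ (e 1 ω - q) h) P :=
        integrable_lossRem hϱ hU hosc hh
      have i2 : Integrable (fun ω => lossRem ϱ (e (t + 1) ω - q) h) P :=
        ((he.ident (t + 1)).comp hm1).integrable_iff.2 i1
      rw [integral_sub i2 (integrable_const _), he.integral_comp hm1]
      simp
    · simp [centredRem, if_neg hh]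

/-- The localized objective converges pointwise, in probability, to a quadratic form. -/
theorem isLittleOP_sum_lossRem (he : IsInnovation P e σ) (hr : IsNearStationary r)
    (hϱ : IsRegularLoss P ϱ (fun ω => e 1 ω - q) ξ) (v : ℝ × ℝ) :
    IsLittleOP P (fun n ω =>
      ∑ t ∈ Finset.range n, lossRem ϱ (e (t + 1) ω - q) (shift σ r m e n t ω v) -
        ξ / 2 * (v.1 ^ 2 + v.2 ^ 2)) := by
  intro η hη
  have hU : Measurable (fun ω => e 1 ω - q) := (he.meas 1).sub_const q
  set V := v.1 ^ 2 + v.2 ^ 2 with hV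
  have hV0 : 0 ≤ V := by positivity
  have hξ := hϱ.pos
  refine tendsto_measure_zero_of_real fun κ hκ => ?_
  -- Budget for `η`: the martingale part uses `η / 2`, the curvature error uses `β V / 2 ≤ η / 4`,
  -- and the deviation of `∑ shift²` from `V`, weighted by `(β + ξ) / 2`, uses the remaining `η /
  -- 4`.
  set β := η / (2 * (V + 1)) with hβ
  have hβ0 : 0 < β := by positivity
  obtain ⟨δ₁, hδ₁, hquad⟩ := exists_integral_lossRem_quadratic hϱ.convex hU hϱ.near hϱ.mean
    hϱ.deriv hβ0
  obtain ⟨δ₂, hδ₂, hosc⟩ := exists_scoreOsc_sq_le hϱ.convex hϱ.near hϱ.deriv.continuousAt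
    (by positivity : 0 < κ * (η / 2) ^ 2 / (24 * (V + 1)))
  set δ := min δ₁ δ₂ with hδdef
  have hδ : 0 < δ := by positivity
  obtain ⟨hoscL, hoscI⟩ := hosc δ hδ (min_le_right _ _)
  -- Off these three exceptional events the martingale part is small, every shift is at most `δ` so
  -- that the truncation in `centredRem` is inactive, and the sum of squared shifts is close to `V`.
  set A₁ : ℕ → Set Ω := fun n => {ω | η / 2 ≤ |∑ t ∈ Finset.range n,
    centredRem P (fun ω => e 1 ω - q) ϱ q δ (e (t + 1) ω) (shift σ r m e n t ω v)|} with hA₁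
  set A₂ : ℕ → Set Ω := fun n =>
    {ω | ∃ t < n, δ / (2 * (|v.2| + 1)) * scale σ r m n ≤ |zArr r m e n t ω|} with hA₂
  set A₃ : ℕ → Set Ω := fun n => {ω | η / (2 * (β + ξ)) ≤
    |∑ t ∈ Finset.range n, shift σ r m e n t ω v ^ 2 - V|} with hA₃
  have ev : ∀ {S : ℕ → Set Ω}, Tendsto (fun n => P (S n)) atTop (𝓝 0) →
      ∀ᶠ n in atTop, P.real (S n) < κ / 3 := fun {S} hS => by
    have := (ENNReal.tendsto_toReal_zero_iff (fun n => measure_ne_top P (S n))).2 hS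
    exact this.eventually (gt_mem_nhds (by positivity))
  have h2 := ev (tendsto_measure_exists_zArr m he hr
    (by positivity : 0 < δ / (2 * (|v.2| + 1))))
  have h3 := ev (isLittleOP_sum_shift_sq m he hr v (η / (2 * (β + ξ))) (by positivity))
  have hsqrt : Tendsto (fun n : ℕ => |v.1| / √(n : ℝ)) atTop (𝓝 0) :=
    tendsto_const_nhds.div_atTop (Real.tendsto_sqrt_atTop.comp tendsto_natCast_atTop_atTop)
  filter_upwards [hr.basic, h2, h3, hsqrt.eventually (gt_mem_nhds (half_pos hδ))]
    with n hn hn2 hn3 hn4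
  obtain ⟨-, -, hd, hpos⟩ := hn
  have hs := scale_pos (m := m) he.pos hd hpos
  obtain ⟨hm1, hm2⟩ := centredRem_sum_sq_le m he hϱ.convex hδ.le hoscL hd hpos v
  have hn1 : P.real (A₁ n) ≤ κ / 3 := by
    refine (measureReal_le_abs_le hm1 (half_pos hη)).trans ?_
    rw [div_le_iff₀ (by positivity)]
    refine hm2.trans ?_
    calc 4 * (∫ ω, scoreOsc ϱ δ (e 1 ω - q) ^ 2 ∂P) * (2 * V)
        ≤ 4 * (κ * (η / 2) ^ 2 / (24 * (V + 1))) * (2 * (V + 1)) := by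
          gcongr
          linarith
      _ = κ / 3 * (η / 2) ^ 2 := by field_simp; norm_num
  have hsub : {ω | η ≤ |∑ t ∈ Finset.range n, lossRem ϱ (e (t + 1) ω - q)
      (shift σ r m e n t ω v) - ξ / 2 * V|} ⊆ A₁ n ∪ A₂ n ∪ A₃ n := by
    intro ω hω
    by_contra hcon
    simp only [hA₁, hA₂, hA₃, Set.mem_union, Set.mem_ofPred_eq, not_or, not_le, not_exists,
      not_and] at hcon hω
    obtain ⟨⟨c1, c2⟩, c3⟩ := hcon
    have hsh : ∀ t ∈ Finset.range n, |shift σ r m e n t ω v| ≤ δ := fun t ht => by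
      have hz := c2 t (Finset.mem_range.1 ht)
      have hz' : |zArr r m e n t ω / scale σ r m n| ≤ δ / (2 * (|v.2| + 1)) := by
        rw [abs_div, abs_of_pos hs, div_le_iff₀ hs]
        exact hz.le
      have hfst : |v.1 / √(n : ℝ)| ≤ δ / 2 := by
        rw [abs_div, abs_of_nonneg (Real.sqrt_nonneg _)]
        exact hn4.le
      calc |shift σ r m e n t ω v|
          ≤ |v.1 / √(n : ℝ)| + |v.2| * |zArr r m e n t ω / scale σ r m n| := by
            rw [← abs_mul]; exact abs_add_le _ _
        _ ≤ δ / 2 + (|v.2| + 1) * (δ / (2 * (|v.2| + 1))) := by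
            gcongr
            linarith
        _ = δ := by field_simp; ring
    have hdecomp : ∑ t ∈ Finset.range n, lossRem ϱ (e (t + 1) ω - q) (shift σ r m e n t ω v) =
        ∑ t ∈ Finset.range n, centredRem P (fun ω => e 1 ω - q) ϱ q δ (e (t + 1) ω)
          (shift σ r m e n t ω v) +
        ∑ t ∈ Finset.range n, ∫ ω', lossRem ϱ (e 1 ω' - q) (shift σ r m e n t ω v) ∂P := by
      rw [← Finset.sum_add_distrib]
      refine Finset.sum_congr rfl fun t ht => ?_
      rw [centredRem, if_pos (hsh t ht)]
      ring
    have hg : |∑ t ∈ Finset.range n, ∫ ω', lossRem ϱ (e 1 ω' - q) (shift σ r m e n t ω v) ∂P -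
        ξ / 2 * ∑ t ∈ Finset.range n, shift σ r m e n t ω v ^ 2| ≤
        β / 2 * ∑ t ∈ Finset.range n, shift σ r m e n t ω v ^ 2 := by
      rw [Finset.mul_sum, Finset.mul_sum, ← Finset.sum_sub_distrib]
      refine (Finset.abs_sum_le_sum_abs _ _).trans (Finset.sum_le_sum fun t ht => ?_)
      have := hquad _ ((hsh t ht).trans (min_le_left _ _))
      refine le_trans (le_of_eq ?_) (this.trans (le_of_eq (by ring)))
      congr 1
      ring
    rw [hdecomp] at hω
    set S₁ := ∑ t ∈ Finset.range n, centredRem P (fun ω => e 1 ω - q) ϱ q δ (e (t + 1) ω)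
          (shift σ r m e n t ω v)
    set S₂ := ∑ t ∈ Finset.range n, ∫ ω', lossRem ϱ (e 1 ω' - q) (shift σ r m e n t ω v) ∂P
    set Q := ∑ t ∈ Finset.range n, shift σ r m e n t ω v ^ 2
    rw [lt_div_iff₀ (by positivity)] at c3
    have hβV : β * V ≤ η / 2 := by
      rw [hβ, div_mul_eq_mul_div, div_le_div_iff₀ (by positivity) (by norm_num)]
      nlinarith
    have hQ1 : β / 2 * Q ≤ β / 2 * |Q - V| + β / 2 * V := by
      have := le_abs_self (Q - V)
      nlinarith
    have hQ2 : |ξ / 2 * Q - ξ / 2 * V| = ξ / 2 * |Q - V| := by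
      rw [← mul_sub, abs_mul, abs_of_pos (by positivity)]
    have htri : |S₁ + S₂ - ξ / 2 * V| ≤ |S₁| + |S₂ - ξ / 2 * Q| + |ξ / 2 * Q - ξ / 2 * V| := by
      have : S₁ + S₂ - ξ / 2 * V = S₁ + (S₂ - ξ / 2 * Q) + (ξ / 2 * Q - ξ / 2 * V) := by ring
      rw [this]
      exact (abs_add_le _ _).trans (by gcongr; exact abs_add_le _ _)
    nlinarith
  calc P.real _ ≤ P.real (A₁ n ∪ A₂ n ∪ A₃ n) := measureReal_mono hsub
    _ ≤ P.real (A₁ n) + P.real (A₂ n) + P.real (A₃ n) :=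
      (measureReal_union_le _ _).trans (add_le_add_left (measureReal_union_le _ _) _)
    _ ≤ κ / 3 + κ / 3 + κ / 3 := add_le_add (add_le_add hn1 hn2.le) hn3.le
    _ = κ := by ring

omit mΩ in
theorem convexOn_sum_lossRem (hϱ : ConvexOn ℝ Set.univ ϱ) (n : ℕ) (ω : Ω) :
    ConvexOn ℝ Set.univ (fun v : ℝ × ℝ =>
      ∑ t ∈ Finset.range n, lossRem ϱ (e (t + 1) ω - q) (shift σ r m e n t ω v)) := by
  refine ⟨convex_univ, fun x _ y _ a b ha hb hab => ?_⟩
  simp only [smul_eq_mul]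
  rw [Finset.mul_sum, Finset.mul_sum, ← Finset.sum_add_distrib]
  refine Finset.sum_le_sum fun t _ => ?_
  set u := e (t + 1) ω - q
  have hlin : shift σ r m e n t ω (a • x + b • y) =
      a * shift σ r m e n t ω x + b * shift σ r m e n t ω y := by
    simp only [shift, Prod.fst_add, Prod.snd_add, Prod.smul_fst, Prod.smul_snd, smul_eq_mul]
    ring
  rw [hlin]
  have h := hϱ.2 (Set.mem_univ (u - shift σ r m e n t ω x))
    (Set.mem_univ (u - shift σ r m e n t ω y)) ha hb hab
  simp only [smul_eq_mul] at h
  have hu : a * (u - shift σ r m e n t ω x) + b * (u - shift σ r m e n t ω y) =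
      u - (a * shift σ r m e n t ω x + b * shift σ r m e n t ω y) := by
    have : a * u + b * u = u := by rw [← add_mul, hab, one_mul]
    linarith
  rw [hu] at h
  have hab' : a * ϱ u + b * ϱ u = ϱ u := by rw [← add_mul, hab, one_mul]
  unfold lossRem
  linarith

/-- The normalized score `∑ ψ(u_t) Z_t`. -/
noncomputable def scoreSum (σ : ℝ) (r m : ℕ → ℝ) (e : ℕ → Ω → ℝ) (ϱ : ℝ → ℝ) (q : ℝ) (n : ℕ)
    (ω : Ω) : ℝ × ℝ :=
  ((∑ t ∈ Finset.range n, leftDeriv ϱ (e (t + 1) ω - q)) / √n,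
    (∑ t ∈ Finset.range n, leftDeriv ϱ (e (t + 1) ω - q) * zArr r m e n t ω) / scale σ r m n)

theorem isBigOP_scoreSum (he : IsInnovation P e σ) (hr : IsNearStationary r)
    (hϱ : IsRegularLoss P ϱ (fun ω => e 1 ω - q) ξ) :
    IsBigOP P (fun n ω => (scoreSum σ r m e ϱ q n ω).1) ∧
    IsBigOP P (fun n ω => (scoreSum σ r m e ϱ q n ω).2) := by
  have hψ : Measurable (fun x => leftDeriv ϱ (x - q)) :=
    (leftDeriv_mono hϱ.convex).measurable.comp (measurable_id.sub_const q)
  constructor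
  · refine isBigOP_of_integral_sq (C := ∫ ω, leftDeriv ϱ (e 1 ω - q) ^ 2 ∂P) ?_
    filter_upwards [eventually_gt_atTop 0] with n hn
    have hn' : (0 : ℝ) < n := by exact_mod_cast hn
    obtain ⟨h1, h2⟩ := memLp_and_integral_sq_sum he hψ hϱ.memLp hϱ.mean n
    refine ⟨by simpa only [scoreSum, div_eq_mul_inv] using h1.mul_const _, ?_⟩
    simp only [scoreSum, div_pow, Real.sq_sqrt hn'.le]
    rw [integral_div, h2, mul_div_cancel_left₀ _ hn'.ne']
  · refine isBigOP_of_integral_sq (C := ∫ ω, leftDeriv ϱ (e 1 ω - q) ^ 2 ∂P) ?_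
    filter_upwards [hr.basic] with n hn
    obtain ⟨-, -, hd, hpos⟩ := hn
    have hs := scale_pos (m := m) he.pos hd hpos
    obtain ⟨h1, h2⟩ := memLp_and_integral_sq_transform m he hψ hϱ.memLp hϱ.mean hd
    refine ⟨by simpa only [scoreSum, div_eq_mul_inv] using h1.mul_const _, ?_⟩
    simp only [scoreSum, div_pow]
    rw [integral_div, div_le_iff₀ (by positivity)]
    exact h2

/-- The Bahadur representation in the orthogonalized parametrization. -/
theorem isLittleOP_argmin_sub_scoreSum (he : IsInnovation P e σ) (hr : IsNearStationary r)
    (hϱ : IsRegularLoss P ϱ (fun ω => e 1 ω - q) ξ) {x : ℕ → Ω → ℝ × ℝ}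
    (hx : ∀ᶠ n in atTop, ∀ᵐ ω ∂P, ∀ v : ℝ × ℝ,
      ∑ t ∈ Finset.range n, ϱ (e (t + 1) ω - q - shift σ r m e n t ω (x n ω)) ≤
        ∑ t ∈ Finset.range n, ϱ (e (t + 1) ω - q - shift σ r m e n t ω v)) :
    IsLittleOP P (fun n ω => (x n ω).1 - ξ⁻¹ * (scoreSum σ r m e ϱ q n ω).1) ∧
    IsLittleOP P (fun n ω => (x n ω).2 - ξ⁻¹ * (scoreSum σ r m e ϱ q n ω).2) := by
  obtain ⟨hw1, hw2⟩ := isBigOP_scoreSum m he hr hϱ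
  refine argmin_isLittleOP (fun n ω => convexOn_sum_lossRem m hϱ.convex n ω) hϱ.pos
    (isLittleOP_sum_lossRem m he hr hϱ) hw1 hw2 ?_
  -- The tilted process is the loss at `v` minus the loss at `0`, and the latter does not depend on
  -- `v`. Both therefore have the same minimizers.
  have key : ∀ n ω (v : ℝ × ℝ),
      ∑ t ∈ Finset.range n, lossRem ϱ (e (t + 1) ω - q) (shift σ r m e n t ω v) -
        ((scoreSum σ r m e ϱ q n ω).1 * v.1 + (scoreSum σ r m e ϱ q n ω).2 * v.2) =
      ∑ t ∈ Finset.range n, ϱ (e (t + 1) ω - q - shift σ r m e n t ω v) -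
        ∑ t ∈ Finset.range n, ϱ (e (t + 1) ω - q) := fun n ω v => by
    have hW : (scoreSum σ r m e ϱ q n ω).1 * v.1 + (scoreSum σ r m e ϱ q n ω).2 * v.2 =
        ∑ t ∈ Finset.range n, shift σ r m e n t ω v * leftDeriv ϱ (e (t + 1) ω - q) := by
      simp only [scoreSum, div_mul_eq_mul_div, Finset.sum_mul, Finset.sum_div]
      rw [← Finset.sum_add_distrib]
      refine Finset.sum_congr rfl fun t _ => ?_
      simp only [shift]
      ring
    rw [hW, ← Finset.sum_sub_distrib, ← Finset.sum_sub_distrib]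
    refine Finset.sum_congr rfl fun t _ => ?_
    simp only [lossRem]
    ring
  filter_upwards [hx] with n hn
  filter_upwards [hn] with ω hω v
  rw [key, key]
  linarith [hω v]

end

/-! ### Index shift and inverse of a diagonal matrix. -/

theorem sum_Icc_one_eq_sum_range {M : Type*} [AddCommMonoid M] (f : ℕ → M) (n : ℕ) :
    ∑ t ∈ Finset.Icc 1 n, f t = ∑ t ∈ Finset.range n, f (t + 1) := by
  induction n with
  | zero => simp
  | succ n ih => rw [Finset.sum_Icc_succ_top (by omega), ih, Finset.sum_range_succ]

theorem inv_diagonal_mulVec {d : Fin 2 → ℝ} (hd : ∀ i, d i ≠ 0) (w : Fin 2 → ℝ) (i : Fin 2) :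
    ((Matrix.diagonal d)⁻¹ *ᵥ w) i = w i / d i := by
  have h : (Matrix.diagonal d)⁻¹ = Matrix.diagonal (fun i => (d i)⁻¹) := by
    refine Matrix.inv_eq_right_inv ?_
    rw [Matrix.diagonal_mul_diagonal, ← Matrix.diagonal_one]
    congr 1
    ext i
    exact mul_inv_cancel₀ (hd i)
  rw [h, Matrix.mulVec_diagonal, div_eq_inv_mul]

/-! ### Deterministic rates, where the conditions on `μ_n` enter. -/

section Rates

variable {c γ : ℝ}

theorem k_pos {n : ℕ} (hn : 0 < n) : 0 < k γ n :=
  Real.rpow_pos_of_pos (by exact_mod_cast hn) _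

theorem tendsto_k (hγ : γ ∈ Set.Ioo (0 : ℝ) 1) : Tendsto (k γ) atTop atTop :=
  (tendsto_rpow_atTop hγ.1).comp tendsto_natCast_atTop_atTop

theorem tendsto_div_k (hγ : γ ∈ Set.Ioo (0 : ℝ) 1) :
    Tendsto (fun n : ℕ => (n : ℝ) / k γ n) atTop atTop := by
  have h : Tendsto (fun n : ℕ => (n : ℝ) ^ (1 - γ)) atTop atTop :=
    (tendsto_rpow_atTop (by linarith [hγ.2])).comp tendsto_natCast_atTop_atTop
  refine h.congr' ?_
  filter_upwards [eventually_gt_atTop 0] with n hn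
  rw [Real.rpow_sub (by exact_mod_cast hn), Real.rpow_one, k]

theorem tendsto_k_div (hγ : γ ∈ Set.Ioo (0 : ℝ) 1) :
    Tendsto (fun n : ℕ => k γ n / n) atTop (𝓝 0) := by
  refine (tendsto_div_k hγ).inv_tendsto_atTop.congr fun n => ?_
  simp

theorem tendsto_rho (hγ : γ ∈ Set.Ioo (0 : ℝ) 1) : Tendsto (rho c γ) atTop (𝓝 1) := by
  have := (tendsto_const_nhds (x := c)).div_atTop (tendsto_k hγ)
  have h := this.const_add 1
  rw [add_zero] at h
  exact h

theorem isNearStationary_rho (hc : c < 0) (hγ : γ ∈ Set.Ioo (0 : ℝ) 1) :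
    IsNearStationary (rho c γ) where
  tendsto := tendsto_rho hγ
  lt_one := by
    filter_upwards [eventually_gt_atTop 0] with n hn
    have := div_neg_of_neg_of_pos hc (k_pos (γ := γ) hn)
    simp only [rho]
    linarith
  rate := by
    have h1 : Tendsto (fun n : ℕ => (n : ℝ) / k γ n * (-c)) atTop atTop :=
      (tendsto_div_k hγ).atTop_mul_const (by linarith)
    have h2 : Tendsto (fun n => 1 + rho c γ n) atTop (𝓝 2) := by
      have := (tendsto_rho (c := c) hγ).const_add 1
      norm_num at this
      exact this
    refine (h1.atTop_mul_pos two_pos h2).congr fun n => ?_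
    simp only [rho]
    ring

/-- The stationary mean `m_n = μ_n / (1 - ρ_n)`. -/
noncomputable def centre (c γ : ℝ) (μ : ℕ → ℝ) (n : ℕ) : ℝ := μ n / (1 - rho c γ n)

variable {μ : ℕ → ℝ} {σ : ℝ}

theorem centre_eq {n : ℕ} (hn : 0 < n) : centre c γ μ n = μ n * k γ n / (-c) := by
  have hk := (k_pos (γ := γ) hn).ne'
  have h : 1 - rho c γ n = -c / k γ n := by simp only [rho]; ring
  rw [centre, h, div_div_eq_mul_div]

theorem tendsto_inv_sqrt : Tendsto (fun n : ℕ => 1 / √(n : ℝ)) atTop (𝓝 0) :=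
  tendsto_const_nhds.div_atTop (Real.tendsto_sqrt_atTop.comp tendsto_natCast_atTop_atTop)

theorem tendsto_sqrt_gap {r : ℕ → ℝ} (hr : IsNearStationary r) :
    Tendsto (fun n => √(1 - r n ^ 2)) atTop (𝓝 0) := by
  have := (Real.continuous_sqrt.tendsto 0).comp hr.gap
  rwa [Real.sqrt_zero] at this

theorem tendsto_div_scale (hσ : 0 < σ) {r : ℕ → ℝ} (hr : IsNearStationary r) (m : ℕ → ℝ) :
    Tendsto (fun n => m n / scale σ r m n) atTop (𝓝 0) := by
  refine squeeze_zero_norm' ?_ (tendsto_sqrt_gap hr)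
  filter_upwards [hr.basic] with n hn
  have hs := scale_pos (m := m) hσ hn.2.2.1 hn.2.2.2
  rw [Real.norm_eq_abs, abs_div, abs_of_pos hs, div_le_iff₀ hs]
  exact abs_le_scale hn.2.2.1

theorem sqrt_div_scale_le (hσ : 0 < σ) {r m : ℕ → ℝ} {n : ℕ} (hd : 0 < 1 - r n ^ 2) (hn : 0 < n) :
    √n / scale σ r m n ≤ √(1 - r n ^ 2) / σ := by
  have hn' : (0 : ℝ) < n := by exact_mod_cast hn
  have hs := scale_pos (m := m) hσ hd hn
  rw [div_le_div_iff₀ hs hσ]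
  have h1 : √(1 - r n ^ 2) * scale σ r m n = √(m n ^ 2 + n * σ ^ 2) := by
    rw [scale, ← Real.sqrt_mul hd.le, mul_div_cancel₀ _ hd.ne']
  rw [h1]
  refine Real.le_sqrt_of_sq_le ?_
  rw [mul_pow, Real.sq_sqrt hn'.le]
  nlinarith [sq_nonneg (m n)]

theorem tendsto_inv_scale (hσ : 0 < σ) {r : ℕ → ℝ} (hr : IsNearStationary r) (m : ℕ → ℝ) :
    Tendsto (fun n => 1 / scale σ r m n) atTop (𝓝 0) := by
  have hlim : Tendsto (fun n => √(1 - r n ^ 2) / σ) atTop (𝓝 0) := by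
    simpa using (tendsto_sqrt_gap hr).div_const σ
  refine squeeze_zero_norm' ?_ hlim
  filter_upwards [hr.basic] with n hn
  have hs := scale_pos (m := m) hσ hn.2.2.1 hn.2.2.2
  refine le_trans ?_ (sqrt_div_scale_le (m := m) hσ hn.2.2.1 hn.2.2.2)
  rw [Real.norm_eq_abs, abs_of_pos (by positivity)]
  gcongr
  exact Real.one_le_sqrt.2 (by exact_mod_cast hn.2.2.2)

theorem gap_eq {n : ℕ} : 1 - rho c γ n ^ 2 = -c / k γ n * (1 + rho c γ n) := by
  simp only [rho]; ring

/-- Since `1 - ρ_n² ≥ -c / k_n`, the square of the ratio is at most `(μ_n / √n)² (k_n / n) / (-c)³ +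
σ² / (-c n k_n)`. -/
theorem tendsto_scale_div (hσ : 0 < σ) (hc : c < 0) (hγ : γ ∈ Set.Ioo (0 : ℝ) 1)
    (hμ : Tendsto (fun n : ℕ => μ n / √(n : ℝ)) atTop (𝓝 0)) :
    Tendsto (fun n : ℕ => scale σ (rho c γ) (centre c γ μ) n / (n * k γ n)) atTop (𝓝 0) := by
  have hr := isNearStationary_rho hc hγ
  have hlim : Tendsto (fun n : ℕ => √((μ n / √(n : ℝ)) ^ 2 * (k γ n / n) / (-c) ^ 3 +
      σ ^ 2 / (-c) / (n * k γ n))) atTop (𝓝 0) := by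
    have h1 : Tendsto (fun n : ℕ => (μ n / √(n : ℝ)) ^ 2 * (k γ n / n) / (-c) ^ 3) atTop (𝓝 0) := by
      simpa using ((hμ.pow 2).mul (tendsto_k_div hγ)).div_const ((-c) ^ 3)
    have h2 : Tendsto (fun n : ℕ => σ ^ 2 / (-c) / (n * k γ n)) atTop (𝓝 0) :=
      tendsto_const_nhds.div_atTop (tendsto_natCast_atTop_atTop.atTop_mul_atTop₀ (tendsto_k hγ))
    have h3 := (Real.continuous_sqrt.tendsto 0).comp (by simpa using h1.add h2)
    rw [Real.sqrt_zero] at h3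
    exact h3
  refine squeeze_zero_norm' ?_ hlim
  filter_upwards [hr.basic] with n hn
  obtain ⟨h0, h1, hd, hpos⟩ := hn
  have hn' : (0 : ℝ) < n := by exact_mod_cast hpos
  have hk := k_pos (γ := γ) hpos
  have hc' : 0 < -c := by linarith
  have hs := scale_pos (m := centre c γ μ) hσ hd hpos
  rw [Real.norm_eq_abs, abs_of_pos (by positivity)]
  refine Real.le_sqrt_of_sq_le ?_
  rw [div_pow, scale_sq hd, centre_eq hpos]
  have hgap : -c / k γ n ≤ 1 - rho c γ n ^ 2 := by
    rw [gap_eq]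
    exact le_mul_of_one_le_right (by positivity) (by linarith)
  calc ((μ n * k γ n / -c) ^ 2 + n * σ ^ 2) / (1 - rho c γ n ^ 2) / (n * k γ n) ^ 2
      ≤ ((μ n * k γ n / -c) ^ 2 + n * σ ^ 2) / (-c / k γ n) / (n * k γ n) ^ 2 := by
        gcongr
    _ = _ := by
        rw [div_pow (μ n), Real.sq_sqrt hn'.le]
        have := hc'.ne'
        generalize -c = d at *
        field_simp

/-- The expression equals `μ_n / (-c √n)`, so `μ_n = o(√n)` is exactly what this coefficient needs.
-/
theorem tendsto_centre_div (hc : c < 0)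
    (hμ : Tendsto (fun n : ℕ => μ n / √(n : ℝ)) atTop (𝓝 0)) :
    Tendsto (fun n : ℕ => centre c γ μ n * √n / (n * k γ n)) atTop (𝓝 0) := by
  have h := hμ.div_const (-c)
  rw [zero_div] at h
  refine h.congr' ?_
  filter_upwards [eventually_gt_atTop 0] with n hn
  have hn' : (0 : ℝ) < n := by exact_mod_cast hn
  have hk := k_pos (γ := γ) hn
  have hsq : √(n : ℝ) ^ 2 = n := Real.sq_sqrt hn'.le
  have hs : 0 < √(n : ℝ) := Real.sqrt_pos.2 hn'
  have hc' : -c ≠ 0 := by linarith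
  rw [centre_eq hn]
  generalize -c = d at *
  field_simp
  rw [hsq]

/-- The bounds `√n / s_n ≤ √(1 - ρ_n²) / σ` and `1 - ρ_n² ≤ -2 c / k_n` leave a constant times `√k_n
|μ_n|`. -/
theorem tendsto_sqrt_mul_centre_div_scale (hσ : 0 < σ) (hc : c < 0) (hγ : γ ∈ Set.Ioo (0 : ℝ) 1)
    (hμ : Tendsto (fun n : ℕ => √(k γ n) * μ n) atTop (𝓝 0)) :
    Tendsto (fun n : ℕ => √n * centre c γ μ n / scale σ (rho c γ) (centre c γ μ) n)
      atTop (𝓝 0) := by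
  have hr := isNearStationary_rho hc hγ
  have hlim : Tendsto (fun n : ℕ => √(-2 * c) / (-c) / σ * |√(k γ n) * μ n|) atTop (𝓝 0) := by
    simpa using hμ.abs.const_mul (√(-2 * c) / (-c) / σ)
  refine squeeze_zero_norm' ?_ hlim
  filter_upwards [hr.basic] with n hn
  obtain ⟨h0, h1, hd, hpos⟩ := hn
  have hk := k_pos (γ := γ) hpos
  have hc' : 0 < -c := by linarith
  have hs := scale_pos (m := centre c γ μ) hσ hd hpos
  have h2 := sqrt_div_scale_le (m := centre c γ μ) hσ hd hpos
  have hgap : √(1 - rho c γ n ^ 2) ≤ √(-2 * c) / √(k γ n) := by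
    rw [← Real.sqrt_div (by linarith)]
    refine Real.sqrt_le_sqrt ?_
    rw [gap_eq, div_mul_eq_mul_div]
    refine div_le_div_of_nonneg_right ?_ hk.le
    nlinarith
  have hsq : √(k γ n) ^ 2 = k γ n := Real.sq_sqrt hk.le
  have hsk : 0 < √(k γ n) := Real.sqrt_pos.2 hk
  rw [Real.norm_eq_abs, mul_comm (√(n : ℝ)), mul_div_assoc, abs_mul,
    abs_of_nonneg (by positivity : 0 ≤ √(n : ℝ) / scale σ (rho c γ) (centre c γ μ) n)]
  calc |centre c γ μ n| * (√n / scale σ (rho c γ) (centre c γ μ) n)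
      ≤ |centre c γ μ n| * (√(-2 * c) / √(k γ n) / σ) := by
        refine mul_le_mul_of_nonneg_left (h2.trans ?_) (abs_nonneg _)
        gcongr
    _ = √(-2 * c) / (-c) / σ * |√(k γ n) * μ n| := by
        rw [centre_eq hpos, abs_div, abs_mul, abs_mul, abs_of_pos hk, abs_of_pos hc',
          abs_of_pos hsk]
        generalize √(-2 * c) = d
        generalize hcc : -c = c' at *
        nth_rewrite 1 [← hsq]
        field_simp

theorem tendsto_centre_div_sqrt (hc : c < 0)
    (hμ : Tendsto (fun n : ℕ => √(k γ n) * μ n) atTop (𝓝 0)) :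
    Tendsto (fun n : ℕ => centre c γ μ n / √(k γ n)) atTop (𝓝 0) := by
  have h := hμ.div_const (-c)
  rw [zero_div] at h
  refine h.congr' ?_
  filter_upwards [eventually_gt_atTop 0] with n hn
  have hk := k_pos (γ := γ) hn
  have hsq : √(k γ n) ^ 2 = k γ n := Real.sq_sqrt hk.le
  have hsk : 0 < √(k γ n) := Real.sqrt_pos.2 hk
  have hc' : -c ≠ 0 := by linarith
  rw [centre_eq hn]
  generalize -c = d at *
  nth_rewrite 2 [← hsq]
  field_simp

/-- When `μ_n` is this small, the `m_n²` in the normalization is negligible against `n σ²`. The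
squared limit is the inverse of the second diagonal entry of `B`. -/
theorem tendsto_sqrt_div_scale (hσ : 0 < σ) (hc : c < 0) (hγ : γ ∈ Set.Ioo (0 : ℝ) 1)
    (hμ : Tendsto (fun n : ℕ => √(k γ n) * μ n) atTop (𝓝 0)) :
    Tendsto (fun n : ℕ => √(n * k γ n) / scale σ (rho c γ) (centre c γ μ) n) atTop
      (𝓝 (√(-2 * c / σ ^ 2))) := by
  have hr := isNearStationary_rho hc hγ
  have hnum : Tendsto (fun n => -c * (1 + rho c γ n)) atTop (𝓝 (-2 * c)) := by
    have := ((tendsto_rho (c := c) hγ).const_add 1).const_mul (-c)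
    have e : -c * (1 + 1) = -2 * c := by ring
    rwa [e] at this
  have hden : Tendsto (fun n : ℕ => (√(k γ n) * μ n) ^ 2 * (k γ n / n) / (-c) ^ 2 + σ ^ 2) atTop
      (𝓝 (σ ^ 2)) := by
    have h := (((hμ.pow 2).mul (tendsto_k_div hγ)).div_const ((-c) ^ 2)).add_const (σ ^ 2)
    rwa [mul_zero, zero_div, zero_add] at h
  have h := (Real.continuous_sqrt.tendsto _).comp (hnum.div hden (by positivity))
  refine h.congr' ?_
  filter_upwards [hr.basic] with n hn
  obtain ⟨h0, h1, hd, hpos⟩ := hn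
  have hn' : (0 : ℝ) < n := by exact_mod_cast hpos
  have hk := k_pos (γ := γ) hpos
  have hc' : 0 < -c := by linarith
  simp only [Function.comp, Pi.div_apply]
  rw [scale, ← Real.sqrt_div (by positivity)]
  congr 1
  rw [centre_eq hpos, gap_eq, mul_pow, Real.sq_sqrt hk.le]
  have h1r : 0 < 1 + rho c γ n := by linarith
  generalize 1 + rho c γ n = a at *
  generalize -c = d at *
  field_simp

end Rates

/-! ### From the orthogonalized coordinates back to the estimator. -/

section Representation

variable {Ω : Type*} [mΩ : MeasurableSpace Ω] {P : Measure Ω} [IsProbabilityMeasure P]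
  {c γ σ q ξ : ℝ} {μ : ℕ → ℝ} {ε : ℕ → Ω → ℝ} {ϱ : ℝ → ℝ}

omit mΩ in
theorem y_eq (hc : c < 0) {n : ℕ} (hn : 0 < n) (t : ℕ) (ω : Ω) :
    y c γ μ ε n t ω = centre c γ μ n + zArr (rho c γ) (centre c γ μ) ε n t ω := by
  refine path_eq_ar ?_ _ _ _
  have := div_neg_of_neg_of_pos hc (k_pos (γ := γ) hn)
  simp only [rho]
  linarith

/-- The normalized, orthogonalized estimation error. -/
noncomputable def estError (c γ σ q : ℝ) (μ : ℕ → ℝ) (n : ℕ) (ϑ : Fin 2 → ℝ) : ℝ × ℝ :=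
  (√n * (ϑ 0 - μ n - q + (ϑ 1 - rho c γ n) * centre c γ μ n),
    scale σ (rho c γ) (centre c γ μ) n * (ϑ 1 - rho c γ n))

-- This is the reason for the definition of `estError`: replacing `y` by `centre + z` moves the mean
-- of the regressor into the intercept coordinate.
omit mΩ in
theorem residual_eq (hσ : 0 < σ) (hc : c < 0) {n : ℕ} (hn : 0 < n) (hd : 0 < 1 - rho c γ n ^ 2)
    (t : ℕ) (ω : Ω) (ϑ : Fin 2 → ℝ) :
    y c γ μ ε n (t + 1) ω - ϑ 0 - ϑ 1 * y c γ μ ε n t ω =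
      ε (t + 1) ω - q - shift σ (rho c γ) (centre c γ μ) ε n t ω (estError c γ σ q μ n ϑ) := by
  have hs := scale_pos (m := centre c γ μ) hσ hd hn
  have hsn : 0 < √(n : ℝ) := Real.sqrt_pos.2 (by exact_mod_cast hn)
  have h1 : y c γ μ ε n (t + 1) ω = μ n + rho c γ n * y c γ μ ε n t ω + ε (t + 1) ω := rfl
  rw [h1, y_eq hc hn]
  simp only [shift, estError]
  rw [mul_div_cancel_left₀ _ hsn.ne']
  field_simp
  ring

omit [IsProbabilityMeasure P] in
theorem IsMEstimator.sum_le {ϑhat : ℕ → Ω → Fin 2 → ℝ} (h : IsMEstimator P ϱ c γ μ ε ϑhat)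
    (hσ : 0 < σ) (hc : c < 0) {n : ℕ} (hn : 0 < n) (hd : 0 < 1 - rho c γ n ^ 2) :
    ∀ᵐ ω ∂P, ∀ v : ℝ × ℝ,
      ∑ t ∈ Finset.range n, ϱ (ε (t + 1) ω - q - shift σ (rho c γ) (centre c γ μ) ε n t ω
        (estError c γ σ q μ n (ϑhat n ω))) ≤
      ∑ t ∈ Finset.range n, ϱ (ε (t + 1) ω - q - shift σ (rho c γ) (centre c γ μ) ε n t ω v) := by
  have hs := scale_pos (m := centre c γ μ) hσ hd hn
  have hn' : (0 : ℝ) < n := by exact_mod_cast hn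
  have hsn : 0 < √(n : ℝ) := Real.sqrt_pos.2 hn'
  filter_upwards [h n] with ω hω v
  set s := scale σ (rho c γ) (centre c γ μ) n
  -- The preimage of `v` under `estError`. Every `v` is attained, so minimality over the parameters
  -- is minimality over all of the plane of local coordinates.
  set ϑ : Fin 2 → ℝ := ![μ n + q + v.1 / √n - v.2 / s * centre c γ μ n, rho c γ n + v.2 / s]
    with hϑ
  have hv : estError c γ σ q μ n ϑ = v := by
    ext
    · simp only [estError, hϑ, Matrix.cons_val_zero, Matrix.cons_val_one]
      field_simp
      ring
    · simp only [estError, hϑ, Matrix.cons_val_one]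
      change s * _ = _
      simp only [Matrix.cons_val_fin_one]
      field_simp
      ring
  have hobj : ∀ ϑ : Fin 2 → ℝ, objective ϱ c γ μ ε n ω ϑ = (1 / (n : ℝ)) *
      ∑ t ∈ Finset.range n, ϱ (ε (t + 1) ω - q - shift σ (rho c γ) (centre c γ μ) ε n t ω
        (estError c γ σ q μ n ϑ)) := fun ϑ => by
    rw [objective, sum_Icc_one_eq_sum_range]
    congr 1
    refine Finset.sum_congr rfl fun t _ => ?_
    rw [Nat.add_sub_cancel, residual_eq (q := q) hσ hc hn hd]
  have := hω ϑ
  rw [hobj, hobj, hv] at this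
  exact le_of_mul_le_mul_left this (by positivity)

-- Exact algebra with no limit involved: each component becomes a combination of estimation errors
-- and scores with deterministic coefficients, whose limits are computed under the rates above. The
-- regressor of the original representation contributes `z + m_n`, hence the extra term in the first
-- score.
omit mΩ in
theorem remainder_apply (hσ : 0 < σ) (hc : c < 0) {n : ℕ} (hn : 0 < n)
    (hd : 0 < 1 - rho c γ n ^ 2) (ϑhat : ℕ → Ω → Fin 2 → ℝ) (ω : Ω) :
    remainder (leftDeriv ϱ) ξ q σ c γ μ ε ϑhat n ω 0 =
      1 / √n * ((estError c γ σ q μ n (ϑhat n ω)).1 -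
        ξ⁻¹ * (scoreSum σ (rho c γ) (centre c γ μ) ε ϱ q n ω).1) -
      centre c γ μ n / scale σ (rho c γ) (centre c γ μ) n *
        (estError c γ σ q μ n (ϑhat n ω)).2 ∧
    remainder (leftDeriv ϱ) ξ q σ c γ μ ε ϑhat n ω 1 =
      1 / scale σ (rho c γ) (centre c γ μ) n * (estError c γ σ q μ n (ϑhat n ω)).2 -
      scale σ (rho c γ) (centre c γ μ) n / (n * k γ n) * (ξ⁻¹ * (-2 * c / σ ^ 2) *
        (scoreSum σ (rho c γ) (centre c γ μ) ε ϱ q n ω).2) -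
      centre c γ μ n * √n / (n * k γ n) * (ξ⁻¹ * (-2 * c / σ ^ 2) *
        (scoreSum σ (rho c γ) (centre c γ μ) ε ϱ q n ω).1) := by
  have hs := scale_pos (m := centre c γ μ) hσ hd hn
  have hn' : (0 : ℝ) < n := by exact_mod_cast hn
  have hsn : 0 < √(n : ℝ) := Real.sqrt_pos.2 hn'
  have hk := k_pos (γ := γ) hn
  have hnk : 0 < √((n : ℝ) * k γ n) := Real.sqrt_pos.2 (by positivity)
  have hsq : √(n : ℝ) * √n = n := Real.mul_self_sqrt hn'.le
  have hsq2 : √((n : ℝ) * k γ n) * √((n : ℝ) * k γ n) = n * k γ n :=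
    Real.mul_self_sqrt (by positivity)
  have hc' : 0 < -2 * c := by linarith
  have hBD : B σ c * D γ n =
      Matrix.diagonal ![√(n : ℝ), σ ^ 2 / (-2 * c) * √((n : ℝ) * k γ n)] := by
    rw [B, D, Matrix.diagonal_mul_diagonal]
    congr 1
    ext i
    fin_cases i <;> simp
  have hBD0 : ∀ i, ![√(n : ℝ), σ ^ 2 / (-2 * c) * √((n : ℝ) * k γ n)] i ≠ 0 := by
    intro i
    fin_cases i
    · exact hsn.ne'
    · exact (mul_pos (div_pos (by positivity) hc') hnk).ne'
  have hD0 : ∀ i, ![√(n : ℝ), √((n : ℝ) * k γ n)] i ≠ 0 := by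
    intro i
    fin_cases i
    · exact hsn.ne'
    · exact hnk.ne'
  set S₀ := ∑ t ∈ Finset.range n, leftDeriv ϱ (ε (t + 1) ω - q) with hS₀
  set S₁ := ∑ t ∈ Finset.range n,
    leftDeriv ϱ (ε (t + 1) ω - q) * zArr (rho c γ) (centre c γ μ) ε n t ω with hS₁
  have hX0 : (∑ t ∈ Finset.Icc 1 n, leftDeriv ϱ (ε t ω - q) • X c γ μ ε n t ω) 0 =
      S₀ / √n := by
    rw [sum_Icc_one_eq_sum_range, Finset.sum_apply, hS₀, Finset.sum_div]
    refine Finset.sum_congr rfl fun t _ => ?_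
    rw [Pi.smul_apply, X, D, inv_diagonal_mulVec hD0]
    simp
    ring
  have hX1 : (∑ t ∈ Finset.Icc 1 n, leftDeriv ϱ (ε t ω - q) • X c γ μ ε n t ω) 1 =
      (S₁ + centre c γ μ n * S₀) / √((n : ℝ) * k γ n) := by
    rw [sum_Icc_one_eq_sum_range, Finset.sum_apply, hS₀, hS₁, Finset.mul_sum,
      ← Finset.sum_add_distrib, Finset.sum_div]
    refine Finset.sum_congr rfl fun t _ => ?_
    rw [Pi.smul_apply, X, D, inv_diagonal_mulVec hD0, Nat.add_sub_cancel, y_eq hc hn]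
    simp only [Matrix.cons_val_one, Matrix.cons_val_fin_one, smul_eq_mul]
    ring
  constructor
  · simp only [remainder, hBD, Pi.sub_apply, Pi.add_apply, Pi.smul_apply,
      inv_diagonal_mulVec hBD0, hX0, Matrix.cons_val_zero, smul_eq_mul, scoreSum, estError,
      ← hS₀]
    field_simp
    ring
  · simp only [remainder, hBD, Pi.sub_apply, Pi.add_apply, Pi.smul_apply,
      inv_diagonal_mulVec hBD0, hX1, Matrix.cons_val_one, Matrix.cons_val_fin_one, smul_eq_mul,
      scoreSum, estError, ← hS₀, ← hS₁]
    have e1 : (S₁ + centre c γ μ n * S₀) / √((n : ℝ) * k γ n) /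
        (σ ^ 2 / (-2 * c) * √((n : ℝ) * k γ n)) =
        (-2 * c / σ ^ 2) * ((S₁ + centre c γ μ n * S₀) / (n * k γ n)) := by
      generalize -2 * c = d at *
      generalize √((n : ℝ) * k γ n) = a at *
      rw [← hsq2]
      field_simp
    rw [e1]
    generalize -2 * c / σ ^ 2 = d
    field_simp
    ring

end Representation

/-! ### Bahadur representation for regular losses. -/

section

variable {Ω : Type*} [mΩ : MeasurableSpace Ω] {P : Measure Ω} [IsProbabilityMeasure P]
  {c γ σ q ξ : ℝ} {μ : ℕ → ℝ} {ε : ℕ → Ω → ℝ} {ϱ : ℝ → ℝ}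

omit [IsProbabilityMeasure P] in
theorem IsLittleOP.isBigOP_of_sub {f g : ℕ → Ω → ℝ} {a : ℝ}
    (h : IsLittleOP P (fun n ω => f n ω - a * g n ω)) (hg : IsBigOP P g) : IsBigOP P f := by
  refine (h.isBigOP.add (hg.mul_bounded (a := fun _ => a) |a|
    (Eventually.of_forall fun _ => le_rfl))).mono (Eventually.of_forall fun n ω => ?_)
  rw [sub_add_cancel]

/-- The Bahadur representation for a regular convex loss. -/
theorem bahadurRepresentation (he : IsInnovation P ε σ) (hc : c < 0) (hγ : γ ∈ Set.Ioo (0 : ℝ) 1)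
    (hϱ : IsRegularLoss P ϱ (fun ω => ε 1 ω - q) ξ) {ϑhat : ℕ → Ω → Fin 2 → ℝ}
    (hest : IsMEstimator P ϱ c γ μ ε ϑhat) :
    BahadurRepresentation P (leftDeriv ϱ) ξ q σ c γ μ ε ϑhat := by
  have hσ := he.pos
  have hr := isNearStationary_rho hc hγ
  set m := centre c γ μ with hm
  set s := scale σ (rho c γ) m with hs
  set x : ℕ → Ω → ℝ × ℝ := fun n ω => estError c γ σ q μ n (ϑhat n ω) with hx
  set W := scoreSum σ (rho c γ) m ε ϱ q with hW
  obtain ⟨hW1, hW2⟩ := isBigOP_scoreSum m he hr hϱ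
  obtain ⟨h1, h2⟩ := isLittleOP_argmin_sub_scoreSum m he hr hϱ (x := x) (by
    filter_upwards [hr.basic] with n hn
    exact hest.sum_le hσ hc hn.2.2.2 hn.2.2.1)
  have hx2 : IsBigOP P (fun n ω => (x n ω).2) := h2.isBigOP_of_sub hW2
  set b := -2 * c / σ ^ 2 with hb
  have hb0 : 0 < b := div_pos (by linarith) (by positivity)
  have scaled : ∀ {f : ℕ → Ω → ℝ}, IsBigOP P f → ∀ a : ℝ, IsBigOP P (fun n ω => a * f n ω) :=
    fun hf a => hf.mul_bounded (a := fun _ => a) |a| (Eventually.of_forall fun _ => le_rfl)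
  constructor
  · intro hμ
    refine tendstoInMeasure_fin_two ?_ ?_
    · refine ((h1.isBigOP.mul_tendsto tendsto_inv_sqrt).sub
        (hx2.mul_tendsto (tendsto_div_scale hσ hr m))).congr ?_
      filter_upwards [hr.basic] with n hn ω
      exact (remainder_apply hσ hc hn.2.2.2 hn.2.2.1 ϑhat ω).1
    · refine (((hx2.mul_tendsto (tendsto_inv_scale hσ hr m)).sub
        ((scaled hW2 (ξ⁻¹ * b)).mul_tendsto (tendsto_scale_div hσ hc hγ hμ))).sub
        ((scaled hW1 (ξ⁻¹ * b)).mul_tendsto (tendsto_centre_div (γ := γ) hc hμ))).congr ?_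
      filter_upwards [hr.basic] with n hn ω
      exact (remainder_apply hσ hc hn.2.2.2 hn.2.2.1 ϑhat ω).2
  · intro hμ
    have hθ := tendsto_sqrt_div_scale (μ := μ) hσ hc hγ hμ
    have hθ0 : 0 < √b := Real.sqrt_pos.2 hb0
    -- With `θ_n = √(n k_n) / s_n`, the second scaled remainder is `θ_n (x₂ - W₂ / ξ) + (θ_n - b /
    -- θ_n) W₂ / ξ` minus a term in `m_n / √k_n`. The middle coefficient vanishes because `θ_n →
    -- √b`, which is where the matrix `B` fits exactly.
    have hθ' : Tendsto (fun n : ℕ => √(n * k γ n) / s n - b / (√(n * k γ n) / s n)) atTop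
        (𝓝 0) := by
      have h := hθ.sub ((tendsto_const_nhds (x := b)).div hθ hθ0.ne')
      have e : √b - b / √b = 0 := by rw [Real.div_sqrt, sub_self]
      rw [← hb, e] at h
      exact h
    have hbd : ∀ᶠ n : ℕ in atTop, |√(n * k γ n) / s n| ≤ √b + 1 := by
      filter_upwards [hθ.abs.eventually (gt_mem_nhds (by
        rw [abs_of_pos hθ0]; linarith : |√b| < √b + 1))] with n hn using hn.le
    refine tendstoInMeasure_fin_two ?_ ?_
    · refine (h1.sub (hx2.mul_tendsto
        (tendsto_sqrt_mul_centre_div_scale (μ := μ) hσ hc hγ hμ))).congr ?_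
      filter_upwards [hr.basic] with n hn ω
      have hn' : (0 : ℝ) < n := by exact_mod_cast hn.2.2.2
      have hsn : 0 < √(n : ℝ) := Real.sqrt_pos.2 hn'
      rw [D, Matrix.mulVec_diagonal, (remainder_apply hσ hc hn.2.2.2 hn.2.2.1 ϑhat ω).1]
      simp only [Matrix.cons_val_zero]
      field_simp
      rfl
    · refine (((h2.mul_bounded (√b + 1) hbd).add
        ((scaled hW2 ξ⁻¹).mul_tendsto hθ')).sub
        ((scaled hW1 (ξ⁻¹ * b)).mul_tendsto (tendsto_centre_div_sqrt (μ := μ) hc hμ))).congr ?_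
      filter_upwards [hr.basic] with n hn ω
      have hn' : (0 : ℝ) < n := by exact_mod_cast hn.2.2.2
      have hk := k_pos (γ := γ) hn.2.2.2
      have hsn : 0 < √(n : ℝ) := Real.sqrt_pos.2 hn'
      have hsk : 0 < √(k γ n) := Real.sqrt_pos.2 hk
      have hs0 : 0 < s n := scale_pos hσ hn.2.2.1 hn.2.2.2
      rw [D, Matrix.mulVec_diagonal, (remainder_apply hσ hc hn.2.2.2 hn.2.2.1 ϑhat ω).2]
      simp only [Matrix.cons_val_one, Matrix.cons_val_fin_one]
      rw [Real.sqrt_mul hn'.le]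
      simp only [← hm, ← hs, ← hW, ← hb]
      change _ * (1 / s n * (x n ω).2 - _ - _) = _
      have e1 : (n : ℝ) * k γ n = (√(n : ℝ) * √(k γ n)) * (√(n : ℝ) * √(k γ n)) := by
        rw [mul_mul_mul_comm, Real.mul_self_sqrt hn'.le, Real.mul_self_sqrt hk.le]
      rw [e1]
      generalize √(n : ℝ) = a at *
      generalize √(k γ n) = d at *
      generalize ξ⁻¹ = ι
      field_simp
      ring

/-! ### The check loss and the quantile. -/

variable {τ : ℝ}

theorem checkLoss_of_nonpos {u : ℝ} (hu : u ≤ 0) : checkLoss τ u = (τ - 1) * u := by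
  rcases hu.lt_or_eq with h | h
  · rw [checkLoss, if_neg hu.not_gt, if_pos h]; ring
  · subst h; simp [checkLoss]

theorem checkLoss_of_pos {u : ℝ} (hu : 0 < u) : checkLoss τ u = τ * u := by
  rw [checkLoss, if_pos hu, if_neg hu.not_gt, sub_zero]

theorem checkLoss_eq_max (τ u : ℝ) : checkLoss τ u = max (τ * u) ((τ - 1) * u) := by
  rcases le_or_gt u 0 with h | h
  · rw [checkLoss_of_nonpos h, max_eq_right (by linarith)]
  · rw [checkLoss_of_pos h, max_eq_left (by linarith)]

theorem convexOn_checkLoss (τ : ℝ) : ConvexOn ℝ Set.univ (checkLoss τ) := by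
  refine ⟨convex_univ, fun x _ y _ a b ha hb _ => ?_⟩
  simp only [checkLoss_eq_max, smul_eq_mul]
  refine max_le ?_ ?_
  · have h1 := mul_le_mul_of_nonneg_left (le_max_left (τ * x) ((τ - 1) * x)) ha
    have h2 := mul_le_mul_of_nonneg_left (le_max_left (τ * y) ((τ - 1) * y)) hb
    linarith
  · have h1 := mul_le_mul_of_nonneg_left (le_max_right (τ * x) ((τ - 1) * x)) ha
    have h2 := mul_le_mul_of_nonneg_left (le_max_right (τ * y) ((τ - 1) * y)) hb
    linarith

/-- At the kink `u = 0` the left derivative is `τ - 1`, which matches the non-strict inequality in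
`quantileScore`. -/
theorem leftDeriv_checkLoss (τ : ℝ) : leftDeriv (checkLoss τ) = quantileScore τ := by
  ext u
  have hlin : ∀ a : ℝ, HasDerivWithinAt (fun x : ℝ => a * x) a (Set.Iio u) u := fun a => by
    simpa using (hasDerivWithinAt_id u (Set.Iio u)).const_mul a
  unfold leftDeriv
  rcases le_or_gt u 0 with h | h
  · rw [quantileScore, if_pos h]
    refine HasDerivWithinAt.derivWithin ?_ (uniqueDiffWithinAt_Iio u)
    exact (hlin (τ - 1)).congr
      (fun x (hx : x < u) => checkLoss_of_nonpos (hx.le.trans h)) (checkLoss_of_nonpos h)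
  · rw [quantileScore, if_neg h.not_ge, sub_zero]
    refine HasDerivWithinAt.derivWithin ?_ (uniqueDiffWithinAt_Iio u)
    refine (hlin τ).congr_of_eventuallyEq ?_ (checkLoss_of_pos h)
    filter_upwards [mem_nhdsWithin_of_mem_nhds (lt_mem_nhds h)] with x hx
    exact checkLoss_of_pos hx

theorem measurable_quantileScore (τ : ℝ) : Measurable (quantileScore τ) :=
  measurable_const.sub (Measurable.ite measurableSet_Iic measurable_const measurable_const)

theorem memLp_quantileScore {U : Ω → ℝ} (hU : Measurable U) (p : ENNReal) :
    MemLp (fun ω => quantileScore τ (U ω)) p P := by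
  refine MemLp.of_bound ((measurable_quantileScore τ).comp hU).aestronglyMeasurable (|τ| + 1)
    (ae_of_all _ fun ω => ?_)
  rw [Real.norm_eq_abs, quantileScore]
  refine (abs_sub _ _).trans ?_
  split_ifs <;> simp

theorem integral_quantileScore {Z : Ω → ℝ} (hZ : Measurable Z) (a : ℝ) :
    ∫ ω, quantileScore τ (Z ω - a) ∂P = τ - cdf (P.map Z) a := by
  have : IsProbabilityMeasure (P.map Z) := Measure.isProbabilityMeasure_map hZ.aemeasurable
  have hset : MeasurableSet (Z ⁻¹' Set.Iic a) := hZ measurableSet_Iic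
  have h : ∀ ω, quantileScore τ (Z ω - a) =
      τ - (Z ⁻¹' Set.Iic a).indicator (fun _ => (1 : ℝ)) ω := fun ω => by
    by_cases hω : Z ω ≤ a
    · rw [quantileScore, if_pos (sub_nonpos.2 hω), Set.indicator_of_mem (s := Z ⁻¹' Set.Iic a) hω]
    · rw [quantileScore, if_neg (fun h => hω (sub_nonpos.1 h)),
        Set.indicator_of_notMem (s := Z ⁻¹' Set.Iic a) hω]
  simp_rw [h]
  rw [integral_sub (integrable_const _) ((integrable_const _).indicator hset),
    integral_indicator_const _ hset, cdf_eq_real, map_measureReal_apply hZ measurableSet_Iic]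
  simp

/-- Left of the infimum the distribution function is below `τ`, and a sequence of points where it is
at least `τ` converges to the infimum. Continuity there carries both inequalities to the limit. -/
theorem cdf_quantile {ν : Measure ℝ} [IsProbabilityMeasure ν] (hτ : τ ∈ Set.Ioo (0 : ℝ) 1)
    (hcont : ContinuousAt (fun x => cdf ν x) (quantile ν τ)) : cdf ν (quantile ν τ) = τ := by
  set S := {x : ℝ | τ ≤ cdf ν x} with hS
  have hne : S.Nonempty := by
    obtain ⟨x, hx⟩ := ((tendsto_cdf_atTop ν).eventually (lt_mem_nhds hτ.2)).exists
    exact ⟨x, hx.le⟩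
  have hbdd : BddBelow S := by
    obtain ⟨x, hx⟩ := ((tendsto_cdf_atBot ν).eventually (gt_mem_nhds hτ.1)).exists
    refine ⟨x, fun z hz => ?_⟩
    by_contra hlt
    exact absurd (hz.trans (monotone_cdf ν (not_le.1 hlt).le)) (not_le.2 hx)
  refine le_antisymm ?_ ?_
  · refine le_of_tendsto (hcont.tendsto.mono_left (nhdsWithin_le_nhds (s := Set.Iio (quantile ν τ)))) ?_
    filter_upwards [self_mem_nhdsWithin] with x (hx : x < quantile ν τ)
    by_contra hlt
    exact absurd (csInf_le hbdd (not_le.1 hlt).le) (not_le.2 hx)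
  · obtain ⟨z, -, hz, hzS⟩ := exists_seq_tendsto_sInf hne hbdd
    exact ge_of_tendsto (hcont.tendsto.comp hz) (Eventually.of_forall hzS)

end

end NearStationaryAR

theorem theorem2 {Ω : Type*} [MeasurableSpace Ω] (P : Measure Ω) [IsProbabilityMeasure P]
    -- i.i.d. centred innovations with variance `σ² > 0` and a finite moment of order `2 + m`
    (ε : ℕ → Ω → ℝ) (hmeas : ∀ t, Measurable (ε t)) (hindep : iIndepFun ε P)
    (hident : ∀ t, IdentDistrib (ε t) (ε 1) P P)
    (σ : ℝ) (hσ : 0 < σ) (hmean : ∫ ω, ε 1 ω ∂P = 0) (hvar : variance (ε 1) P = σ ^ 2)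
    (hmom : ∃ m : ℝ, 0 < m ∧ MemLp (ε 1) (ENNReal.ofReal (2 + m)) P)
    -- near-stationary coefficients `ρ_n = 1 + c / n ^ γ`, and the intercepts `μ_n`
    (c γ : ℝ) (hc : c < 0) (hγ : γ ∈ Set.Ioo (0 : ℝ) 1) (μ : ℕ → ℝ) :
    -- M-regression with a convex loss `ϱ` whose left derivative is the score `ψ`
    (∀ (ϱ : ℝ → ℝ) (q : ℝ), ConvexOn ℝ Set.univ ϱ →
      (∃ m : ℝ, 0 < m ∧
        MemLp (fun ω => NearStationaryAR.leftDeriv ϱ (ε 1 ω - q)) (ENNReal.ofReal (2 + m)) P) →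
      (∀ᶠ θ : ℝ in 𝓝 0, MemLp (fun ω => NearStationaryAR.leftDeriv ϱ (ε 1 ω - q - θ)) 2 P) →
      ∫ ω, NearStationaryAR.leftDeriv ϱ (ε 1 ω - q) ∂P = 0 →
      NearStationaryAR.xi P (NearStationaryAR.leftDeriv ϱ) (fun ω => ε 1 ω - q) ≠ 0 →
      ∀ ϑhat : ℕ → Ω → Fin 2 → ℝ, NearStationaryAR.IsMEstimator P ϱ c γ μ ε ϑhat →
        NearStationaryAR.BahadurRepresentation P (NearStationaryAR.leftDeriv ϱ)
          (NearStationaryAR.xi P (NearStationaryAR.leftDeriv ϱ) (fun ω => ε 1 ω - q))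
          q σ c γ μ ε ϑhat) ∧
    -- quantile regression at level `τ`, when `ε_1` has the density `f`
    (∀ (τ : ℝ) (f : ℝ → ℝ), τ ∈ Set.Ioo (0 : ℝ) 1 →
      P.map (ε 1) = volume.withDensity (fun x => ENNReal.ofReal (f x)) →
      HasDerivAt (fun x => cdf (P.map (ε 1)) x)
        (f (NearStationaryAR.quantile (P.map (ε 1)) τ))
        (NearStationaryAR.quantile (P.map (ε 1)) τ) →
      0 < f (NearStationaryAR.quantile (P.map (ε 1)) τ) →
      ∀ ϑhat : ℕ → Ω → Fin 2 → ℝ,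
        NearStationaryAR.IsMEstimator P (NearStationaryAR.checkLoss τ) c γ μ ε ϑhat →
        NearStationaryAR.BahadurRepresentation P (NearStationaryAR.quantileScore τ)
          (f (NearStationaryAR.quantile (P.map (ε 1)) τ))
          (NearStationaryAR.quantile (P.map (ε 1)) τ) σ c γ μ ε ϑhat) := by
  have hL2 : MemLp (ε 1) 2 P := by
    obtain ⟨p, hp, h⟩ := hmom
    refine h.mono_exponent ?_
    rw [← ENNReal.ofReal_ofNat 2]
    exact ENNReal.ofReal_le_ofReal (by linarith)
  have he : NearStationaryAR.IsInnovation P ε σ :=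
    { meas := hmeas
      indep := hindep
      ident := hident
      memLp := hL2
      mean := hmean
      var := by
        rw [← hvar, variance_of_integral_eq_zero (hmeas 1).aemeasurable hmean]
      pos := hσ }
  constructor
  · intro ϱ q hϱ _ hnear hzero hxi ϑhat hest
    refine NearStationaryAR.bahadurRepresentation he hc hγ ?_ hest
    exact
      { convex := hϱ
        memLp := by simpa using hnear.self_of_nhds
        near := hnear
        mean := hzero
        deriv := NearStationaryAR.hasDerivAt_of_xi_ne_zero hϱ hnear hxi
        pos := lt_of_le_of_ne (abs_nonneg _) hxi.symm }
  · intro τ f hτ _ hderiv hpos ϑhat hest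
    have : IsProbabilityMeasure (P.map (ε 1)) :=
      Measure.isProbabilityMeasure_map (hmeas 1).aemeasurable
    set q := NearStationaryAR.quantile (P.map (ε 1)) τ with hq
    have hF := NearStationaryAR.cdf_quantile hτ hderiv.continuousAt
    rw [← NearStationaryAR.leftDeriv_checkLoss]
    refine NearStationaryAR.bahadurRepresentation he hc hγ ?_ hest
    exact
      { convex := NearStationaryAR.convexOn_checkLoss τ
        memLp := by
          rw [NearStationaryAR.leftDeriv_checkLoss]
          exact NearStationaryAR.memLp_quantileScore ((hmeas 1).sub_const q) 2
        near := Eventually.of_forall fun θ => by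
          rw [NearStationaryAR.leftDeriv_checkLoss]
          exact NearStationaryAR.memLp_quantileScore (((hmeas 1).sub_const q).sub_const θ) 2
        mean := by
          rw [NearStationaryAR.leftDeriv_checkLoss,
            NearStationaryAR.integral_quantileScore (hmeas 1), hq, hF, sub_self]
        deriv := by
          simp only [NearStationaryAR.leftDeriv_checkLoss, sub_sub,
            NearStationaryAR.integral_quantileScore (hmeas 1)]
          -- The mean score at `θ` is `τ - F(q + θ)`, so its slope at 0 is `-f q` and the density
          -- plays the role of `ξ`.
          have h : HasDerivAt (fun θ : ℝ => cdf (P.map (ε 1)) (q + θ)) (f q) 0 := by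
            refine HasDerivAt.comp_const_add q 0 ?_
            rwa [add_zero]
          exact h.const_sub τ
        pos := hpos }
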